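/- Let $C^\infty(\mathbb R/\mathbb Z)$ be the space of smooth $1$-periodic functions on $\mathbb R$ with the Whitney $C^\infty$ topology, which on the compact circle is the topology of uniform convergence of all derivatives. Let $\Omega\subset C^\infty(\mathbb R/\mathbb Z)\times C^\infty(\mathbb R/\mathbb Z)$, with the induced topology, be the set of pairs $(U_1,U_2)$ such that each $U_i$ has exactly one local minimum and one local maximum in $[0,1)$, $U_i''\neq 0$ at every critical point of $U_i$, and $U_1(q_1)>U_2(q_2)$ for all $q_1,q_2\in\mathbb R$. The pair represents the Liouville metric $(U_1(q_1)-U_2(q_2))(dq_1^2+dq_2^2)$ on $\mathbb R^2/\mathbb Z^2$. For $(U_1,U_2)\in\Omega$ put $c_1=\max U_1$, $c_2=\min U_1$, $c_3=\max U_2$, $c_4=\min U_2$, so that $c_4<c_3<c_2<c_1$, and for $c\in[c_4,c_1]$ $$F_1(c)=\int_{\{q\in[0,1]\,:\,U_1(q)\ge c\}}\sqrt{U_1(q)-c}\,dq,\qquad F_2(c)=\int_{\{q\in[0,1]\,:\,U_2(q)\le c\}}\sqrt{c-U_2(q)}\,dq .$$ Let $$\kappa(c)=\frac{F_2''(c)F_1'(c)-F_1''(c)F_2'(c)}{\left(F_1'(c)^2+F_2'(c)^2\right)^{3/2}}\qquad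 (c\in[c_4,c_1]\setminus\{c_2,c_3\})$$ be the curvature of the curve $\gamma(c)=(F_1(c),F_2(c))$; derivatives at $c_4$ and $c_1$ are one-sided. A real number $\alpha$ is called typical if there are $\tau>0$ and $\delta>0$ such that $|k_1+\alpha k_2|\ge \delta/\bigl(|k_2|(\log(1+|k_2|))^{\tau}\bigr)$ for all $k_1,k_2\in\mathbb Z$ with $k_2\ne0$. The metric represented by $(U_1,U_2)\in\Omega$ is nondegenerate if 1. $\kappa$ has finitely many zeros on $[c_4,c_3)\cup(c_2,c_1]$, each of first order; 2. $F_2'(c)/F_1'(c)$ is typical for each such zero $c$; 3. $F_2'(c_i)/F_1'(c_i)$ is typical for $i=1,4$; 4. $F_2(c_i)/F_1(c_i)$ is typical for $i=2,3$. Then the set of pairs $(U_1,U_2)\in\Omega$ that represent nondegenerate metrics is dense in $\Omega$. -/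

import Mathlib

open Set MeasureTheory
open scoped ContDiff

noncomputable section

namespace Liouville

/-- Smooth real functions on the circle `ℝ / ℤ`, seen as smooth `1`-periodic functions on `ℝ`. -/
structure CircleFun where
  /-- The underlying `1`-periodic function on the line. -/
  toFun : ℝ → ℝ
  smooth : ContDiff ℝ ∞ toFun
  periodic : Function.Periodic toFun 1

instance : CoeFun CircleFun (fun _ => ℝ → ℝ) := ⟨CircleFun.toFun⟩

/-- The Whitney `C^∞` topology on `C^∞(ℝ / ℤ)`. As the circle is compact, it is the coarsest
topology for which every map `f ↦ f^(k)` is continuous into the space of functions with the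
topology of uniform convergence (`ℝ →ᵤ ℝ`). -/
instance : TopologicalSpace CircleFun :=
  ⨅ k : ℕ, TopologicalSpace.induced
    (fun f : CircleFun => UniformFun.ofFun (iteratedDeriv k f.toFun)) inferInstance

/-- `U` has exactly one (local) minimum and one (local) maximum in `[0, 1)`, and the second
derivative does not vanish at critical points. -/
def HasSimpleExtrema (U : ℝ → ℝ) : Prop :=
  (∃! m, m ∈ Ico (0 : ℝ) 1 ∧ IsLocalMin U m) ∧
  (∃! M, M ∈ Ico (0 : ℝ) 1 ∧ IsLocalMax U M) ∧
  ∀ q : ℝ, deriv U q = 0 → iteratedDeriv 2 U q ≠ 0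

/-- The set `Ω` of pairs `(U₁, U₂)`, representing the Liouville metrics
`(U₁(q₁) - U₂(q₂)) (dq₁² + dq₂²)` on `ℝ² / ℤ²`. -/
def Omega : Set (CircleFun × CircleFun) :=
  {U | HasSimpleExtrema U.1 ∧ HasSimpleExtrema U.2 ∧ ∀ q₁ q₂ : ℝ, U.2 q₂ < U.1 q₁}

/-- The maximum of a periodic function over a period. -/
def maxVal (U : ℝ → ℝ) : ℝ := sSup (U '' Icc 0 1)

/-- The minimum of a periodic function over a period. -/
def minVal (U : ℝ → ℝ) : ℝ := sInf (U '' Icc 0 1)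

/-- `c₁ = max U₁`. -/
def c₁ (U : CircleFun × CircleFun) : ℝ := maxVal U.1

/-- `c₂ = min U₁`. -/
def c₂ (U : CircleFun × CircleFun) : ℝ := minVal U.1

/-- `c₃ = max U₂`. -/
def c₃ (U : CircleFun × CircleFun) : ℝ := maxVal U.2

/-- `c₄ = min U₂`. -/
def c₄ (U : CircleFun × CircleFun) : ℝ := minVal U.2

/-- The first action variable, at energy level one. For `c ≤ c₂` the domain of integration is the
whole period. -/
def F₁ (U : CircleFun × CircleFun) (c : ℝ) : ℝ :=
  ∫ q in {q : ℝ | q ∈ Icc (0 : ℝ) 1 ∧ c ≤ U.1 q}, √(U.1 q - c)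

/-- The second action variable, at energy level one. For `c₃ ≤ c` the domain of integration is the
whole period. -/
def F₂ (U : CircleFun × CircleFun) (c : ℝ) : ℝ :=
  ∫ q in {q : ℝ | q ∈ Icc (0 : ℝ) 1 ∧ U.2 q ≤ c}, √(c - U.2 q)

/-- `F₁'` on `[c₄, c₁]`, one-sided at the endpoints. -/
def dF₁ (U : CircleFun × CircleFun) (c : ℝ) : ℝ := derivWithin (F₁ U) (Icc (c₄ U) (c₁ U)) c

/-- `F₂'` on `[c₄, c₁]`, one-sided at the endpoints. -/
def dF₂ (U : CircleFun × CircleFun) (c : ℝ) : ℝ := derivWithin (F₂ U) (Icc (c₄ U) (c₁ U)) c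

/-- `F₁''` on `[c₄, c₁]`, one-sided at the endpoints. -/
def ddF₁ (U : CircleFun × CircleFun) (c : ℝ) : ℝ := derivWithin (dF₁ U) (Icc (c₄ U) (c₁ U)) c

/-- `F₂''` on `[c₄, c₁]`, one-sided at the endpoints. -/
def ddF₂ (U : CircleFun × CircleFun) (c : ℝ) : ℝ := derivWithin (dF₂ U) (Icc (c₄ U) (c₁ U)) c

/-- The curvature at `(F₁(c), F₂(c))` of the curve `γ` parametrized by `c ∈ [c₄, c₁]`
(it is meaningful for `c ≠ c₂, c₃`). -/
def curvature (U : CircleFun × CircleFun) (c : ℝ) : ℝ :=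
  (ddF₂ U c * dF₁ U c - ddF₁ U c * dF₂ U c) / (dF₁ U c ^ 2 + dF₂ U c ^ 2) ^ (3 / 2 : ℝ)

/-- The zeros of the curvature on `[c₄, c₃) ∪ (c₂, c₁]`. -/
def curvatureZeros (U : CircleFun × CircleFun) : Set ℝ :=
  {c | c ∈ Ico (c₄ U) (c₃ U) ∪ Ioc (c₂ U) (c₁ U) ∧ curvature U c = 0}

/-- Typical real numbers. -/
def IsTypical (α : ℝ) : Prop :=
  ∃ τ : ℝ, 0 < τ ∧ ∃ δ : ℝ, 0 < δ ∧ ∀ k₁ k₂ : ℤ, k₂ ≠ 0 →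
    δ / (|(k₂ : ℝ)| * Real.log (1 + |(k₂ : ℝ)|) ^ τ) ≤ |(k₁ : ℝ) + α * k₂|

/-- Nondegeneracy of the metric represented by the pair `U`. -/
structure IsNondegenerate (U : CircleFun × CircleFun) : Prop where
  mem_Omega : U ∈ Omega
  finite_zeros : (curvatureZeros U).Finite
  /-- Every zero of the curvature is of first order. -/
  simple_zeros : ∀ c ∈ curvatureZeros U,
    derivWithin (curvature U) (Icc (c₄ U) (c₁ U)) c ≠ 0
  typical_zeros : ∀ c ∈ curvatureZeros U, IsTypical (dF₂ U c / dF₁ U c)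
  typical_slope_c₁ : IsTypical (dF₂ U (c₁ U) / dF₁ U (c₁ U))
  typical_slope_c₄ : IsTypical (dF₂ U (c₄ U) / dF₁ U (c₄ U))
  typical_ratio_c₂ : IsTypical (F₂ U (c₂ U) / F₁ U (c₂ U))
  typical_ratio_c₃ : IsTypical (F₂ U (c₃ U) / F₁ U (c₃ U))

end Liouville

end

/-!
The proof perturbs `U₂` alone, along a one-parameter family that keeps its extreme values.

In a suitable coordinate `y` on the circle, a function with simple extrema is `α - β cos (2 π y)`
(`HasSimpleExtrema.exists_normalForm`): the angle is an integral of `|U'| / √((max - U)(U - min))`,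
and this speed extends smoothly over the critical points by Hadamard's lemma. After the change of
variables `q = Φ y`, both actions become pendulum integrals
`∫ √(z - sin² (π y)) Θ (sin² (π y)) dy`, where the density `Θ` comes from the even part of `Φ'`
(`IsNormalForm.action_eq`, `IsCircleDiffeo.exists_density`). They are linear in `Θ`, and below and
above the critical energy `z = 1` their derivatives have explicit integral formulas.

Write `F₂' = A` and `F₁' = -B`. The curvature vanishes exactly where `A / B` has a critical point,
and the order of the zero and the slope are read off from the second derivative and the critical
value. Changing the density of `U₂` by `ε E` changes `A` into `A + ε a`. If `a / B` has no critical
point, then for almost every `ε` the function `A / B + ε a / B` has only nondegenerate critical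
points, with critical values outside a given null set. This is Sard's theorem applied to
`g = -(A / B)' / (a / B)'`, since the critical points of `A / B + ε a / B` are the solutions of
`g = ε` (`volume_bad_pencil`). Almost every number is typical (`volume_not_isTypical`), so each
of the slopes at `c₁`, `c₄` and the ratios at `c₂`, `c₃`, which are nonconstant affine functions of
`ε`, is typical outside a null set of `ε`.

It remains to find an `E` of mean zero for which `a / B` has no critical point. Near `c₃` and `c₂`
none is needed, as there the logarithmic singularity of one of the two actions gives the curvature a
sign, uniformly in the density (`exists_wronskian_pos_below`, `exists_wronskian_pos_above`). This
leaves two compact intervals, on which `B' / B` is bounded, so that a large `|a' / a|` suffices. Below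
`c₃` a factor `(1 + x) ^ n` does this, by Chebyshev's integral inequality (`libration_growth`). Above
`c₂` one adds a large multiple of the `j`-th derivative of a bump function supported close to the
critical energy: after `j` integrations by parts its action is an integral of a high negative power
of `z - x` (`exists_perturbation`).
-/

open Filter Topology

namespace Liouville

/-! ### Smooth families of functions and diffeomorphisms of the circle -/

/-- The partial derivative in the second variable of a jointly smooth function is jointly smooth. -/
theorem contDiff_deriv_snd {G : ℝ → ℝ → ℝ} (hG : ContDiff ℝ ∞ fun p : ℝ × ℝ => G p.1 p.2) :
    ContDiff ℝ ∞ fun p : ℝ × ℝ => deriv (G p.1) p.2 := by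
  have h1 : ∀ p : ℝ × ℝ, deriv (G p.1) p.2 =
      fderiv ℝ (fun p : ℝ × ℝ => G p.1 p.2) p (0, 1) := by
    intro p
    have hd : HasFDerivAt (fun p : ℝ × ℝ => G p.1 p.2)
        (fderiv ℝ (fun p : ℝ × ℝ => G p.1 p.2) p) (p.1, p.2) :=
      ((hG.differentiable (by simp)) p).hasFDerivAt
    have h2 : HasDerivAt (fun y : ℝ => (p.1, y)) ((0 : ℝ), (1 : ℝ)) p.2 :=
      (hasDerivAt_const _ _).prodMk (hasDerivAt_id _)
    exact (hd.comp_hasDerivAt p.2 h2).deriv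
  simp_rw [h1]
  exact (hG.fderiv_right (by simp)).clm_apply contDiff_const

theorem contDiff_iteratedDeriv_snd {G : ℝ → ℝ → ℝ}
    (hG : ContDiff ℝ ∞ fun p : ℝ × ℝ => G p.1 p.2) (k : ℕ) :
    ContDiff ℝ ∞ fun p : ℝ × ℝ => iteratedDeriv k (G p.1) p.2 := by
  induction k with
  | zero => simpa using hG
  | succ k ih =>
    simp_rw [iteratedDeriv_succ]
    exact contDiff_deriv_snd (G := fun t => iteratedDeriv k (G t)) ih

theorem periodic_deriv {f : ℝ → ℝ} {T : ℝ} (hf : Function.Periodic f T) :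
    Function.Periodic (deriv f) T := by
  intro x
  rw [← deriv_comp_add_const]
  congr 1
  exact funext hf

theorem periodic_iteratedDeriv {f : ℝ → ℝ} {T : ℝ} (hf : Function.Periodic f T) (k : ℕ) :
    Function.Periodic (iteratedDeriv k f) T := by
  induction k with
  | zero => simpa using hf
  | succ k ih => rw [iteratedDeriv_succ]; exact periodic_deriv ih

/-- A family of functions on the circle that is jointly smooth in the parameter and the variable
is continuous for the `C^∞` topology. -/
theorem continuous_of_contDiff_family (G : ℝ → CircleFun)
    (hG : ContDiff ℝ ∞ fun p : ℝ × ℝ => G p.1 p.2) : Continuous G := by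
  refine continuous_iInf_rng.2 fun k => continuous_induced_rng.2 ?_
  rw [continuous_iff_continuousAt]
  intro t₀
  rw [ContinuousAt, UniformFun.tendsto_iff_tendstoUniformly, Metric.tendstoUniformly_iff]
  intro ε hε
  have hc : Continuous fun p : ℝ × ℝ => iteratedDeriv k (G p.1) p.2 :=
    (contDiff_iteratedDeriv_snd (G := fun t => (G t).toFun) hG k).continuous
  have key : ∀ᶠ t in 𝓝 t₀, ∀ x ∈ Icc (0 : ℝ) 1,
      dist (iteratedDeriv k (G t₀) x) (iteratedDeriv k (G t) x) < ε := by
    refine isCompact_Icc.eventually_forall_of_forall_eventually fun x _ => ?_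
    have h1 : Continuous fun p : ℝ × ℝ =>
        dist (iteratedDeriv k (G t₀) p.2) (iteratedDeriv k (G p.1) p.2) :=
      (hc.comp (continuous_const.prodMk continuous_snd)).dist hc
    have := h1.tendsto (t₀, x)
    simp only [dist_self] at this
    exact this.eventually (gt_mem_nhds hε)
  filter_upwards [key] with t ht x
  have h2 := fun s : ℝ => periodic_iteratedDeriv (G s).periodic k
  obtain ⟨n, hn, -⟩ := existsUnique_sub_zsmul_mem_Ico (zero_lt_one' ℝ) x 0
  have h3 := ht (x - n • 1) ⟨hn.1, by simpa using hn.2.le⟩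
  rw [(h2 t₀).sub_zsmul_eq, (h2 t).sub_zsmul_eq] at h3
  exact h3

/-- A lift to the line of an orientation preserving smooth diffeomorphism of the circle. -/
structure IsCircleDiffeo (Φ : ℝ → ℝ) : Prop where
  smooth : ContDiff ℝ ∞ Φ
  add_one : ∀ y, Φ (y + 1) = Φ y + 1
  deriv_pos : ∀ y, 0 < deriv Φ y

namespace IsCircleDiffeo

variable {Φ : ℝ → ℝ} (h : IsCircleDiffeo Φ)
include h

theorem strictMono : StrictMono Φ := strictMono_of_deriv_pos h.deriv_pos

theorem add_int (y : ℝ) (n : ℤ) : Φ (y + n) = Φ y + n := by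
  have h1 : Function.Periodic (fun y => Φ y - y) 1 := fun y => by simp [h.add_one]
  have := h1.int_mul n y
  simp only [mul_one] at this
  linarith

theorem surjective : Function.Surjective Φ := by
  refine h.smooth.continuous.surjective ?_ ?_
  · refine tendsto_atTop_atTop.2 fun b => ⟨((⌈b - Φ 0⌉ : ℤ) : ℝ), fun a ha => ?_⟩
    have h1 := h.strictMono.monotone ha
    have h2 := h.add_int 0 ⌈b - Φ 0⌉
    have h3 := Int.le_ceil (b - Φ 0)
    rw [zero_add] at h2
    linarith
  · refine tendsto_atBot_atBot.2 fun b => ⟨((⌊b - Φ 0⌋ : ℤ) : ℝ), fun a ha => ?_⟩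
    have h1 := h.strictMono.monotone ha
    have h2 := h.add_int 0 ⌊b - Φ 0⌋
    have h3 := Int.floor_le (b - Φ 0)
    rw [zero_add] at h2
    linarith

end IsCircleDiffeo

/-- The inverses of a jointly smooth family of circle diffeomorphisms form a jointly smooth
family. -/
theorem exists_smooth_inverse_family {Φ : ℝ → ℝ → ℝ}
    (hΦ : ContDiff ℝ ∞ fun p : ℝ × ℝ => Φ p.1 p.2) (h : ∀ t, IsCircleDiffeo (Φ t)) :
    ∃ Ψ : ℝ → ℝ → ℝ, (ContDiff ℝ ∞ fun p : ℝ × ℝ => Ψ p.1 p.2) ∧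
      (∀ t y, Ψ t (Φ t y) = y) ∧ ∀ t x, Φ t (Ψ t x) = x := by
  choose Ψ hΨ using fun t => (h t).surjective
  have hl : ∀ t y, Ψ t (Φ t y) = y := fun t y => (h t).strictMono.injective (hΨ t _)
  refine ⟨Ψ, ?_, hl, hΨ⟩
  rw [contDiff_iff_contDiffAt]
  rintro ⟨t₀, x₀⟩
  -- the inverse function theorem for `(t, y) ↦ (t, Φ t y)`
  set p₀ : ℝ × ℝ := (t₀, Ψ t₀ x₀) with hp₀
  set F : ℝ × ℝ → ℝ × ℝ := fun p => (p.1, Φ p.1 p.2) with hF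
  have hFs : ContDiff ℝ ∞ F := contDiff_fst.prodMk hΦ
  set L := fderiv ℝ (fun p : ℝ × ℝ => Φ p.1 p.2) p₀ with hL
  have hLd : HasFDerivAt (fun p : ℝ × ℝ => Φ p.1 p.2) L p₀ :=
    ((hΦ.differentiable (by simp)) p₀).hasFDerivAt
  have hb : 0 < L (0, 1) := by
    have h2 : HasDerivAt (fun y : ℝ => (t₀, y)) ((0 : ℝ), (1 : ℝ)) (Ψ t₀ x₀) :=
      (hasDerivAt_const _ _).prodMk (hasDerivAt_id _)
    have h3 := (HasFDerivAt.comp_hasDerivAt (Ψ t₀ x₀) (hLd : HasFDerivAt _ L (t₀, Ψ t₀ x₀)) h2).deriv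
    have h4 := (h t₀).deriv_pos (Ψ t₀ x₀)
    have h5 : deriv (Φ t₀) (Ψ t₀ x₀) = L (0, 1) := h3
    rwa [h5] at h4
  have hFd : HasFDerivAt F ((ContinuousLinearMap.fst ℝ ℝ ℝ).prod L) p₀ :=
    hasFDerivAt_fst.prodMk hLd
  have hLs : ∀ v : ℝ × ℝ, L v = v.1 * L (1, 0) + v.2 * L (0, 1) := by
    intro v
    have : v = v.1 • ((1 : ℝ), (0 : ℝ)) + v.2 • ((0 : ℝ), (1 : ℝ)) := by ext <;> simp
    conv_lhs => rw [this, map_add, map_smul, map_smul]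
    simp
  have hinj : Function.Injective ((ContinuousLinearMap.fst ℝ ℝ ℝ).prod L) := by
    rw [injective_iff_map_eq_zero]
    rintro ⟨v, w⟩ hv
    simp only [ContinuousLinearMap.prod_apply, ContinuousLinearMap.coe_fst', Prod.mk_eq_zero] at hv
    obtain ⟨rfl, h2⟩ := hv
    rw [hLs] at h2
    simp only [zero_mul, zero_add, mul_eq_zero, hb.ne', or_false] at h2
    simp [h2]
  have hsurj : Function.Surjective ((ContinuousLinearMap.fst ℝ ℝ ℝ).prod L) := by
    have := (LinearMap.injective_iff_surjective
      (f := (((ContinuousLinearMap.fst ℝ ℝ ℝ).prod L : ℝ × ℝ →L[ℝ] ℝ × ℝ) : ℝ × ℝ →ₗ[ℝ] ℝ × ℝ))).1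
        hinj
    exact this
  let e : (ℝ × ℝ) ≃L[ℝ] (ℝ × ℝ) := ContinuousLinearEquiv.ofBijective
    ((ContinuousLinearMap.fst ℝ ℝ ℝ).prod L) (LinearMap.ker_eq_bot.2 hinj)
    (LinearMap.range_eq_top.2 hsurj)
  have hFe : HasFDerivAt F (e : ℝ × ℝ →L[ℝ] ℝ × ℝ) p₀ := hFd
  have hFp : F p₀ = (t₀, x₀) := by simp [hF, hp₀, hΨ]
  have hstr : HasStrictFDerivAt F (e : ℝ × ℝ →L[ℝ] ℝ × ℝ) p₀ :=
    hFs.contDiffAt.hasStrictFDerivAt' hFe (by simp)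
  have hsm : ContDiffAt ℝ ∞ (hstr.localInverse F e p₀) (F p₀) :=
    (hFs.contDiffAt (x := p₀)).to_localInverse hFe (by simp)
  have hri := hstr.eventually_right_inverse
  rw [hFp] at hsm hri
  refine (contDiff_snd.contDiffAt.comp (t₀, x₀) hsm).congr_of_eventuallyEq ?_
  filter_upwards [hri] with q hq
  have h1 : (hstr.localInverse F e p₀ q).1 = q.1 := by
    have := congrArg Prod.fst hq; exact this
  have h2 : Φ (hstr.localInverse F e p₀ q).1 (hstr.localInverse F e p₀ q).2 = q.2 := by
    have := congrArg Prod.snd hq; exact this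
  have h3 := hl q.1 (hstr.localInverse F e p₀ q).2
  rw [← h1, h2, h1] at h3
  exact h3

/-! ### Hadamard's lemma and smooth quotients -/

/-- Differentiation under the integral sign over a compact interval. -/
theorem hasDerivAt_intervalIntegral {F F' : ℝ → ℝ → ℝ} {V : Set ℝ} (hV : IsOpen V) {a b : ℝ}
    (hab : a ≤ b) (hF : ContinuousOn (fun p : ℝ × ℝ => F p.1 p.2) (V ×ˢ Icc a b))
    (hF' : ContinuousOn (fun p : ℝ × ℝ => F' p.1 p.2) (V ×ˢ Icc a b))
    (hd : ∀ z ∈ V, ∀ t ∈ Icc a b, HasDerivAt (fun z => F z t) (F' z t) z) {z : ℝ} (hz : z ∈ V) :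
    HasDerivAt (fun z => ∫ t in a..b, F z t) (∫ t in a..b, F' z t) z := by
  obtain ⟨r, hr, hrV⟩ := Metric.nhds_basis_closedBall.mem_iff.1 (hV.mem_nhds hz)
  obtain ⟨C, hC⟩ := ((isCompact_closedBall z r).prod isCompact_Icc).exists_bound_of_continuousOn
    (hF'.mono (prod_mono_left hrV))
  have slice : ∀ {g : ℝ → ℝ → ℝ}, ContinuousOn (fun p : ℝ × ℝ => g p.1 p.2) (V ×ˢ Icc a b) →
      ∀ x ∈ V, IntervalIntegrable (g x) volume a b := by
    intro g hg x hx
    refine ContinuousOn.intervalIntegrable ?_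
    rw [uIcc_of_le hab]
    exact hg.comp (f := fun t => (x, t)) (by fun_prop) fun t ht => ⟨hx, ht⟩
  refine (intervalIntegral.hasDerivAt_integral_of_dominated_loc_of_deriv_le
    (F := F) (F' := F') (bound := fun _ => C) (Metric.closedBall_mem_nhds z hr) ?_ (slice hF z hz)
    (slice hF' z hz).def'.aestronglyMeasurable ?_ intervalIntegrable_const ?_).2
  · filter_upwards [hV.mem_nhds hz] with x hx
    exact (slice hF x hx).def'.aestronglyMeasurable
  · refine .of_forall fun t ht x hx => hC (x, t) ⟨hx, ?_⟩
    rw [uIoc_of_le hab] at ht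
    exact Ioc_subset_Icc_self ht
  · refine .of_forall fun t ht x hx => hd x (hrV hx) t ?_
    rw [uIoc_of_le hab] at ht
    exact Ioc_subset_Icc_self ht

/-- The integrals in Hadamard's lemma are smooth. The weight `t ^ j` makes the induction on the order
of differentiability work, as differentiation in `x` raises `j` by one. -/
theorem contDiff_hadamard_integral (a : ℝ) (n : ℕ) : ∀ (j : ℕ) {f : ℝ → ℝ}, ContDiff ℝ ∞ f →
    ContDiff ℝ n fun x => ∫ t in (0 : ℝ)..1, t ^ j * f (a + t * (x - a)) := by
  have key : ∀ (j : ℕ) {f : ℝ → ℝ}, ContDiff ℝ ∞ f → ∀ x,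
      HasDerivAt (fun x => ∫ t in (0 : ℝ)..1, t ^ j * f (a + t * (x - a)))
        (∫ t in (0 : ℝ)..1, t ^ (j + 1) * deriv f (a + t * (x - a))) x := by
    intro j f hf x
    have hc := hf.continuous
    have hc' : Continuous (deriv f) := hf.continuous_deriv (by simp)
    refine hasDerivAt_intervalIntegral (F := fun x t => t ^ j * f (a + t * (x - a)))
      (F' := fun x t => t ^ (j + 1) * deriv f (a + t * (x - a))) isOpen_univ zero_le_one
      (by fun_prop) (by fun_prop) (fun z _ t _ => ?_) (mem_univ x)
    have h1 : HasDerivAt (fun z => a + t * (z - a)) (t * 1) z :=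
      (((hasDerivAt_id z).sub_const a).const_mul t).const_add a
    have h2 := (((hf.differentiable (by simp)) (a + t * (z - a))).hasDerivAt.comp z h1).const_mul
      (t ^ j)
    exact h2.congr_deriv (by ring)
  induction n with
  | zero =>
    intro j f hf
    exact contDiff_zero.2 (continuous_iff_continuousAt.2 fun x => (key j hf x).continuousAt)
  | succ n ih =>
    intro j f hf
    push_cast
    refine contDiff_succ_iff_deriv.2 ⟨fun x => (key j hf x).differentiableAt, by simp, ?_⟩
    rw [funext fun x => (key j hf x).deriv]
    exact ih (j + 1) (contDiff_infty_iff_deriv.1 hf).2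

/-- Hadamard's lemma: a smooth function vanishing at `a` is `x - a` times a smooth function. -/
theorem exists_hadamard {f : ℝ → ℝ} (hf : ContDiff ℝ ∞ f) {a : ℝ} (ha : f a = 0) :
    ∃ g : ℝ → ℝ, ContDiff ℝ ∞ g ∧ (∀ x, f x = (x - a) * g x) ∧ g a = deriv f a := by
  have hc' : Continuous (deriv f) := hf.continuous_deriv (by simp)
  refine ⟨fun x => ∫ t in (0 : ℝ)..1, deriv f (a + t * (x - a)), ?_, fun x => ?_, by simp⟩
  · refine contDiff_infty.2 fun n => ?_
    simpa using contDiff_hadamard_integral a n 0 (contDiff_infty_iff_deriv.1 hf).2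
  · have h : ∀ t ∈ uIcc (0 : ℝ) 1, HasDerivAt (fun t => f (a + t * (x - a)))
        (deriv f (a + t * (x - a)) * (x - a)) t := by
      intro t _
      have h1 : HasDerivAt (fun t => a + t * (x - a)) (1 * (x - a)) t :=
        ((hasDerivAt_id t).mul_const _).const_add a
      rw [one_mul] at h1
      exact ((hf.differentiable (by simp)) (a + t * (x - a))).hasDerivAt.comp t h1
    have h2 := intervalIntegral.integral_eq_sub_of_hasDerivAt h
      (Continuous.intervalIntegrable (by fun_prop) _ _)
    rw [intervalIntegral.integral_mul_const] at h2
    simp only [one_mul, add_sub_cancel, zero_mul, add_zero, ha, sub_zero] at h2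
    rw [← h2, mul_comm]

/-- If `s` has only simple zeros and `f` vanishes at them, then `f / s` extends smoothly. -/
theorem exists_smooth_quotient {f s : ℝ → ℝ} (hf : ContDiff ℝ ∞ f) (hs : ContDiff ℝ ∞ s)
    (h0 : ∀ x, s x = 0 → f x = 0) (h1 : ∀ x, s x = 0 → deriv s x ≠ 0) :
    ∃ g : ℝ → ℝ, ContDiff ℝ ∞ g ∧ ∀ x, f x = s x * g x := by
  classical
  refine ⟨fun x => if s x = 0 then deriv f x / deriv s x else f x / s x, ?_, fun x => ?_⟩
  · rw [contDiff_iff_contDiffAt]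
    intro a
    by_cases ha : s a = 0
    · obtain ⟨k, hk, hsk, hka⟩ := exists_hadamard hs ha
      obtain ⟨g, hg, hfg, hga⟩ := exists_hadamard hf (h0 a ha)
      have hk0 : k a ≠ 0 := hka ▸ h1 a ha
      refine (hg.contDiffAt.div hk.contDiffAt hk0).congr_of_eventuallyEq ?_
      filter_upwards [hk.continuous.continuousAt.eventually_ne hk0] with x hx
      by_cases hxa : x = a
      · subst hxa
        simp [ha, hka, hga]
      · have hxa' := sub_ne_zero.2 hxa
        rw [hsk, hfg]
        simp only [mul_eq_zero, hxa', hx, or_self, if_false]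
        rw [mul_div_mul_left _ _ hxa', Pi.div_apply]
    · refine (hf.contDiffAt.div hs.contDiffAt ha).congr_of_eventuallyEq ?_
      filter_upwards [hs.continuous.continuousAt.eventually_ne ha] with x hx
      simp [hx]
  · by_cases hx : s x = 0
    · simp [hx, h0 x hx]
    · simp only [hx, if_false]
      field_simp

/-! ### Even periodic functions as functions of the squared sine -/

theorem hasDerivAt_sin_sq (y : ℝ) :
    HasDerivAt (fun y => Real.sin (Real.pi * y) ^ 2) (Real.pi * Real.sin (2 * Real.pi * y)) y := by
  have h1 : HasDerivAt (fun y => Real.pi * y) (Real.pi * 1) y := (hasDerivAt_id y).const_mul _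
  have h2 := (h1.sin).pow 2
  refine h2.congr_deriv ?_
  rw [show 2 * Real.pi * y = 2 * (Real.pi * y) by ring, Real.sin_two_mul]
  simp
  ring

theorem sin_two_pi_eq_zero {y : ℝ} (h : Real.sin (2 * Real.pi * y) = 0) :
    ∃ n : ℤ, 2 * y = n := by
  obtain ⟨n, hn⟩ := Real.sin_eq_zero_iff.1 h
  refine ⟨n, ?_⟩
  have := Real.pi_pos
  have h2 : Real.pi * (2 * y - n) = 0 := by linear_combination -hn
  rcases mul_eq_zero.1 h2 with h3 | h3 <;> linarith

/-- For an even smooth periodic `f`, the derivative of `f` with respect to `sin² (π y)` is again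
an even smooth periodic function. -/
theorem exists_deriv_sin_sq {f : ℝ → ℝ} (hf : ContDiff ℝ ∞ f) (hp : Function.Periodic f 1)
    (he : ∀ y, f (-y) = f y) :
    ∃ g : ℝ → ℝ, ContDiff ℝ ∞ g ∧ Function.Periodic g 1 ∧ (∀ y, g (-y) = g y) ∧
      ∀ y, HasDerivAt f (g y * (Real.pi * Real.sin (2 * Real.pi * y))) y := by
  have hπ := Real.pi_pos
  set s : ℝ → ℝ := fun y => Real.pi * Real.sin (2 * Real.pi * y) with hs
  have hsd : ∀ y, HasDerivAt s (Real.pi * (Real.cos (2 * Real.pi * y) * (2 * Real.pi))) y := by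
    intro y
    have h1 : HasDerivAt (fun y => 2 * Real.pi * y) (2 * Real.pi * 1) y :=
      (hasDerivAt_id y).const_mul _
    rw [mul_one] at h1
    exact h1.sin.const_mul _
  have hodd : ∀ y, deriv f (-y) = -deriv f y := by
    intro y
    have h1 : deriv (fun y => f (-y)) y = deriv f y := by rw [funext he]
    rw [deriv_comp_neg] at h1
    linarith
  have hper := periodic_deriv hp
  have hsm : ContDiff ℝ ∞ s := by
    rw [hs]; fun_prop
  have hz : ∀ y, s y = 0 → deriv f y = 0 := by
    intro y hy
    have h0 : Real.sin (2 * Real.pi * y) = 0 := by simpa [hs, hπ.ne'] using hy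
    obtain ⟨n, hn⟩ := sin_two_pi_eq_zero h0
    have h1 := hper.int_mul n (-y)
    rw [mul_one, ← hn, show -y + 2 * y = y by ring, hodd] at h1
    linarith
  have hz' : ∀ y, s y = 0 → deriv s y ≠ 0 := by
    intro y hy
    have h0 : Real.sin (2 * Real.pi * y) = 0 := by simpa [hs, hπ.ne'] using hy
    rw [(hsd y).deriv]
    intro h1
    have h2 := Real.sin_sq_add_cos_sq (2 * Real.pi * y)
    have h3 : Real.cos (2 * Real.pi * y) = 0 := by simpa [hπ.ne'] using h1
    rw [h0, h3] at h2
    norm_num at h2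
  obtain ⟨g, hg, hfg⟩ := exists_smooth_quotient (contDiff_infty_iff_deriv.1 hf).2 hsm hz hz'
  have hsn : ∀ y, s (-y) = - s y := fun y => by simp [hs]
  have hs1 : ∀ y, s (y + 1) = s y := fun y => by
    simp only [hs]
    rw [mul_add, mul_one, Real.sin_add_two_pi]
  -- `s` vanishes on a discrete set only, so identities for `g` may be multiplied by `s`
  have hcl : ∀ (r : ℝ → ℝ), Continuous r → (∀ y, s y * r y = s y * g y) → r = g := by
    intro r hr h
    refine Continuous.ext_on (s := {y | s y ≠ 0}) ?_ hr hg.continuous fun y hy =>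
      mul_left_cancel₀ hy (h y)
    intro y
    rw [mem_closure_iff_frequently]
    intro hev
    have hev' : s =ᶠ[𝓝 y] fun _ => 0 := by
      filter_upwards [hev] with z hz
      simpa using hz
    have h0 : s y = 0 := hev'.self_of_nhds
    have h1 := hev'.deriv_eq
    rw [(hsd y).deriv, deriv_const] at h1
    have h2 := Real.sin_sq_add_cos_sq (2 * Real.pi * y)
    simp only [hs, mul_eq_zero, hπ.ne', false_or] at h0 h1
    have h3 : Real.cos (2 * Real.pi * y) = 0 := by simpa [hπ.ne'] using h1
    rw [h0, h3] at h2
    norm_num at h2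
  refine ⟨g, hg, fun y => ?_, fun y => ?_, fun y => ?_⟩
  · refine congrFun (hcl (fun y => g (y + 1)) (hg.continuous.comp (by fun_prop)) fun y => ?_) y
    rw [← hfg, ← hs1, ← hfg, hper]
  · refine congrFun (hcl (fun y => g (-y)) (hg.continuous.comp (by fun_prop)) fun y => ?_) y
    have h1 := hfg (-y)
    rw [hodd, hsn] at h1
    linarith [hfg y]
  · have := ((hf.differentiable (by simp)) y).hasDerivAt
    rwa [hfg y, mul_comm] at this

/-- On even `1`-periodic functions, `x ↦ arcsin √x / π` acts as an inverse of `y ↦ sin² (π y)`. -/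
theorem even_periodic_comp_arcsin {f : ℝ → ℝ} (hp : Function.Periodic f 1)
    (he : ∀ y, f (-y) = f y) (y : ℝ) :
    f (Real.arcsin (√(Real.sin (Real.pi * y) ^ 2)) / Real.pi) = f y := by
  have hπ := Real.pi_pos
  rw [Real.sqrt_sq_eq_abs]
  have h0 : f (Real.arcsin |Real.sin (Real.pi * y)| / Real.pi) =
      f (Real.arcsin (Real.sin (Real.pi * y)) / Real.pi) := by
    rcases abs_cases (Real.sin (Real.pi * y)) with h | h
    · rw [h.1]
    · rw [h.1, Real.arcsin_neg, neg_div, he]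
  rw [h0]
  set x := y - round y with hx
  have h1 : |x| ≤ 1 / 2 := abs_sub_round y
  have h2 : f y = f x := by
    have := hp.sub_zsmul_eq (x := y) (round y)
    simpa [hx] using this.symm
  have h3 : Real.sin (Real.pi * y) = Real.cos (round y * Real.pi) * Real.sin (Real.pi * x) := by
    have : Real.pi * y = Real.pi * x + round y * Real.pi := by rw [hx]; ring
    rw [this, Real.sin_add, Real.sin_int_mul_pi]
    ring
  rw [abs_le] at h1
  have h4 : Real.arcsin (Real.sin (Real.pi * x)) = Real.pi * x :=
    Real.arcsin_sin (by nlinarith) (by nlinarith)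
  rw [h2, h3]
  have h5 : Real.cos (round y * Real.pi) = 1 ∨ Real.cos (round y * Real.pi) = -1 := by
    have h6 := Real.sin_sq_add_cos_sq (round y * Real.pi)
    rw [Real.sin_int_mul_pi] at h6
    exact mul_self_eq_one_iff.1 (by linarith)
  rcases h5 with h5 | h5
  · rw [h5, one_mul, h4]; field_simp
  · rw [h5, neg_one_mul, Real.arcsin_neg, h4, neg_div, he]; field_simp

/-- An even smooth `1`-periodic function is a `C²` function of `sin² (π y)`. Its second derivative
with respect to `sin² (π y)` is smooth in `y`, hence a continuous function of `sin² (π y)`, and `Θ` is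
a second primitive of that function. -/
theorem exists_comp_sin_sq {f : ℝ → ℝ} (hf : ContDiff ℝ ∞ f) (hp : Function.Periodic f 1)
    (he : ∀ y, f (-y) = f y) :
    ∃ Θ : ℝ → ℝ, ContDiff ℝ 2 Θ ∧ ∀ y, Θ (Real.sin (Real.pi * y) ^ 2) = f y := by
  obtain ⟨g, hg, hgp, hge, hfg⟩ := exists_deriv_sin_sq hf hp he
  obtain ⟨k, hk, hkp, hke, hgk⟩ := exists_deriv_sin_sq hg hgp hge
  set t₂ : ℝ → ℝ := fun x => k (Real.arcsin (√x) / Real.pi) with ht₂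
  have c₂ : Continuous t₂ := hk.continuous.comp (by fun_prop)
  have prim : ∀ (t : ℝ → ℝ) (c : ℝ), Continuous t →
      ∀ x, HasDerivAt (fun x => c + ∫ y in (0 : ℝ)..x, t y) (t x) x := fun t c ht x =>
    (intervalIntegral.integral_hasDerivAt_right (ht.intervalIntegrable _ _)
      (ht.stronglyMeasurableAtFilter _ _) ht.continuousAt).const_add c
  -- a primitive of the derivative with respect to `sin² (π y)` recovers the function
  have lift : ∀ (t : ℝ → ℝ) (r r' : ℝ → ℝ), Continuous t →
      (∀ y, t (Real.sin (Real.pi * y) ^ 2) = r' y) →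
      (∀ y, HasDerivAt r (r' y * (Real.pi * Real.sin (2 * Real.pi * y))) y) →
      ∀ y, r 0 + ∫ z in (0 : ℝ)..Real.sin (Real.pi * y) ^ 2, t z = r y := by
    intro t r r' ht h1 h2 y
    have h3 : ∀ y, HasDerivAt
        (fun y => (r 0 + ∫ z in (0 : ℝ)..Real.sin (Real.pi * y) ^ 2, t z) - r y) 0 y := by
      intro y
      have h4 := ((prim t (r 0) ht (Real.sin (Real.pi * y) ^ 2)).comp y (hasDerivAt_sin_sq y)).sub
        (h2 y)
      exact h4.congr_deriv (by rw [h1]; ring)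
    have h5 := is_const_of_deriv_eq_zero (fun y => (h3 y).differentiableAt)
      (fun y => (h3 y).deriv) y 0
    simp at h5
    linarith
  set t₁ : ℝ → ℝ := fun x => g 0 + ∫ y in (0 : ℝ)..x, t₂ y with ht₁
  have d₁ := prim t₂ (g 0) c₂
  have c₁ : Continuous t₁ := continuous_iff_continuousAt.2 fun x => (d₁ x).continuousAt
  have l₁ := lift t₂ g k c₂ (fun y => even_periodic_comp_arcsin hkp hke y) hgk
  have l₀ := lift t₁ f g c₁ l₁ hfg
  have d₀ := prim t₁ (f 0) c₁
  refine ⟨fun x => f 0 + ∫ y in (0 : ℝ)..x, t₁ y, ?_, l₀⟩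
  rw [show (2 : WithTop ℕ∞) = 1 + 1 by norm_num, contDiff_succ_iff_deriv]
  refine ⟨fun x => (d₀ x).differentiableAt, by simp, ?_⟩
  rw [funext fun x => (d₀ x).deriv, contDiff_one_iff_deriv]
  refine ⟨fun x => (d₁ x).differentiableAt, ?_⟩
  rw [funext fun x => (d₁ x).deriv]
  exact c₂

/-! ### The normal form of a function with simple extrema -/

/-- The function `-U` on the circle. -/
def CircleFun.neg (U : CircleFun) : CircleFun where
  toFun x := -U x
  smooth := U.smooth.neg
  periodic x := congrArg Neg.neg (U.periodic x)

@[simp] theorem CircleFun.neg_apply (U : CircleFun) (x : ℝ) : U.neg x = -U x := rfl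

theorem iteratedDeriv_two (f : ℝ → ℝ) : iteratedDeriv 2 f = deriv (deriv f) := by
  rw [iteratedDeriv_succ, iteratedDeriv_one]

theorem HasSimpleExtrema.neg {U : CircleFun} (h : HasSimpleExtrema U) :
    HasSimpleExtrema U.neg := by
  refine ⟨?_, ?_, fun q hq => ?_⟩
  · convert h.2.1 using 4 with m
    exact ⟨fun h => by simpa using h.neg, fun h => h.neg⟩
  · convert h.1 using 4 with m
    exact ⟨fun h => by simpa using h.neg, fun h => h.neg⟩
  · have h1 : deriv U.neg q = -deriv U q := deriv.fun_neg
    have h2 : iteratedDeriv 2 U.neg.toFun q = -iteratedDeriv 2 U q := iteratedDeriv_fun_neg 2 U q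
    rw [h2, neg_ne_zero]
    exact h.2.2 q (by linarith [h1])

theorem CircleFun.exists_min (U : CircleFun) : ∃ p, ∀ x, U p ≤ U x := by
  obtain ⟨p, -, hp⟩ := isCompact_Icc.exists_isMinOn (nonempty_Icc.2 (zero_le_one' ℝ))
    U.smooth.continuous.continuousOn
  refine ⟨p, fun x => ?_⟩
  obtain ⟨n, hn, -⟩ := existsUnique_sub_zsmul_mem_Ico (zero_lt_one' ℝ) x 0
  have := hp (show x - n • 1 ∈ Icc (0 : ℝ) 1 from ⟨hn.1, by simpa using hn.2.le⟩)
  rwa [mem_ofPred_eq, U.periodic.sub_zsmul_eq] at this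

/-- All local minima are translates of one global minimum. -/
theorem HasSimpleExtrema.exists_min {U : CircleFun} (h : HasSimpleExtrema U) :
    ∃ p, (∀ x, U p ≤ U x) ∧ ∀ q, IsLocalMin U q → ∃ n : ℤ, q = p + n := by
  obtain ⟨p, hp⟩ := U.exists_min
  refine ⟨p, hp, fun q hq => ?_⟩
  obtain ⟨⟨m, -, hm⟩, -, -⟩ := h
  have key : ∀ q, IsLocalMin U q → Int.fract q = m := by
    intro q hq
    refine hm _ ⟨⟨Int.fract_nonneg q, Int.fract_lt_one q⟩, ?_⟩
    have h1 : U.toFun = U.toFun ∘ fun x => x + ⌊q⌋ := by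
      funext x
      simpa using (U.periodic.int_mul ⌊q⌋ x).symm
    rw [h1]
    refine IsLocalMin.comp_continuous ?_ (by fun_prop)
    simpa using hq
  have h1 := key q hq
  have h2 := key p (.of_forall hp)
  refine ⟨⌊q⌋ - ⌊p⌋, ?_⟩
  have h3 := Int.floor_add_fract q
  have h4 := Int.floor_add_fract p
  push_cast
  linarith

/-- Near a nondegenerate zero minimum `a` of `f`, the function `f' ^ 2 / f` extends smoothly
across `a`, with a positive value. -/
theorem exists_smooth_deriv_sq_div {f : ℝ → ℝ} (hf : ContDiff ℝ ∞ f) (h0 : ∀ x, 0 ≤ f x) {a : ℝ}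
    (ha : f a = 0) (h1 : deriv f a = 0) (h2 : deriv (deriv f) a ≠ 0) :
    0 < deriv (deriv f) a ∧ ∃ g : ℝ → ℝ, ContDiffAt ℝ ∞ g a ∧ g a = 2 * deriv (deriv f) a ∧
      ∀ᶠ x in 𝓝 a, x ≠ a → deriv f x ≠ 0 ∧ deriv f x ^ 2 / f x = g x := by
  obtain ⟨k, hk, hfk, hka⟩ := exists_hadamard hf ha
  obtain ⟨A, hA, hkA, hAa⟩ := exists_hadamard hk (hka.trans h1)
  have hdk : ∀ x, deriv k x = A x + (x - a) * deriv A x := by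
    intro x
    rw [funext hkA]
    have := ((hasDerivAt_id x).sub_const a).mul ((hA.differentiable (by simp)) x).hasDerivAt
    rw [one_mul] at this
    exact this.deriv
  have hdf : ∀ x, deriv f x = k x + (x - a) * deriv k x := by
    intro x
    rw [funext hfk]
    have := ((hasDerivAt_id x).sub_const a).mul ((hk.differentiable (by simp)) x).hasDerivAt
    rw [one_mul] at this
    exact this.deriv
  have hk' := (contDiff_infty_iff_deriv.1 hk).2
  have hA' := (contDiff_infty_iff_deriv.1 hA).2
  have hddf : deriv (deriv f) a = 2 * A a := by
    rw [funext hdf]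
    have := ((hk.differentiable (by simp)) a).hasDerivAt.add
      (((hasDerivAt_id a).sub_const a).mul ((hk'.differentiable (by simp)) a).hasDerivAt)
    have h3 := this.deriv
    simp only [id, sub_self, zero_mul, add_zero, one_mul] at h3
    rw [hAa]
    refine Eq.trans ?_ (h3.trans (by ring))
    rfl
  have hA0 : A a ≠ 0 := fun h => h2 (by rw [hddf, h, mul_zero])
  have hApos : 0 < A a := by
    refine lt_of_le_of_ne ?_ hA0.symm
    refine ge_of_tendsto (x := 𝓝[≠] a)
      (hA.continuous.continuousAt.tendsto.mono_left nhdsWithin_le_nhds) ?_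
    filter_upwards [self_mem_nhdsWithin] with x hx
    have h3 := h0 x
    rw [hfk, hkA, ← mul_assoc] at h3
    have h4 : 0 < (x - a) * (x - a) := mul_self_pos.2 (sub_ne_zero.2 hx)
    exact nonneg_of_mul_nonneg_right h3 h4
  set B : ℝ → ℝ := fun x => A x + (A x + (x - a) * deriv A x) with hB
  have hBs : ContDiff ℝ ∞ B := hA.add (hA.add ((contDiff_id.sub contDiff_const).mul hA'))
  have hBa : B a = 2 * A a := by simp [hB]; ring
  have hfB : ∀ x, deriv f x = (x - a) * B x := by
    intro x
    rw [hdf, hdk, hkA, hB]; ring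
  refine ⟨by rw [hddf]; positivity, fun x => B x ^ 2 / A x,
    (hBs.contDiffAt.pow 2).div hA.contDiffAt hA0, ?_, ?_⟩
  · simp only [hBa, hddf]; field_simp
  · filter_upwards [hA.continuous.continuousAt.eventually_ne hA0,
      hBs.continuous.continuousAt.eventually_ne (hBa ▸ mul_ne_zero two_ne_zero hA0)] with x h3 h4 h5
    have h6 := sub_ne_zero.2 h5
    refine ⟨by rw [hfB]; exact mul_ne_zero h6 h4, ?_⟩
    rw [hfB, hfk, hkA]
    field_simp

/-- The angular velocity `w = |U'| / √((b - U) (U - a))` of the phase of `U` extends to a smooth and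
positive function across the extrema. -/
theorem exists_phase_speed {U : CircleFun} (h : HasSimpleExtrema U) {a b : ℝ} (hab : a < b)
    (ha : ∀ x, a ≤ U x) (hb : ∀ x, U x ≤ b) (hc : ∀ x, deriv U x = 0 → U x = a ∨ U x = b) :
    ∃ w : ℝ → ℝ, ContDiff ℝ ∞ w ∧ (∀ x, 0 < w x) ∧ Function.Periodic w 1 ∧
      ∀ x, w x ^ 2 * ((b - U x) * (U x - a)) = deriv U x ^ 2 := by
  classical
  have hU := U.smooth
  have hUc := hU.continuous
  have hU' := (contDiff_infty_iff_deriv.1 hU).2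
  have hmin : ∀ x, U x = a → deriv U x = 0 := fun x hx =>
    IsLocalMin.deriv_eq_zero (.of_forall fun y => hx ▸ ha y)
  have hmax : ∀ x, U x = b → deriv U x = 0 := fun x hx =>
    IsLocalMax.deriv_eq_zero (.of_forall fun y => hx ▸ hb y)
  set e : ℝ → ℝ := fun x => if deriv U x = 0 then 2 * |deriv (deriv U) x| / (b - a)
    else deriv U x ^ 2 / ((b - U x) * (U x - a)) with he
  have hdd : ∀ x, deriv U x = 0 → deriv (deriv U) x ≠ 0 := fun x hx => by
    have := h.2.2 x hx
    rwa [iteratedDeriv_two] at this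
  have hba : 0 < b - a := sub_pos.2 hab
  have hne : ∀ x, deriv U x ≠ 0 → 0 < b - U x ∧ 0 < U x - a := fun x hx =>
    ⟨sub_pos.2 (lt_of_le_of_ne (hb x) fun h => hx (hmax x h)),
      sub_pos.2 (lt_of_le_of_ne (ha x) fun h => hx (hmin x h.symm))⟩
  have hepos : ∀ x, 0 < e x := by
    intro x
    by_cases hx : deriv U x = 0
    · have := abs_pos.2 (hdd x hx)
      simp only [he, hx, if_true]
      positivity
    · obtain ⟨h1, h2⟩ := hne x hx
      simp only [he, hx, if_false]
      positivity
  -- at a critical point one factor of the denominator has a double zero, and so has `U' ^ 2`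
  have hes : ContDiff ℝ ∞ e := by
    rw [contDiff_iff_contDiffAt]
    intro x₀
    by_cases hx : deriv U x₀ = 0
    · rcases hc x₀ hx with h1 | h1
      · have d1 : deriv (fun x => U x - a) = deriv U := funext fun x => deriv_sub_const (f := U.toFun) a
        obtain ⟨hp, g, hg, hga, hev⟩ := exists_smooth_deriv_sq_div (f := fun x => U x - a)
          (hU.sub contDiff_const) (fun x => sub_nonneg.2 (ha x)) (a := x₀) (by simp [h1])
          (by rw [d1, hx]) (by rw [d1]; exact hdd x₀ hx)
        rw [d1] at hp hga hev
        have h2 : b - U x₀ ≠ 0 := by rw [h1]; exact hba.ne'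
        refine (hg.div (contDiff_const.sub hU).contDiffAt h2).congr_of_eventuallyEq ?_
        filter_upwards [hev] with x hx'
        by_cases hxx : x = x₀
        · subst hxx
          simp only [he, hx, if_true, Pi.div_apply, hga, h1, abs_of_pos hp]
        · obtain ⟨h3, h4⟩ := hx' hxx
          simp only [he, h3, if_false, Pi.div_apply, ← h4]
          rw [div_div, mul_comm]
      · have d1 : deriv (fun x => b - U x) = fun x => -deriv U x :=
          funext fun x => deriv_const_sub (f := U.toFun) b
        have d2 : deriv (deriv (fun x => b - U x)) = fun x => -deriv (deriv U) x := by
          rw [d1]; exact funext fun x => deriv.fun_neg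
        obtain ⟨hp, g, hg, hga, hev⟩ := exists_smooth_deriv_sq_div (f := fun x => b - U x)
          (contDiff_const.sub hU) (fun x => sub_nonneg.2 (hb x)) (a := x₀) (by simp [h1])
          (by rw [d1]; simp [hx]) (by rw [d2]; simpa using hdd x₀ hx)
        rw [d2] at hp hga
        rw [d1] at hev
        have h2 : U x₀ - a ≠ 0 := by rw [h1]; exact hba.ne'
        refine (hg.div (hU.sub contDiff_const).contDiffAt h2).congr_of_eventuallyEq ?_
        filter_upwards [hev] with x hx'
        by_cases hxx : x = x₀
        · subst hxx
          simp only [he, hx, if_true, Pi.div_apply, hga, h1, abs_of_neg (neg_pos.1 hp)]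
        · obtain ⟨h3, h4⟩ := hx' hxx
          rw [neg_ne_zero] at h3
          simp only [he, h3, if_false, Pi.div_apply, ← h4]
          rw [div_div, neg_sq]
    · obtain ⟨h1, h2⟩ := hne x₀ hx
      refine ((hU'.contDiffAt.pow 2).div (((contDiff_const (c := b)).sub hU).mul
        (hU.sub (contDiff_const (c := a)))).contDiffAt
        (mul_pos h1 h2).ne').congr_of_eventuallyEq ?_
      filter_upwards [hU'.continuous.continuousAt.eventually_ne hx] with x hx'
      simp only [he, hx', if_false, Pi.div_apply]
  have hdp := periodic_deriv U.periodic
  refine ⟨fun x => √(e x), hes.sqrt fun x => (hepos x).ne', fun x => Real.sqrt_pos.2 (hepos x),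
    fun x => ?_, fun x => ?_⟩
  · simp only [he, hdp x, periodic_deriv hdp x, U.periodic x]
  · rw [Real.sq_sqrt (hepos x).le]
    by_cases hx : deriv U x = 0
    · rw [hx]
      rcases hc x hx with h1 | h1 <;> simp [h1]
    · obtain ⟨h1, h2⟩ := hne x hx
      simp only [he, hx, if_false]
      field_simp

theorem IsCircleDiffeo.exists_inverse {Φ : ℝ → ℝ} (h : IsCircleDiffeo Φ) :
    ∃ Ψ, IsCircleDiffeo Ψ ∧ (∀ y, Ψ (Φ y) = y) ∧ ∀ x, Φ (Ψ x) = x := by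
  obtain ⟨Ψ, hΨ, hl, hr⟩ := exists_smooth_inverse_family (Φ := fun _ => Φ)
    (h.smooth.comp contDiff_snd) fun _ => h
  have hs : ContDiff ℝ ∞ (Ψ 0) := hΨ.comp (contDiff_const.prodMk contDiff_id)
  refine ⟨Ψ 0, ⟨hs, fun y => ?_, fun y => ?_⟩, hl 0, hr 0⟩
  · apply h.strictMono.injective
    rw [h.add_one]
    exact (hr 0 _).trans (congrArg (· + 1) (hr 0 y).symm)
  · have h1 := ((h.smooth.differentiable (by simp)) (Ψ 0 y)).hasDerivAt.comp y
      ((hs.differentiable (by simp)) y).hasDerivAt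
    rw [show Φ ∘ Ψ 0 = id from funext (hr 0)] at h1
    have h2 := h1.unique (hasDerivAt_id y)
    exact pos_of_mul_pos_right (h2 ▸ one_pos) (h.deriv_pos _).le

/-- In the coordinate `y` on the circle given by `q = Φ y`, the function `U` is
`α - β cos (2 π y)`. Thus its minimum is `α - β` and its maximum is `α + β`. -/
structure IsNormalForm (U Φ : ℝ → ℝ) (α β : ℝ) : Prop where
  diffeo : IsCircleDiffeo Φ
  pos : 0 < β
  eq : ∀ y, U (Φ y) = α - β * Real.cos (2 * Real.pi * y)

theorem hasDerivAt_cos_two_pi (y : ℝ) : HasDerivAt (fun y => Real.cos (2 * Real.pi * y))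
    (-Real.sin (2 * Real.pi * y) * (2 * Real.pi)) y := by
  have h1 : HasDerivAt (fun y => 2 * Real.pi * y) (2 * Real.pi * 1) y :=
    (hasDerivAt_id y).const_mul _
  rw [mul_one] at h1
  exact h1.cos

/-- Every function with simple extrema has a normal form: the new coordinate is the phase `T` with
angular velocity `w = |U'| / √((max - U) (U - min))`, divided by `2 π`. -/
theorem HasSimpleExtrema.exists_normalForm {U : CircleFun} (h : HasSimpleExtrema U) :
    ∃ Φ α β, IsNormalForm U Φ α β := by
  have hπ := Real.pi_pos
  obtain ⟨p, hp, hpu⟩ := h.exists_min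
  obtain ⟨p', hp', hpu'⟩ := h.neg.exists_min
  have hU := U.smooth
  have hU' := (contDiff_infty_iff_deriv.1 hU).2
  have hcrit : ∀ x, deriv U x = 0 → U x = U p ∨ U x = U p' := by
    intro x hx
    have h2 := h.2.2 x hx
    rw [iteratedDeriv_two] at h2
    rcases lt_or_gt_of_ne h2 with h2 | h2
    · right
      have hdn : deriv U.neg.toFun = fun x => -deriv U x := funext fun x => deriv.fun_neg
      have h3 : IsLocalMin U.neg x := isLocalMin_of_deriv_deriv_pos
        (by rw [hdn, deriv.fun_neg]; linarith) (by rw [hdn]; simp [hx])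
        U.neg.smooth.continuous.continuousAt
      obtain ⟨n, rfl⟩ := hpu' x h3
      simpa using U.periodic.int_mul n p'
    · left
      obtain ⟨n, rfl⟩ := hpu x (isLocalMin_of_deriv_deriv_pos h2 hx hU.continuous.continuousAt)
      simpa using U.periodic.int_mul n p
  have hb : ∀ x, U x ≤ U p' := fun x => by simpa using hp' x
  have hab : U p < U p' := by
    refine lt_of_le_of_ne (hp p') fun heq => ?_
    have h1 : U.toFun = fun _ => U p := funext fun x => le_antisymm (heq ▸ hb x) (hp x)
    have h2 : deriv U p = 0 := by rw [h1]; simp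
    refine h.2.2 p h2 ?_
    rw [iteratedDeriv_two, h1]
    simp
  obtain ⟨w, hw, hwpos, hwp, hwU⟩ := exists_phase_speed h hab hp hb hcrit
  set α := (U p + U p') / 2 with hα
  set β := (U p' - U p) / 2 with hβ
  have hβ0 : 0 < β := by rw [hβ]; linarith
  -- `(x, s)` moves on the unit circle with angular speed `w`.
  set x : ℝ → ℝ := fun q => (α - U q) / β with hx
  set s : ℝ → ℝ := fun q => deriv U q / (β * w q) with hs
  have hxd : ∀ q, HasDerivAt x (-(w q * s q)) q := by
    intro q
    have h1 := (((hU.differentiable (by simp)) q).hasDerivAt.const_sub α).div_const β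
    refine h1.congr_deriv ?_
    have := (hwpos q).ne'
    rw [hs]; field_simp
  have hsq : ∀ q, x q * x q + s q * s q = 1 := by
    intro q
    have h1 := hwU q
    have h2 := (hwpos q).ne'
    have h3 : U p = α - β := by rw [hα, hβ]; ring
    have h4 : U p' = α + β := by rw [hα, hβ]; ring
    rw [h3, h4] at h1
    simp only [hx, hs]
    field_simp
    rw [← h1]
    ring
  have hss : ContDiff ℝ ∞ s := hU'.div (contDiff_const.mul hw) fun q => (mul_pos hβ0 (hwpos q)).ne'
  have hs'c : Continuous (deriv s) := hss.continuous_deriv (by simp)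
  have hxc : Continuous x := continuous_iff_continuousAt.2 fun q => (hxd q).continuousAt
  have hsd0 : ∀ q, HasDerivAt s (deriv s q) q := fun q => ((hss.differentiable (by simp)) q).hasDerivAt
  -- Differentiating `x² + s² = 1` gives `s' = w x` wherever `s ≠ 0`, and this set is dense.
  have hsd : deriv s = fun q => w q * x q := by
    refine Continuous.ext_on (s := {q | deriv U q ≠ 0}) ?_ hs'c (hw.continuous.mul hxc) fun q hq => ?_
    · intro q
      rw [mem_closure_iff_frequently]
      intro hev
      have hev' : deriv U =ᶠ[𝓝 q] fun _ => 0 := by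
        filter_upwards [hev] with z hz
        simpa using hz
      have h1 := h.2.2 q hev'.self_of_nhds
      rw [iteratedDeriv_two, hev'.deriv_eq] at h1
      simp at h1
    · have h1 : s q ≠ 0 := div_ne_zero hq (mul_pos hβ0 (hwpos q)).ne'
      have h2 := ((hxd q).mul (hxd q)).add ((hsd0 q).mul (hsd0 q))
      have h3 : HasDerivAt (fun _ : ℝ => (1 : ℝ)) _ q := h2.congr_of_eventuallyEq
        (.of_forall fun q => (hsq q).symm)
      have h4 := h3.unique (hasDerivAt_const q 1)
      have h5 : s q * (deriv s q - w q * x q) = 0 := by linear_combination h4 / 2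
      rcases mul_eq_zero.1 h5 with h6 | h6
      · exact absurd h6 h1
      · linarith
  set T : ℝ → ℝ := fun q => ∫ t in p..q, w t with hT
  have hTd : ∀ q, HasDerivAt T (w q) q := fun q =>
    intervalIntegral.integral_hasDerivAt_right (hw.continuous.intervalIntegrable _ _)
      (hw.continuous.stronglyMeasurableAtFilter _ _) hw.continuous.continuousAt
  have hTp : T p = 0 := by simp [hT]
  have hxp : x p = 1 := by
    simp only [hx]
    rw [div_eq_one_iff_eq hβ0.ne', hα, hβ]; ring
  have hsp : s p = 0 := by
    have := hsq p
    rw [hxp] at this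
    nlinarith
  have hcos : ∀ q, x q = Real.cos (T q) := by
    intro q
    have e1 : ∀ q, HasDerivAt (fun q => x q * Real.cos (T q) + s q * Real.sin (T q)) 0 q := by
      intro q
      have hsq' := hsd0 q
      rw [hsd] at hsq'
      refine (((hxd q).mul (hTd q).cos).add (hsq'.mul (hTd q).sin)).congr_deriv ?_
      ring
    have e2 : ∀ q, HasDerivAt (fun q => x q * Real.sin (T q) - s q * Real.cos (T q)) 0 q := by
      intro q
      have hsq' := hsd0 q
      rw [hsd] at hsq'
      refine (((hxd q).mul (hTd q).sin).sub (hsq'.mul (hTd q).cos)).congr_deriv ?_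
      ring
    have f1 := is_const_of_deriv_eq_zero (fun y => (e1 y).differentiableAt) (fun y => (e1 y).deriv) q p
    have f2 := is_const_of_deriv_eq_zero (fun y => (e2 y).differentiableAt) (fun y => (e2 y).deriv) q p
    simp only [hTp, hxp, hsp, Real.cos_zero, Real.sin_zero] at f1 f2
    have h3 := Real.sin_sq_add_cos_sq (T q)
    linear_combination Real.cos (T q) * f1 + Real.sin (T q) * f2 - x q * h3
  have hUT : ∀ q, U q = α - β * Real.cos (T q) := by
    intro q
    rw [← hcos, hx]
    field_simp
    ring
  have hTmono : StrictMono T := strictMono_of_deriv_pos fun q => by rw [(hTd q).deriv]; exact hwpos q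
  have hTc : Continuous T := continuous_iff_continuousAt.2 fun q => (hTd q).continuousAt
  -- The phase makes exactly one turn in a period, as the minimum is attained once.
  have hT1 : T (p + 1) = 2 * Real.pi := by
    have h1 : Real.cos (T (p + 1)) = 1 := by
      have h2 : x (p + 1) = x p := by simp only [hx, U.periodic p]
      rw [← hcos, h2, hxp]
    obtain ⟨n, hn⟩ := (Real.cos_eq_one_iff _).1 h1
    have h2 : 0 < T (p + 1) := hTp ▸ hTmono (by linarith)
    have h3 : (0 : ℝ) < n := by
      by_contra h3
      nlinarith
    have h4 : 1 ≤ n := by exact_mod_cast h3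
    have h4' : (1 : ℝ) ≤ n := by exact_mod_cast h4
    obtain ⟨q, hq, hqT⟩ := intermediate_value_Icc (show p ≤ p + 1 by linarith) hTc.continuousOn
      (show 2 * Real.pi ∈ Icc (T p) (T (p + 1)) by rw [hTp, ← hn]; constructor <;> nlinarith)
    have h5 : U q = U p := by rw [hUT, hUT, hqT, hTp]; simp
    obtain ⟨m, hm⟩ := hpu q (.of_forall fun y => h5 ▸ hp y)
    have h6 : p < q := hTmono.lt_iff_lt.1 (by rw [hTp, hqT]; positivity)
    have h7 : (0 : ℝ) < m := by linarith
    have h8 : 1 ≤ m := by exact_mod_cast h7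
    have h8' : (1 : ℝ) ≤ m := by exact_mod_cast h8
    have h9 : q = p + 1 := le_antisymm hq.2 (by linarith)
    rw [← h9, hqT]
  set ψ : ℝ → ℝ := fun q => T q / (2 * Real.pi) with hψ
  have hψd : ∀ q, HasDerivAt ψ (w q / (2 * Real.pi)) q := fun q => (hTd q).div_const _
  have hψD : IsCircleDiffeo ψ := by
    refine ⟨contDiff_infty_iff_deriv.2 ⟨fun q => (hψd q).differentiableAt, ?_⟩, fun q => ?_,
      fun q => ?_⟩
    · rw [funext fun q => (hψd q).deriv]
      exact hw.div_const _
    · have h1 : T (q + 1) = T q + T (p + 1) := by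
        have h2 := hwp.intervalIntegral_add_eq q p
        have h3 := intervalIntegral.integral_add_adjacent_intervals
          (hw.continuous.intervalIntegrable (μ := volume) p q)
          (hw.continuous.intervalIntegrable q (q + 1))
        simp only [hT]
        rw [← h3, h2]
      simp only [hψ, h1, hT1]
      field_simp
    · rw [(hψd q).deriv]
      have := hwpos q
      positivity
  obtain ⟨Φ, hΦ, -, hr⟩ := hψD.exists_inverse
  refine ⟨Φ, α, β, hΦ, hβ0, fun y => ?_⟩
  have h1 : T (Φ y) = 2 * Real.pi * ψ (Φ y) := by
    simp only [hψ]
    field_simp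
  rw [hUT, h1, hr]

/-- A half turn of the circle exchanges minima and maxima. -/
theorem IsNormalForm.neg {U : CircleFun} {Φ : ℝ → ℝ} {α β : ℝ} (h : IsNormalForm U Φ α β) :
    IsNormalForm U.neg (fun y => Φ (y + 1 / 2)) (-α) β := by
  refine ⟨⟨h.diffeo.smooth.comp (by fun_prop), fun y => ?_, fun y => ?_⟩, h.pos, fun y => ?_⟩
  · rw [← h.diffeo.add_one]; ring_nf
  · rw [deriv_comp_add_const]; exact h.diffeo.deriv_pos _
  · rw [CircleFun.neg_apply, h.eq, show 2 * Real.pi * (y + 1 / 2) = 2 * Real.pi * y + Real.pi by ring,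
      Real.cos_add_pi]
    ring

theorem IsNormalForm.deriv_mul {U : CircleFun} {Φ : ℝ → ℝ} {α β : ℝ} (h : IsNormalForm U Φ α β)
    (y : ℝ) : deriv U (Φ y) * deriv Φ y = β * (2 * Real.pi) * Real.sin (2 * Real.pi * y) := by
  have h1 := ((U.smooth.differentiable (by simp)) (Φ y)).hasDerivAt.comp y
    ((h.diffeo.smooth.differentiable (by simp)) y).hasDerivAt
  rw [show U.toFun ∘ Φ = _ from funext h.eq] at h1
  refine h1.unique ?_
  exact (((hasDerivAt_cos_two_pi y).const_mul β).const_sub α).congr_deriv (by ring)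

theorem IsNormalForm.deriv_ne_zero {U : CircleFun} {Φ : ℝ → ℝ} {α β : ℝ}
    (h : IsNormalForm U Φ α β) (q : ℝ) (hq : deriv U q = 0) : iteratedDeriv 2 U q ≠ 0 := by
  have hπ := Real.pi_pos
  have hβ := h.pos
  have hU' := (contDiff_infty_iff_deriv.1 U.smooth).2
  have hΦ' := (contDiff_infty_iff_deriv.1 h.diffeo.smooth).2
  obtain ⟨y, rfl⟩ := h.diffeo.surjective q
  have h1 := h.deriv_mul y
  rw [hq, zero_mul] at h1
  have h2 : Real.sin (2 * Real.pi * y) = 0 := by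
    rcases mul_eq_zero.1 h1.symm with h3 | h3
    · exact absurd h3 (by positivity)
    · exact h3
  have h3 := (((hU'.differentiable (by simp)) (Φ y)).hasDerivAt.comp y
    ((h.diffeo.smooth.differentiable (by simp)) y).hasDerivAt).mul
    ((hΦ'.differentiable (by simp)) y).hasDerivAt
  have h4 : HasDerivAt (fun y => β * (2 * Real.pi) * Real.sin (2 * Real.pi * y)) _ y :=
    h3.congr_of_eventuallyEq (.of_forall fun y => (h.deriv_mul y).symm)
  have h5 : HasDerivAt (fun y => 2 * Real.pi * y) (2 * Real.pi * 1) y :=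
    (hasDerivAt_id y).const_mul _
  have h6 := h4.unique (h5.sin.const_mul _)
  rw [iteratedDeriv_two]
  intro h7
  simp only [Function.comp, h7, hq, zero_mul, add_zero, mul_one] at h6
  have h8 := Real.sin_sq_add_cos_sq (2 * Real.pi * y)
  have h9 : Real.cos (2 * Real.pi * y) = 0 := by
    have h10 : β * (2 * Real.pi) * (2 * Real.pi) ≠ 0 := by positivity
    refine (mul_eq_zero.1 (?_ : β * (2 * Real.pi) * (2 * Real.pi) * _ = 0)).resolve_left h10
    linear_combination -h6
  rw [h2, h9] at h8
  norm_num at h8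

theorem IsNormalForm.min_le {U : CircleFun} {Φ : ℝ → ℝ} {α β : ℝ} (h : IsNormalForm U Φ α β)
    (q : ℝ) : α - β ≤ U q := by
  obtain ⟨y, rfl⟩ := h.diffeo.surjective q
  rw [h.eq]
  nlinarith [h.pos, Real.cos_le_one (2 * Real.pi * y)]

theorem IsNormalForm.le_max {U : CircleFun} {Φ : ℝ → ℝ} {α β : ℝ} (h : IsNormalForm U Φ α β)
    (q : ℝ) : U q ≤ α + β := by
  obtain ⟨y, rfl⟩ := h.diffeo.surjective q
  rw [h.eq]
  nlinarith [h.pos, Real.neg_one_le_cos (2 * Real.pi * y)]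

theorem IsNormalForm.existsUnique_min {U : CircleFun} {Φ : ℝ → ℝ} {α β : ℝ}
    (h : IsNormalForm U Φ α β) : ∃! m, m ∈ Ico (0 : ℝ) 1 ∧ IsLocalMin U m := by
  have hπ := Real.pi_pos
  have hβ := h.pos
  have hmono := h.diffeo.strictMono
  obtain ⟨y₀, hy₀⟩ := h.diffeo.surjective 0
  have hy₁ : Φ (y₀ + 1) = 1 := by rw [h.diffeo.add_one, hy₀, zero_add]
  have hval : ∀ n : ℤ, U (Φ n) = α - β := fun n => by
    rw [h.eq, mul_comm (2 * Real.pi), Real.cos_int_mul_two_pi]; ring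
  refine ⟨Φ ⌈y₀⌉, ⟨⟨?_, ?_⟩, .of_forall fun x => ?_⟩, ?_⟩
  · rw [← hy₀]; exact hmono.monotone (Int.le_ceil _)
  · rw [← hy₁]; exact hmono (Int.ceil_lt_add_one _)
  · rw [hval]; exact h.min_le x
  · rintro q ⟨hq, hmin⟩
    obtain ⟨y, rfl⟩ := h.diffeo.surjective q
    have h0 := hmin.deriv_eq_zero
    have h1 := h.deriv_mul y
    rw [h0, zero_mul] at h1
    have h2 : Real.sin (2 * Real.pi * y) = 0 := by
      rcases mul_eq_zero.1 h1.symm with h3 | h3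
      · exact absurd h3 (by positivity)
      · exact h3
    obtain ⟨n, hn⟩ := sin_two_pi_eq_zero h2
    rcases Int.even_or_odd' n with ⟨k, rfl | rfl⟩
    · have hk : y = k := by push_cast at hn; linarith
      subst hk
      rw [← hy₁, ← hy₀, mem_Ico, hmono.le_iff_le, hmono.lt_iff_lt] at hq
      congr 2
      exact (Int.ceil_eq_iff.2 ⟨by linarith, hq.1⟩).symm
    · exfalso
      -- a local minimum that is also a global maximum would be a degenerate critical point
      have hk : 2 * Real.pi * y = Real.pi + k * (2 * Real.pi) := by
        push_cast at hn; linear_combination Real.pi * hn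
      have h3 : U (Φ y) = α + β := by
        rw [h.eq, hk, Real.cos_add_int_mul_two_pi, Real.cos_pi]; ring
      have h4 : U.toFun =ᶠ[𝓝 (Φ y)] fun _ => α + β := by
        filter_upwards [hmin] with z hz
        exact le_antisymm (h.le_max z) (h3 ▸ hz)
      refine h.deriv_ne_zero _ h0 ?_
      rw [iteratedDeriv_two, h4.deriv.deriv_eq]
      simp

theorem IsNormalForm.hasSimpleExtrema {U : CircleFun} {Φ : ℝ → ℝ} {α β : ℝ}
    (h : IsNormalForm U Φ α β) : HasSimpleExtrema U := by
  refine ⟨h.existsUnique_min, ?_, h.deriv_ne_zero⟩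
  convert h.neg.existsUnique_min using 4 with m
  exact ⟨fun h => h.neg, fun h => by simpa using h.neg⟩

theorem IsNormalForm.minVal_eq {U : CircleFun} {Φ : ℝ → ℝ} {α β : ℝ}
    (h : IsNormalForm U Φ α β) : minVal U = α - β := by
  obtain ⟨m, ⟨hm, hmin⟩, -⟩ := h.existsUnique_min
  have hg : IsLeast (U.toFun '' Icc 0 1) (α - β) := by
    refine ⟨?_, ?_⟩
    · refine ⟨Int.fract (Φ 0), ⟨Int.fract_nonneg _, (Int.fract_lt_one _).le⟩, ?_⟩
      have h1 := U.periodic.sub_zsmul_eq (x := Φ 0) ⌊Φ 0⌋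
      rw [zsmul_one, ← Int.fract, h.eq] at h1
      simpa using h1
    · rintro _ ⟨x, -, rfl⟩
      exact h.min_le x
  exact hg.csInf_eq

theorem IsNormalForm.maxVal_eq {U : CircleFun} {Φ : ℝ → ℝ} {α β : ℝ}
    (h : IsNormalForm U Φ α β) : maxVal U = α + β := by
  have hg : IsGreatest (U.toFun '' Icc 0 1) (α + β) := by
    refine ⟨?_, ?_⟩
    · refine ⟨Int.fract (Φ (1 / 2)), ⟨Int.fract_nonneg _, (Int.fract_lt_one _).le⟩, ?_⟩
      have h1 := U.periodic.sub_zsmul_eq (x := Φ (1 / 2)) ⌊Φ (1 / 2)⌋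
      rw [zsmul_one, ← Int.fract, h.eq, show 2 * Real.pi * (1 / 2) = Real.pi by ring,
        Real.cos_pi] at h1
      linarith
    · rintro _ ⟨x, -, rfl⟩
      exact h.le_max x
  exact hg.csSup_eq

/-! ### Action integrals in normal form -/

/-- The action integral over a sublevel set. The square root vanishes outside that set, so the
integral can be taken over the whole period. -/
noncomputable def action (U : ℝ → ℝ) (c : ℝ) : ℝ := ∫ q in (0 : ℝ)..1, √(c - U q)

theorem F₂_eq_action (U : CircleFun × CircleFun) : F₂ U = action U.2 := by
  funext c
  rw [F₂, action, intervalIntegral.integral_of_le zero_le_one, ← integral_Icc_eq_integral_Ioc]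
  refine Eq.symm <| setIntegral_eq_of_subset_of_forall_sdiff_eq_zero measurableSet_Icc (fun q hq => hq.1) ?_
  intro q hq
  refine Real.sqrt_eq_zero_of_nonpos ?_
  by_contra h
  exact hq.2 ⟨hq.1, by linarith⟩

/-- The superlevel set `U₁ ≥ c` is the sublevel set `-U₁ ≤ -c`, so both actions have the same form. -/
theorem F₁_eq_action (U : CircleFun × CircleFun) (c : ℝ) : F₁ U c = action U.1.neg (-c) := by
  rw [F₁, action, intervalIntegral.integral_of_le zero_le_one, ← integral_Icc_eq_integral_Ioc]
  have h1 : ∀ q, -c - U.1.neg q = U.1 q - c := fun q => by rw [CircleFun.neg_apply]; ring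
  simp_rw [h1]
  refine Eq.symm <| setIntegral_eq_of_subset_of_forall_sdiff_eq_zero measurableSet_Icc (fun q hq => hq.1) ?_
  intro q hq
  refine Real.sqrt_eq_zero_of_nonpos ?_
  by_contra h
  exact hq.2 ⟨hq.1, by linarith⟩

/-- The action integral of the pendulum `sin² (π y)` with density `Θ (sin² (π y))`. -/
noncomputable def pendulumAction (Θ : ℝ → ℝ) (z : ℝ) : ℝ :=
  ∫ y in (0 : ℝ)..1, √(z - Real.sin (Real.pi * y) ^ 2) * Θ (Real.sin (Real.pi * y) ^ 2)

/-- In normal form, only the even part of the density `Φ'` contributes to the action. -/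
theorem IsNormalForm.action_eq {U : CircleFun} {Φ Θ : ℝ → ℝ} {α β : ℝ}
    (h : IsNormalForm U Φ α β)
    (hΘ : ∀ y, Θ (Real.sin (Real.pi * y) ^ 2) = (deriv Φ y + deriv Φ (-y)) / 2) (c : ℝ) :
    action U c = √(2 * β) * pendulumAction Θ ((c - (α - β)) / (2 * β)) := by
  have hβ := h.pos
  have hUc := U.smooth.continuous
  have hΦc := h.diffeo.smooth.continuous
  have hΦ'c : Continuous (deriv Φ) := h.diffeo.smooth.continuous_deriv (by simp)
  set z := (c - (α - β)) / (2 * β) with hz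
  have hper : Function.Periodic (fun q => √(c - U q)) 1 := fun q => by simp only [U.periodic q]
  have h1 : action U c = ∫ y in (0 : ℝ)..1, √(c - U (Φ y)) * deriv Φ y := by
    have h2 := hper.intervalIntegral_add_eq 0 (Φ 0)
    rw [zero_add, ← h.diffeo.add_one, zero_add] at h2
    rw [action, h2]
    refine (intervalIntegral.integral_comp_mul_deriv (g := fun q => √(c - U q))
      (fun y _ => ((h.diffeo.smooth.differentiable (by simp)) y).hasDerivAt)
      hΦ'c.continuousOn (by fun_prop)).symm
  have h2 : ∀ y, √(c - U (Φ y)) = √(2 * β) * √(z - Real.sin (Real.pi * y) ^ 2) := by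
    intro y
    rw [← Real.sqrt_mul (by positivity), h.eq, show 2 * Real.pi * y = 2 * (Real.pi * y) by ring,
      Real.cos_two_mul, hz, Real.sin_sq]
    congr 1
    field_simp
    ring
  set k : ℝ → ℝ := fun y => √(z - Real.sin (Real.pi * y) ^ 2) with hk
  have hkc : Continuous k := by rw [hk]; fun_prop
  have hke : ∀ y, k (-y) = k y := fun y => by simp [hk]
  have hkp : Function.Periodic k 1 := fun y => by
    simp only [hk, mul_add, mul_one, Real.sin_add_pi, neg_sq]
  have hdp : Function.Periodic (deriv Φ) 1 := fun y => by
    rw [← deriv_comp_add_const, funext h.diffeo.add_one, deriv_add_const]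
  have h3 : ∫ y in (0 : ℝ)..1, k y * deriv Φ (-y) = ∫ y in (0 : ℝ)..1, k y * deriv Φ y := by
    have h4 : ∀ y, k y * deriv Φ (-y) = (fun y => k y * deriv Φ y) (-y) := fun y => by
      simp only [hke]
    simp_rw [h4]
    rw [intervalIntegral.integral_comp_neg fun y => k y * deriv Φ y]
    have h5 := (hkp.mul hdp).intervalIntegral_add_eq (-1) 0
    simpa using h5
  rw [h1, pendulumAction]
  have h5 : ∀ y, √(c - U (Φ y)) * deriv Φ y = √(2 * β) * (k y * deriv Φ y) := fun y => by
    rw [h2, mul_assoc]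
  have h6 : ∀ y, √(z - Real.sin (Real.pi * y) ^ 2) * Θ (Real.sin (Real.pi * y) ^ 2) =
      (k y * deriv Φ y + k y * deriv Φ (-y)) / 2 := fun y => by rw [hΘ]; ring
  simp_rw [h5, h6]
  rw [intervalIntegral.integral_const_mul, intervalIntegral.integral_div,
    intervalIntegral.integral_add (Continuous.intervalIntegrable (by fun_prop) _ _)
      (Continuous.intervalIntegrable (by fun_prop) _ _), h3]
  ring

/-- The even part of the density `Φ'` is a `C²` function of `sin² (π y)`. -/
theorem IsCircleDiffeo.exists_density {Φ : ℝ → ℝ} (h : IsCircleDiffeo Φ) :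
    ∃ Θ : ℝ → ℝ, ContDiff ℝ 2 Θ ∧
      ∀ y, Θ (Real.sin (Real.pi * y) ^ 2) = (deriv Φ y + deriv Φ (-y)) / 2 := by
  have h1 := (contDiff_infty_iff_deriv.1 h.smooth).2
  have hdp : Function.Periodic (deriv Φ) 1 := fun y => by
    rw [← deriv_comp_add_const, funext h.add_one, deriv_add_const]
  refine exists_comp_sin_sq (by fun_prop) (fun y => ?_) fun y => ?_
  · have h2 := hdp (-(y + 1))
    rw [show -(y + 1) + 1 = -y by ring] at h2
    simp only [hdp y, h2]
  · simp only [neg_neg]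
    ring

/-! ### The pendulum action below the critical energy -/

theorem mul_sin_sq_lt_one {z : ℝ} (hz : z < 1) (φ : ℝ) : z * Real.sin φ ^ 2 < 1 := by
  have h1 := Real.sin_sq_le_one φ
  have h2 := sq_nonneg (Real.sin φ)
  rcases le_or_gt z 0 with h | h
  · nlinarith
  · nlinarith

theorem hasDerivAt_integral_sin_sq {w f f' : ℝ → ℝ} (hw : Continuous w)
    (hf : ∀ x < 1, HasDerivAt f (f' x) x) (hf' : ContinuousOn f' (Iio 1)) {z : ℝ} (hz : z < 1) :
    HasDerivAt (fun z => ∫ φ in -(Real.pi / 2)..Real.pi / 2, w φ * f (z * Real.sin φ ^ 2))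
      (∫ φ in -(Real.pi / 2)..Real.pi / 2,
        w φ * Real.sin φ ^ 2 * f' (z * Real.sin φ ^ 2)) z := by
  have hπ := Real.pi_pos
  have hfc : ContinuousOn f (Iio 1) := fun x hx => (hf x hx).continuousAt.continuousWithinAt
  have hmap : MapsTo (fun p : ℝ × ℝ => p.1 * Real.sin p.2 ^ 2)
      (Iio 1 ×ˢ Icc (-(Real.pi / 2)) (Real.pi / 2)) (Iio 1) := fun p hp =>
    mul_sin_sq_lt_one hp.1 _
  have hin : Continuous fun p : ℝ × ℝ => p.1 * Real.sin p.2 ^ 2 := by fun_prop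
  refine hasDerivAt_intervalIntegral (F := fun z φ => w φ * f (z * Real.sin φ ^ 2))
    (F' := fun z φ => w φ * Real.sin φ ^ 2 * f' (z * Real.sin φ ^ 2)) isOpen_Iio (by linarith)
    ?_ ?_ (fun z hz φ _ => ?_) hz
  · exact (hw.comp continuous_snd).continuousOn.mul (hfc.comp hin.continuousOn hmap)
  · exact ((hw.comp continuous_snd).mul (by fun_prop)).continuousOn.mul
      (hf'.comp hin.continuousOn hmap)
  · have h1 : HasDerivAt (fun z : ℝ => z * Real.sin φ ^ 2) (1 * Real.sin φ ^ 2) z :=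
      (hasDerivAt_id z).mul_const _
    have h2 := ((hf _ (mul_sin_sq_lt_one hz φ)).comp z h1).const_mul (w φ)
    exact h2.congr_deriv (by ring)

theorem hasDerivAt_inv_sqrt {x : ℝ} (hx : x < 1) :
    HasDerivAt (fun x => (√(1 - x))⁻¹) ((√(1 - x))⁻¹ ^ 3 / 2) x := by
  have h0 : 0 < 1 - x := sub_pos.2 hx
  have h1 : HasDerivAt (fun x : ℝ => 1 - x) (-1) x := (hasDerivAt_id x).const_sub 1
  have h2 := (h1.sqrt h0.ne').inv (Real.sqrt_pos.2 h0).ne'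
  refine h2.congr_deriv ?_
  have := (Real.sqrt_pos.2 h0).ne'
  field_simp

/-- The integrand of the action variable in the coordinate `φ` given by `sin (π y) = √z sin φ`. -/
noncomputable def librationKernel (Θ : ℝ → ℝ) (x : ℝ) : ℝ := Θ x * (√(1 - x))⁻¹

/-- The derivative of `librationKernel`. -/
noncomputable def librationKernel' (Θ : ℝ → ℝ) (x : ℝ) : ℝ :=
  deriv Θ x * (√(1 - x))⁻¹ + Θ x * ((√(1 - x))⁻¹ ^ 3 / 2)

theorem hasDerivAt_librationKernel {Θ : ℝ → ℝ} (hΘ : ContDiff ℝ 2 Θ) {x : ℝ} (hx : x < 1) :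
    HasDerivAt (librationKernel Θ) (librationKernel' Θ x) x :=
  ((hΘ.differentiable (by simp)) x).hasDerivAt.mul (hasDerivAt_inv_sqrt hx)

theorem contDiffOn_librationKernel' {Θ : ℝ → ℝ} (hΘ : ContDiff ℝ 2 Θ) :
    ContDiffOn ℝ 1 (librationKernel' Θ) (Iio 1) := by
  have h1 : ContDiff ℝ 1 (deriv Θ) := by
    rw [show (2 : WithTop ℕ∞) = 1 + 1 by norm_num, contDiff_succ_iff_deriv] at hΘ
    exact hΘ.2.2
  have h2 : ContDiffOn ℝ 1 (fun x : ℝ => (√(1 - x))⁻¹) (Iio 1) := by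
    have hp : ∀ x ∈ Iio (1 : ℝ), 1 - x ≠ 0 := fun x hx => (sub_pos.2 hx).ne'
    exact ((contDiff_const.sub contDiff_id).contDiffOn.sqrt hp).inv fun x hx =>
      (Real.sqrt_pos.2 (sub_pos.2 hx)).ne'
  exact (h1.contDiffOn.mul h2).add ((hΘ.of_le (by norm_num)).contDiffOn.mul ((h2.pow 3).div_const 2))

/-- The derivative of the action below the critical energy `z = 1`. -/
noncomputable def libration₁ (Θ : ℝ → ℝ) (z : ℝ) : ℝ :=
  1 / (2 * Real.pi) *
    ∫ φ in -(Real.pi / 2)..Real.pi / 2, librationKernel Θ (z * Real.sin φ ^ 2)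

/-- The second derivative of the action below the critical energy `z = 1`. -/
noncomputable def libration₂ (Θ : ℝ → ℝ) (z : ℝ) : ℝ :=
  1 / (2 * Real.pi) * ∫ φ in -(Real.pi / 2)..Real.pi / 2,
    Real.sin φ ^ 2 * librationKernel' Θ (z * Real.sin φ ^ 2)

theorem hasDerivAt_libration₁ {Θ : ℝ → ℝ} (hΘ : ContDiff ℝ 2 Θ) {z : ℝ} (hz : z < 1) :
    HasDerivAt (libration₁ Θ) (libration₂ Θ z) z := by
  have h1 := (hasDerivAt_integral_sin_sq (w := fun _ => 1) continuous_const
    (fun _ hx => hasDerivAt_librationKernel hΘ hx)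
    (contDiffOn_librationKernel' hΘ).continuousOn hz).const_mul (1 / (2 * Real.pi))
  simp only [one_mul] at h1
  exact h1

theorem differentiableAt_libration₂ {Θ : ℝ → ℝ} (hΘ : ContDiff ℝ 2 Θ) {z : ℝ} (hz : z < 1) :
    DifferentiableAt ℝ (libration₂ Θ) z := by
  have h1 := contDiffOn_librationKernel' hΘ
  have h2 : ∀ x < 1, HasDerivAt (librationKernel' Θ) (deriv (librationKernel' Θ) x) x :=
    fun x hx => ((h1.differentiableOn (by simp)).differentiableAt (Iio_mem_nhds hx)).hasDerivAt
  have h3 : ContinuousOn (deriv (librationKernel' Θ)) (Iio 1) :=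
    h1.continuousOn_deriv_of_isOpen isOpen_Iio (by simp)
  exact ((hasDerivAt_integral_sin_sq (by fun_prop) h2 h3 hz).const_mul _).differentiableAt

theorem continuous_librationKernel_comp {Θ : ℝ → ℝ} (hΘ : ContDiff ℝ 2 Θ) {z : ℝ} (hz : z < 1) :
    Continuous fun φ => librationKernel Θ (z * Real.sin φ ^ 2) := by
  rw [continuous_iff_continuousAt]
  intro φ
  exact ContinuousAt.comp (f := fun φ => z * Real.sin φ ^ 2)
    (hasDerivAt_librationKernel hΘ (mul_sin_sq_lt_one hz φ)).continuousAt (by fun_prop)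

theorem continuous_librationKernel'_comp {Θ : ℝ → ℝ} (hΘ : ContDiff ℝ 2 Θ) {z : ℝ} (hz : z < 1) :
    Continuous fun φ => librationKernel' Θ (z * Real.sin φ ^ 2) := by
  rw [continuous_iff_continuousAt]
  intro φ
  exact ContinuousAt.comp (f := fun φ => z * Real.sin φ ^ 2)
    ((contDiffOn_librationKernel' hΘ).continuousOn.continuousAt
      (Iio_mem_nhds (mul_sin_sq_lt_one hz φ))) (by fun_prop)

/-- The action below the critical energy, in the coordinate `φ`. -/
noncomputable def librationAction (Θ : ℝ → ℝ) (z : ℝ) : ℝ :=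
  1 / Real.pi * (z * ∫ φ in -(Real.pi / 2)..Real.pi / 2,
    Real.cos φ ^ 2 * librationKernel Θ (z * Real.sin φ ^ 2))

/-- The two expressions for the derivative of the action agree by an integration by parts. -/
theorem hasDerivAt_librationAction {Θ : ℝ → ℝ} (hΘ : ContDiff ℝ 2 Θ) {z : ℝ} (hz : z < 1) :
    HasDerivAt (librationAction Θ) (libration₁ Θ z) z := by
  have hπ := Real.pi_pos
  have h1 := ((hasDerivAt_id z).mul (hasDerivAt_integral_sin_sq (w := fun φ => Real.cos φ ^ 2)
    (by fun_prop) (fun _ hx => hasDerivAt_librationKernel hΘ hx)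
    (contDiffOn_librationKernel' hΘ).continuousOn hz)).const_mul (1 / Real.pi)
  refine h1.congr_deriv ?_
  have c1 := continuous_librationKernel_comp hΘ hz
  have c2 := continuous_librationKernel'_comp hΘ hz
  have hd : ∀ φ ∈ uIcc (-(Real.pi / 2)) (Real.pi / 2), HasDerivAt
      (fun φ => librationKernel Θ (z * Real.sin φ ^ 2) * (Real.sin φ * Real.cos φ))
      (2 * z * (Real.cos φ ^ 2 * Real.sin φ ^ 2 * librationKernel' Θ (z * Real.sin φ ^ 2)) +
        (2 * (Real.cos φ ^ 2 * librationKernel Θ (z * Real.sin φ ^ 2)) -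
          librationKernel Θ (z * Real.sin φ ^ 2))) φ := by
    intro φ _
    have h2 : HasDerivAt (fun φ => z * Real.sin φ ^ 2) (z * (2 * Real.sin φ * Real.cos φ)) φ := by
      have := ((Real.hasDerivAt_sin φ).pow 2).const_mul z
      refine this.congr_deriv ?_
      simp
    have h3 := ((hasDerivAt_librationKernel hΘ (mul_sin_sq_lt_one hz φ)).comp φ h2).mul
      ((Real.hasDerivAt_sin φ).mul (Real.hasDerivAt_cos φ))
    refine h3.congr_deriv ?_
    simp only [Function.comp, Pi.mul_apply]
    linear_combination (-librationKernel Θ (z * Real.sin φ ^ 2)) * Real.sin_sq_add_cos_sq φ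
  have h4 := intervalIntegral.integral_eq_sub_of_hasDerivAt hd
    (Continuous.intervalIntegrable (by fun_prop) _ _)
  rw [intervalIntegral.integral_add (Continuous.intervalIntegrable (by fun_prop) _ _)
      (Continuous.intervalIntegrable (by fun_prop) _ _),
    intervalIntegral.integral_sub (Continuous.intervalIntegrable (by fun_prop) _ _)
      (Continuous.intervalIntegrable (by fun_prop) _ _), intervalIntegral.integral_const_mul,
    intervalIntegral.integral_const_mul, Real.cos_neg, Real.cos_pi_div_two] at h4
  simp only [mul_zero, sub_self] at h4
  simp only [libration₁, id, one_mul] at h4 ⊢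
  field_simp
  linear_combination h4

/-- The substitution `sin (π y) = √z sin φ` removes the square root singularity at the turning points.
Outside the interval between them the square root of a negative number contributes nothing. -/
theorem pendulumAction_eq_libration {Θ : ℝ → ℝ} (hΘ : ContDiff ℝ 2 Θ) {z : ℝ} (h0 : 0 ≤ z)
    (hz : z < 1) : pendulumAction Θ z = librationAction Θ z := by
  have hπ := Real.pi_pos
  have hΘc := hΘ.continuous
  set k := √z with hk
  have hk0 : 0 ≤ k := Real.sqrt_nonneg z
  have hkz : k ^ 2 = z := Real.sq_sqrt h0
  have hk1 : k < 1 := by nlinarith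
  set g : ℝ → ℝ := fun y =>
    √(z - Real.sin (Real.pi * y) ^ 2) * Θ (Real.sin (Real.pi * y) ^ 2) with hg
  have hgc : Continuous g := by rw [hg]; fun_prop
  have hgp : Function.Periodic g 1 := fun y => by
    simp only [hg, mul_add, mul_one, Real.sin_add_pi, neg_sq]
  set r := Real.arcsin k / Real.pi with hr
  have hr0 : 0 ≤ r := div_nonneg (Real.arcsin_nonneg.2 hk0) hπ.le
  have hr1 : r ≤ 1 / 2 := by
    rw [hr, div_le_iff₀ hπ]
    linarith [Real.arcsin_le_pi_div_two k]
  have hz0 : ∀ y, |y| ≤ 1 / 2 → r ≤ |y| → g y = 0 := by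
    intro y hy1 hy2
    simp only [hg]
    rw [Real.sqrt_eq_zero_of_nonpos, zero_mul]
    have h1 : Real.sin (Real.pi * y) ^ 2 = Real.sin (Real.pi * |y|) ^ 2 := by
      rcases abs_cases y with h | h <;> rw [h.1]
      rw [mul_neg, Real.sin_neg, neg_sq]
    have h2 : k ≤ Real.sin (Real.pi * |y|) := by
      rw [hr, div_le_iff₀ hπ] at hy2
      have h3 := Real.sin_arcsin (by linarith) hk1.le
      rw [← h3]
      exact Real.sin_le_sin_of_le_of_le_pi_div_two (Real.neg_pi_div_two_le_arcsin k)
        (by nlinarith) (by linarith)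
    rw [h1, ← hkz]
    nlinarith
  have h1 : pendulumAction Θ z = ∫ y in -r..r, g y := by
    have h2 := hgp.intervalIntegral_add_eq 0 (-(1 / 2))
    rw [zero_add, show -(1 / 2) + 1 = (1 / 2 : ℝ) by norm_num] at h2
    have i : ∀ a b, IntervalIntegrable g volume a b := fun a b => hgc.intervalIntegrable a b
    have h3 : ∫ y in -(1 / 2)..-r, g y = 0 := by
      rw [intervalIntegral.integral_congr (g := fun _ => 0), intervalIntegral.integral_zero]
      intro y hy
      rw [uIcc_of_le (by linarith)] at hy
      exact hz0 y (by rw [abs_of_nonpos (by linarith [hy.2])]; linarith [hy.1])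
        (by rw [abs_of_nonpos (by linarith [hy.2])]; linarith [hy.2])
    have h4 : ∫ y in r..1 / 2, g y = 0 := by
      rw [intervalIntegral.integral_congr (g := fun _ => 0), intervalIntegral.integral_zero]
      intro y hy
      rw [uIcc_of_le (by linarith)] at hy
      exact hz0 y (by rw [abs_of_nonneg (by linarith [hy.1])]; linarith [hy.2])
        (by rw [abs_of_nonneg (by linarith [hy.1])]; linarith [hy.1])
    rw [show pendulumAction Θ z = ∫ y in (0 : ℝ)..1, g y from rfl, h2,
      ← intervalIntegral.integral_add_adjacent_intervals (i _ (-r)) (i _ _),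
      ← intervalIntegral.integral_add_adjacent_intervals (i (-r) r) (i _ _), h3, h4]
    ring
  set y : ℝ → ℝ := fun φ => Real.arcsin (k * Real.sin φ) / Real.pi with hy
  have hs : ∀ φ, |k * Real.sin φ| < 1 := by
    intro φ
    rw [abs_mul, abs_of_nonneg hk0]
    have := Real.abs_sin_le_one φ
    have := abs_nonneg (Real.sin φ)
    nlinarith
  have hyd : ∀ φ, HasDerivAt y (k * Real.cos φ * (√(1 - z * Real.sin φ ^ 2))⁻¹ / Real.pi) φ := by
    intro φ
    have h2 := abs_lt.1 (hs φ)
    have h3 := ((Real.hasDerivAt_arcsin (by linarith) (by linarith)).comp φ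
      ((Real.hasDerivAt_sin φ).const_mul k)).div_const Real.pi
    refine h3.congr_deriv ?_
    rw [← hkz, mul_pow]
    ring
  have hyc : Continuous fun φ =>
      k * Real.cos φ * (√(1 - z * Real.sin φ ^ 2))⁻¹ / Real.pi := by
    have : ∀ φ, √(1 - z * Real.sin φ ^ 2) ≠ 0 := fun φ =>
      (Real.sqrt_pos.2 (sub_pos.2 (mul_sin_sq_lt_one hz φ))).ne'
    fun_prop (disch := assumption)
  have h5 := intervalIntegral.integral_comp_mul_deriv (a := -(Real.pi / 2)) (b := Real.pi / 2)
    (g := g) (fun φ _ => hyd φ) hyc.continuousOn hgc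
  have h6 : y (Real.pi / 2) = r := by simp [hy, hr]
  have h7 : y (-(Real.pi / 2)) = -r := by simp [hy, hr, neg_div]
  rw [h6, h7] at h5
  rw [h1, ← h5, librationAction, ← intervalIntegral.integral_const_mul,
    ← intervalIntegral.integral_const_mul]
  refine intervalIntegral.integral_congr fun φ hφ => ?_
  rw [uIcc_of_le (by linarith)] at hφ
  have h8 : Real.sin (Real.pi * y φ) = k * Real.sin φ := by
    have h9 := abs_lt.1 (hs φ)
    rw [hy, mul_div_cancel₀ _ hπ.ne', Real.sin_arcsin h9.1.le h9.2.le]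
  have hcos : 0 ≤ Real.cos φ := Real.cos_nonneg_of_mem_Icc hφ
  have h10 : √(z - z * Real.sin φ ^ 2) = k * Real.cos φ := by
    rw [show z - z * Real.sin φ ^ 2 = (k * Real.cos φ) ^ 2 by
      rw [mul_pow, hkz, Real.cos_sq']; ring]
    exact Real.sqrt_sq (mul_nonneg hk0 hcos)
  simp only [Function.comp, hg, h8, librationKernel]
  rw [mul_pow, hkz, h10]
  rw [← hkz]
  ring

/-! ### The pendulum action above the critical energy, and its derivatives -/

/-- The integral `∫ (z - sin² (π y)) ^ r Θ (sin² (π y)) dy`, for energies `z` above the critical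
one. -/
noncomputable def rotation (Θ : ℝ → ℝ) (r z : ℝ) : ℝ :=
  ∫ y in (0 : ℝ)..1, (z - Real.sin (Real.pi * y) ^ 2) ^ r * Θ (Real.sin (Real.pi * y) ^ 2)

theorem sub_sin_sq_pos {z : ℝ} (hz : 1 < z) (x : ℝ) : 0 < z - Real.sin x ^ 2 := by
  linarith [Real.sin_sq_le_one x]

theorem continuousOn_rotation_integrand {Θ : ℝ → ℝ} (hΘ : Continuous Θ) (r : ℝ) :
    ContinuousOn (fun p : ℝ × ℝ => (p.1 - Real.sin (Real.pi * p.2) ^ 2) ^ r *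
      Θ (Real.sin (Real.pi * p.2) ^ 2)) (Ioi 1 ×ˢ Icc 0 1) := by
  refine ContinuousOn.mul (ContinuousOn.rpow_const (by fun_prop) fun p hp => ?_) (by fun_prop)
  exact Or.inl (sub_sin_sq_pos hp.1 _).ne'

theorem hasDerivAt_rotation {Θ : ℝ → ℝ} (hΘ : Continuous Θ) (r : ℝ) {z : ℝ} (hz : 1 < z) :
    HasDerivAt (rotation Θ r) (r * rotation Θ (r - 1) z) z := by
  have h1 := hasDerivAt_intervalIntegral
    (F := fun z y => (z - Real.sin (Real.pi * y) ^ 2) ^ r * Θ (Real.sin (Real.pi * y) ^ 2))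
    (F' := fun z y => r * ((z - Real.sin (Real.pi * y) ^ 2) ^ (r - 1) *
      Θ (Real.sin (Real.pi * y) ^ 2)))
    isOpen_Ioi zero_le_one (continuousOn_rotation_integrand hΘ r)
    (continuousOn_const.mul (continuousOn_rotation_integrand hΘ (r - 1)))
    (fun z hz y _ => ?_) hz
  · rw [intervalIntegral.integral_const_mul] at h1
    exact h1
  · have h2 := (((hasDerivAt_id z).sub_const (Real.sin (Real.pi * y) ^ 2)).rpow_const (p := r)
      (Or.inl (sub_sin_sq_pos hz _).ne')).mul_const (Θ (Real.sin (Real.pi * y) ^ 2))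
    refine h2.congr_deriv ?_
    simp only [id]
    ring

theorem pendulumAction_eq_rotation (Θ : ℝ → ℝ) (z : ℝ) :
    pendulumAction Θ z = rotation Θ (1 / 2) z := by
  simp only [pendulumAction, rotation, Real.sqrt_eq_rpow]

/-- The derivative of the action of the pendulum, for `0 ≤ z`, `z ≠ 1`. At negative `z` the action
vanishes and this is not its derivative, but the integral formula continues smoothly to these `z`,
so that differentiation at `z = 0` can be two-sided. -/
noncomputable def pendulum₁ (Θ : ℝ → ℝ) (z : ℝ) : ℝ :=
  if z < 1 then libration₁ Θ z else 1 / 2 * rotation Θ (-1 / 2) z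

/-- The derivative of `pendulum₁`, for `z ≠ 1`. -/
noncomputable def pendulum₂ (Θ : ℝ → ℝ) (z : ℝ) : ℝ :=
  if z < 1 then libration₂ Θ z else -1 / 4 * rotation Θ (-3 / 2) z

theorem pendulum₁_of_lt {Θ : ℝ → ℝ} {z : ℝ} (hz : z < 1) : pendulum₁ Θ z = libration₁ Θ z :=
  if_pos hz

theorem pendulum₂_of_lt {Θ : ℝ → ℝ} {z : ℝ} (hz : z < 1) : pendulum₂ Θ z = libration₂ Θ z :=
  if_pos hz

theorem pendulum₁_of_gt {Θ : ℝ → ℝ} {z : ℝ} (hz : 1 < z) :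
    pendulum₁ Θ z = 1 / 2 * rotation Θ (-1 / 2) z := if_neg hz.not_gt

theorem pendulum₂_of_gt {Θ : ℝ → ℝ} {z : ℝ} (hz : 1 < z) :
    pendulum₂ Θ z = -1 / 4 * rotation Θ (-3 / 2) z := if_neg hz.not_gt

theorem hasDerivWithinAt_pendulumAction {Θ : ℝ → ℝ} (hΘ : ContDiff ℝ 2 Θ) {z : ℝ} (h0 : 0 ≤ z)
    (h1 : z ≠ 1) : HasDerivWithinAt (pendulumAction Θ) (pendulum₁ Θ z) (Ici 0) z := by
  rcases lt_or_gt_of_ne h1 with hz | hz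
  · rw [pendulum₁_of_lt hz]
    refine (hasDerivAt_librationAction hΘ hz).hasDerivWithinAt.congr_of_eventuallyEq_of_mem ?_ h0
    filter_upwards [self_mem_nhdsWithin, mem_nhdsWithin_of_mem_nhds (Iio_mem_nhds hz)] with x h2 h3
    exact pendulumAction_eq_libration hΘ h2 h3
  · rw [pendulum₁_of_gt hz, funext (pendulumAction_eq_rotation Θ)]
    have h2 := (hasDerivAt_rotation hΘ.continuous (1 / 2) hz).hasDerivWithinAt (s := Ici 0)
    rwa [show (1 / 2 - 1 : ℝ) = -1 / 2 by norm_num] at h2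

theorem hasDerivAt_pendulum₁ {Θ : ℝ → ℝ} (hΘ : ContDiff ℝ 2 Θ) {z : ℝ}
    (h1 : z ≠ 1) : HasDerivAt (pendulum₁ Θ) (pendulum₂ Θ z) z := by
  rcases lt_or_gt_of_ne h1 with hz | hz
  · rw [pendulum₂_of_lt hz]
    refine (hasDerivAt_libration₁ hΘ hz).congr_of_eventuallyEq ?_
    filter_upwards [Iio_mem_nhds hz] with x h3
    exact pendulum₁_of_lt h3
  · rw [pendulum₂_of_gt hz]
    have h2 := (hasDerivAt_rotation hΘ.continuous (-1 / 2) hz).const_mul (1 / 2)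
    rw [show (-1 / 2 - 1 : ℝ) = -3 / 2 by norm_num] at h2
    refine (h2.congr_deriv (by ring)).congr_of_eventuallyEq ?_
    filter_upwards [Ioi_mem_nhds hz] with x h3
    exact pendulum₁_of_gt h3

theorem differentiableAt_pendulum₂ {Θ : ℝ → ℝ} (hΘ : ContDiff ℝ 2 Θ) {z : ℝ}
    (h1 : z ≠ 1) : DifferentiableAt ℝ (pendulum₂ Θ) z := by
  rcases lt_or_gt_of_ne h1 with hz | hz
  · refine (differentiableAt_libration₂ hΘ hz).congr_of_eventuallyEq ?_
    filter_upwards [Iio_mem_nhds hz] with x h3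
    exact pendulum₂_of_lt h3
  · have h2 := (hasDerivAt_rotation hΘ.continuous (-3 / 2) hz).const_mul (-1 / 4)
    refine h2.differentiableAt.congr_of_eventuallyEq ?_
    filter_upwards [Ioi_mem_nhds hz] with x h3
    exact pendulum₂_of_gt h3

theorem intervalIntegrable_pendulum {Θ : ℝ → ℝ} (hΘ : Continuous Θ) (z : ℝ) :
    IntervalIntegrable (fun y => √(z - Real.sin (Real.pi * y) ^ 2) *
      Θ (Real.sin (Real.pi * y) ^ 2)) volume 0 1 :=
  Continuous.intervalIntegrable (by fun_prop) _ _

theorem pendulumAction_add_mul {Θ E : ℝ → ℝ} (hΘ : Continuous Θ) (hE : Continuous E) (ε z : ℝ) :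
    pendulumAction (fun x => Θ x + ε * E x) z = pendulumAction Θ z + ε * pendulumAction E z := by
  rw [pendulumAction, pendulumAction, pendulumAction, ← intervalIntegral.integral_const_mul,
    ← intervalIntegral.integral_add (intervalIntegrable_pendulum hΘ z)
      ((intervalIntegrable_pendulum hE z).const_mul ε)]
  refine intervalIntegral.integral_congr fun y _ => ?_
  ring

theorem pendulum₁_add_mul {Θ E : ℝ → ℝ} (hΘ : ContDiff ℝ 2 Θ) (hE : ContDiff ℝ 2 E) (ε : ℝ)
    {z : ℝ} (h0 : 0 ≤ z) (h1 : z ≠ 1) :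
    pendulum₁ (fun x => Θ x + ε * E x) z = pendulum₁ Θ z + ε * pendulum₁ E z := by
  refine UniqueDiffWithinAt.eq_deriv (Ici 0) (uniqueDiffOn_Ici (0 : ℝ) z h0)
    (hasDerivWithinAt_pendulumAction (by fun_prop) h0 h1) ?_
  rw [funext (pendulumAction_add_mul hΘ.continuous hE.continuous ε)]
  exact (hasDerivWithinAt_pendulumAction hΘ h0 h1).add
    ((hasDerivWithinAt_pendulumAction hE h0 h1).const_mul ε)

theorem pendulum₂_add_mul {Θ E : ℝ → ℝ} (hΘ : ContDiff ℝ 2 Θ) (hE : ContDiff ℝ 2 E) (ε : ℝ)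
    {z : ℝ} (h0 : 0 ≤ z) (h1 : z ≠ 1) :
    pendulum₂ (fun x => Θ x + ε * E x) z = pendulum₂ Θ z + ε * pendulum₂ E z := by
  refine UniqueDiffWithinAt.eq_deriv (Ici 0) (uniqueDiffOn_Ici (0 : ℝ) z h0)
    (hasDerivAt_pendulum₁ (Θ := fun x => Θ x + ε * E x) (by fun_prop) h1).hasDerivWithinAt ?_
  refine (((hasDerivAt_pendulum₁ hΘ h1).add
    ((hasDerivAt_pendulum₁ hE h1).const_mul ε)).hasDerivWithinAt).congr_of_eventuallyEq_of_mem ?_ h0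
  filter_upwards [self_mem_nhdsWithin, mem_nhdsWithin_of_mem_nhds (isOpen_ne.mem_nhds h1)]
    with x h2 h3
  exact pendulum₁_add_mul hΘ hE ε h2 h3

theorem integral_sin_sq_half :
    ∫ φ in -(Real.pi / 2)..Real.pi / 2, Real.sin φ ^ 2 = Real.pi / 2 := by
  rw [integral_sin_sq]
  simp

/-- Lower order terms are absorbed by a constant. -/
theorem exists_cubic_lower_bound {a b : ℝ} (ha : 0 < a) (hb : 0 < b) :
    ∃ K, 0 < K ∧ ∀ X : ℝ, 0 ≤ X → -K ≤ a * X ^ 3 - b * X := by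
  refine ⟨b * (1 + b / a), by positivity, fun X hX => ?_⟩
  rcases le_total X (1 + b / a) with h | h
  · have h1 : b * X ≤ b * (1 + b / a) := mul_le_mul_of_nonneg_left h hb.le
    have : 0 ≤ a * X ^ 3 := by positivity
    linarith
  · have h1 : 1 ≤ X := le_trans (by simp; positivity) h
    have h2 : b ≤ a * X := by
      have := mul_le_mul_of_nonneg_left h ha.le
      rw [mul_add, mul_one, mul_div_cancel₀ _ ha.ne'] at this
      linarith
    have h3 : b * X ≤ a * X * X := mul_le_mul_of_nonneg_right h2 hX
    have h4 : a * X * X * 1 ≤ a * X * X * X :=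
      mul_le_mul_of_nonneg_left h1 (by positivity)
    have h5 : 0 ≤ b * (1 + b / a) := by positivity
    nlinarith

theorem continuous_inv_sqrt_sin {z : ℝ} (hz : z < 1) :
    Continuous fun φ => (√(1 - z * Real.sin φ ^ 2))⁻¹ := by
  have : ∀ φ, √(1 - z * Real.sin φ ^ 2) ≠ 0 := fun φ =>
    (Real.sqrt_pos.2 (sub_pos.2 (mul_sin_sq_lt_one hz φ))).ne'
  fun_prop (disch := assumption)

/-- The integral `∫ sin² φ (1 - z sin² φ) ^ (-3 / 2) dφ` blows up at the critical energy. -/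
theorem div_le_integral_sin_sq {z : ℝ} (hz : 1 / 2 < z) (hz1 : z < 1) :
    1 / (16 * (1 - z)) ≤ ∫ φ in -(Real.pi / 2)..Real.pi / 2,
      Real.sin φ ^ 2 * (√(1 - z * Real.sin φ ^ 2))⁻¹ ^ 3 := by
  have hπ := Real.pi_pos
  have hπ3 := Real.pi_gt_three
  set e := √(1 - z) with he
  have he0 : 0 < e := Real.sqrt_pos.2 (by linarith)
  have he2 : e ^ 2 = 1 - z := Real.sq_sqrt (by linarith)
  have he1 : e < 1 := by nlinarith
  have hXc := continuous_inv_sqrt_sin hz1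
  have hD : ∀ φ, 0 < 1 - z * Real.sin φ ^ 2 := fun φ => sub_pos.2 (mul_sin_sq_lt_one hz1 φ)
  have e1 : ∀ φ ∈ Icc (Real.pi / 2 - e) (Real.pi / 2),
      1 / (16 * e ^ 3) ≤ Real.sin φ ^ 2 * (√(1 - z * Real.sin φ ^ 2))⁻¹ ^ 3 := by
    intro φ hφ
    have g1 : Real.cos φ ^ 2 ≤ e ^ 2 := by
      rw [← Real.sin_pi_div_two_sub]
      have g2 : Real.sin (Real.pi / 2 - φ) ≤ e :=
        (Real.sin_le (by linarith [hφ.2])).trans (by linarith [hφ.1])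
      have g3 : 0 ≤ Real.sin (Real.pi / 2 - φ) :=
        Real.sin_nonneg_of_nonneg_of_le_pi (by linarith [hφ.2]) (by linarith [hφ.1])
      exact pow_le_pow_left₀ g3 g2 2
    have g4 := Real.sin_sq_add_cos_sq φ
    have g5 : 1 / 2 ≤ Real.sin φ ^ 2 := by linarith
    have g6 : 1 - z * Real.sin φ ^ 2 ≤ 4 * e ^ 2 := by
      have : 1 - z * Real.sin φ ^ 2 = (1 - z) + z * Real.cos φ ^ 2 := by
        rw [Real.cos_sq']; ring
      rw [this]
      nlinarith [sq_nonneg (Real.cos φ)]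
    have g7 : √(1 - z * Real.sin φ ^ 2) ≤ 2 * e := by
      rw [Real.sqrt_le_iff]
      exact ⟨by positivity, by linarith [mul_pow 2 e 2]⟩
    have g8 : (2 * e)⁻¹ ≤ (√(1 - z * Real.sin φ ^ 2))⁻¹ :=
      inv_anti₀ (Real.sqrt_pos.2 (hD φ)) g7
    calc 1 / (16 * e ^ 3) = 1 / 2 * (2 * e)⁻¹ ^ 3 := by field_simp; norm_num
      _ ≤ _ := by gcongr
  rw [← he2]
  calc 1 / (16 * e ^ 2) = ∫ φ in (Real.pi / 2 - e)..Real.pi / 2, 1 / (16 * e ^ 3) := by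
        rw [intervalIntegral.integral_const, smul_eq_mul]
        field_simp
        ring
    _ ≤ ∫ φ in (Real.pi / 2 - e)..Real.pi / 2,
          Real.sin φ ^ 2 * (√(1 - z * Real.sin φ ^ 2))⁻¹ ^ 3 :=
        intervalIntegral.integral_mono_on (by linarith) intervalIntegrable_const
          (Continuous.intervalIntegrable (by fun_prop) _ _) e1
    _ ≤ _ := by
        refine intervalIntegral.integral_mono_interval (by linarith) (by linarith) le_rfl
          (.of_forall fun φ => ?_) (Continuous.intervalIntegrable (by fun_prop) _ _)
        have := hD φ
        positivity

/-- A lower bound for the integrand of `libration₂ - L * libration₁`. Here `S` is `sin² φ`, the numbers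
`t`, `t'` are the values of the density and of its derivative, and `x = (1 - z S) ^ (-1 / 2)`. The cubic
term in `x`, whose integral diverges at the critical energy, dominates. -/
theorem libration_integrand_lower_bound {m M L K S t t' x z : ℝ} (hm : 0 < m)
    (hcub : ∀ X : ℝ, 0 ≤ X → -K ≤ m / 4 * X ^ 3 - (|M| + |L| * |M| + m / 4) * X)
    (hs0 : 0 ≤ S) (hs1 : S ≤ 1) (hz1 : z ≤ 1) (e1 : m ≤ t) (e2 : t ≤ M) (e3 : |t'| ≤ M)
    (hx0 : 0 < x) (hxD : x ^ 2 * (1 - z * S) = 1) :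
    m / 4 * (S * x ^ 3) - K ≤ S * (t' * x + t * (x ^ 3 / 2)) - L * (t * x) := by
  have f1 : x ^ 3 - x ≤ S * x ^ 3 := by
    have h1 : x ^ 3 - x = z * S * x ^ 3 := by linear_combination x * hxD
    rw [h1]
    have : z * S ≤ 1 * S := mul_le_mul_of_nonneg_right hz1 hs0
    nlinarith [pow_pos hx0 3]
  have f2 : -(|M| * x) ≤ S * (t' * x) := by
    have g1 : |S * t'| ≤ |M| := by
      rw [abs_mul, abs_of_nonneg hs0]
      have := abs_nonneg t'
      nlinarith [le_abs_self M]
    have g2 := (abs_le.1 g1).1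
    nlinarith
  have f3 : L * (t * x) ≤ |L| * |M| * x := by
    have g1 : L * t ≤ |L| * |M| := by
      refine (le_abs_self _).trans ?_
      rw [abs_mul, abs_of_pos (hm.trans_le e1)]
      exact mul_le_mul_of_nonneg_left (e2.trans (le_abs_self M)) (abs_nonneg L)
    nlinarith
  have f4 : m * (S * x ^ 3) ≤ t * (S * x ^ 3) :=
    mul_le_mul_of_nonneg_right e1 (by positivity)
  have f5 := hcub x hx0.le
  have f6 : m / 4 * (x ^ 3 - x) ≤ m / 4 * (S * x ^ 3) :=
    mul_le_mul_of_nonneg_left f1 (by positivity)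
  linarith

/-- Below and close to the critical energy, the second derivative of the action dominates the
first one, uniformly over bounded sets of densities. -/
theorem exists_libration_dominates {m : ℝ} (hm : 0 < m) (M L : ℝ) :
    ∃ δ, 0 < δ ∧ δ < 1 ∧ ∀ Θ : ℝ → ℝ, ContDiff ℝ 2 Θ → (∀ x ∈ Icc (0 : ℝ) 1, m ≤ Θ x) →
      (∀ x ∈ Icc (0 : ℝ) 1, Θ x ≤ M) → (∀ x ∈ Icc (0 : ℝ) 1, |deriv Θ x| ≤ M) →
      ∀ z, 1 - δ < z → z < 1 → L * libration₁ Θ z < libration₂ Θ z := by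
  have hπ := Real.pi_pos
  obtain ⟨K, hK0, hcub⟩ := exists_cubic_lower_bound (a := m / 4) (b := |M| + |L| * |M| + m / 4)
    (by positivity) (by positivity)
  refine ⟨min (1 / 2) (m / 4 / (16 * Real.pi * K)), by positivity,
    (min_le_left _ _).trans_lt (by norm_num), fun Θ hΘ h1 h2 h3 z hz hz1 => ?_⟩
  have hzh : 1 / 2 < z := by linarith [min_le_left (1 / 2) (m / 4 / (16 * Real.pi * K))]
  have hzK : 1 - z < m / 4 / (16 * Real.pi * K) := by
    linarith [min_le_right (1 / 2) (m / 4 / (16 * Real.pi * K))]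
  have c1 := continuous_librationKernel_comp hΘ hz1
  have c2 := continuous_librationKernel'_comp hΘ hz1
  have c3 := continuous_inv_sqrt_sin hz1
  have hD : ∀ φ, 0 < 1 - z * Real.sin φ ^ 2 := fun φ => sub_pos.2 (mul_sin_sq_lt_one hz1 φ)
  have hpt : ∀ φ, m / 4 * (Real.sin φ ^ 2 * (√(1 - z * Real.sin φ ^ 2))⁻¹ ^ 3) - K ≤
      Real.sin φ ^ 2 * librationKernel' Θ (z * Real.sin φ ^ 2) -
        L * librationKernel Θ (z * Real.sin φ ^ 2) := by
    intro φ
    have hx : z * Real.sin φ ^ 2 ∈ Icc (0 : ℝ) 1 :=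
      ⟨by positivity, (mul_sin_sq_lt_one hz1 φ).le⟩
    refine libration_integrand_lower_bound hm hcub (sq_nonneg _) (Real.sin_sq_le_one φ) hz1.le
      (h1 _ hx) (h2 _ hx) (h3 _ hx) (inv_pos.2 (Real.sqrt_pos.2 (hD φ))) ?_
    rw [inv_pow, Real.sq_sqrt (hD φ).le, inv_mul_cancel₀ (hD φ).ne']
  have e1 := intervalIntegral.integral_mono (a := -(Real.pi / 2)) (b := Real.pi / 2)
    (μ := volume) (by linarith)
    (Continuous.intervalIntegrable (by fun_prop) _ _)
    (Continuous.intervalIntegrable (by fun_prop) _ _) hpt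
  rw [intervalIntegral.integral_sub (Continuous.intervalIntegrable (by fun_prop) _ _)
      intervalIntegrable_const, intervalIntegral.integral_const_mul,
    intervalIntegral.integral_sub (Continuous.intervalIntegrable (by fun_prop) _ _)
      (Continuous.intervalIntegrable (by fun_prop) _ _), intervalIntegral.integral_const_mul,
    intervalIntegral.integral_const, smul_eq_mul] at e1
  have hlow := mul_le_mul_of_nonneg_left (div_le_integral_sin_sq hzh hz1)
    (show 0 ≤ m / 4 by positivity)
  have hfin : Real.pi * K < m / 4 * (1 / (16 * (1 - z))) := by
    have g1 : 0 < 1 - z := by linarith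
    rw [lt_div_iff₀ (by positivity)] at hzK
    rw [mul_one_div, lt_div_iff₀ (by positivity)]
    linarith
  rw [libration₁, libration₂, mul_left_comm]
  refine mul_lt_mul_of_pos_left ?_ (by positivity)
  linarith

theorem libration₁_pos {Θ : ℝ → ℝ} (hΘ : ContDiff ℝ 2 Θ) {z : ℝ} (h0 : 0 ≤ z) (hz : z < 1)
    (h : ∀ x ∈ Icc 0 z, 0 < Θ x) : 0 < libration₁ Θ z := by
  have hπ := Real.pi_pos
  refine mul_pos (by positivity) ?_
  have c1 := continuous_librationKernel_comp hΘ hz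
  refine intervalIntegral.intervalIntegral_pos_of_pos (Continuous.intervalIntegrable (by fun_prop) _ _)
    (fun φ => ?_) (by linarith)
  refine mul_pos (h _ ⟨by positivity, ?_⟩)
    (inv_pos.2 (Real.sqrt_pos.2 (sub_pos.2 (mul_sin_sq_lt_one hz φ))))
  exact mul_le_of_le_one_right h0 (Real.sin_sq_le_one φ)

/-- For a density that grows like `(1 + x) ^ n`, the logarithmic derivative of the derivative of
the action is at least `n / 4`; this is Chebyshev's inequality for `sin²` and an increasing
function of it. -/
theorem libration_growth {Θ : ℝ → ℝ} (hΘ : ContDiff ℝ 2 Θ) {n : ℕ} {x₁ z : ℝ} (hx₁ : x₁ ≤ 1)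
    (h : ∀ x < x₁, Θ x = (1 + x) ^ n) (h0 : 0 ≤ z) (hz : z < x₁) :
    n / 4 * libration₁ Θ z ≤ libration₂ Θ z := by
  have hπ := Real.pi_pos
  have hz1 : z < 1 := hz.trans_le hx₁
  have c1 := continuous_librationKernel_comp hΘ hz1
  have c2 := continuous_librationKernel'_comp hΘ hz1
  have hmono : MonotoneOn (librationKernel Θ) (Ico 0 x₁) := by
    intro x hx y hy hxy
    have hy1 : 0 < 1 - y := by linarith [hy.2]
    have hx0 := hx.1
    rw [librationKernel, librationKernel, h x hx.2, h y hy.2]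
    have := Real.sqrt_pos.2 hy1
    have hy0 := hy.1
    gcongr
  have hmem : ∀ t ∈ Icc (0 : ℝ) 1, z * t ∈ Ico 0 x₁ := fun t ht =>
    ⟨mul_nonneg h0 ht.1, (mul_le_of_le_one_right h0 ht.2).trans_lt hz⟩
  set F := librationKernel Θ (z * (1 / 2)) with hF
  have hpt : ∀ φ, (n / 4 : ℝ) * librationKernel Θ (z * Real.sin φ ^ 2) +
      n / 2 * F * (Real.sin φ ^ 2 - 1 / 2) ≤
      Real.sin φ ^ 2 * librationKernel' Θ (z * Real.sin φ ^ 2) := by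
    intro φ
    have hs : Real.sin φ ^ 2 ∈ Icc (0 : ℝ) 1 := ⟨sq_nonneg _, Real.sin_sq_le_one φ⟩
    set S := Real.sin φ ^ 2
    have hx := hmem S hs
    set x := z * S with hxdef
    have hn0 : (0 : ℝ) ≤ n := n.cast_nonneg
    have hX : 0 < (√(1 - x))⁻¹ := inv_pos.2 (Real.sqrt_pos.2 (by linarith [hx.2]))
    have e1 : deriv Θ x = n * (1 + x) ^ (n - 1) := by
      have : Θ =ᶠ[𝓝 x] fun x => (1 + x) ^ n := by
        filter_upwards [Iio_mem_nhds hx.2] with y hy using h y hy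
      rw [this.deriv_eq]
      have h5 := ((hasDerivAt_id x).const_add 1).pow n
      refine h5.deriv.trans ?_
      simp
    have hx0 := hx.1
    have e2 : n / 2 * (1 + x) ^ n ≤ n * (1 + x) ^ (n - 1) := by
      rcases Nat.eq_zero_or_pos n with h6 | h6
      · simp [h6]
      · obtain ⟨k, rfl⟩ := Nat.exists_eq_succ_of_ne_zero h6.ne'
        rw [Nat.succ_sub_one, pow_succ]
        have : 0 < (1 + x) ^ k := by positivity
        have h7 : 1 + x ≤ 2 := by linarith [hx.2]
        nlinarith [mul_le_mul_of_nonneg_left h7 (mul_nonneg hn0 this.le)]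
    have e3 : n / 2 * librationKernel Θ x ≤ librationKernel' Θ x := by
      rw [librationKernel, librationKernel', e1, h x hx.2]
      have h8 : 0 ≤ (1 + x) ^ n * ((√(1 - x))⁻¹ ^ 3 / 2) := by positivity
      nlinarith
    have e4 : 0 ≤ (S - 1 / 2) * (librationKernel Θ x - F) := by
      have hh := hmem (1 / 2) ⟨by norm_num, by norm_num⟩
      rcases le_total S (1 / 2) with h9 | h9
      · exact mul_nonneg_of_nonpos_of_nonpos (by linarith)
          (sub_nonpos.2 (hmono hx hh (mul_le_mul_of_nonneg_left h9 h0)))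
      · exact mul_nonneg (by linarith)
          (sub_nonneg.2 (hmono hh hx (mul_le_mul_of_nonneg_left h9 h0)))
    have e5 := mul_le_mul_of_nonneg_left e3 hs.1
    have e6 := mul_nonneg (show (0 : ℝ) ≤ n / 2 by positivity) e4
    nlinarith
  have e1 := intervalIntegral.integral_mono (a := -(Real.pi / 2)) (b := Real.pi / 2)
      (μ := volume) (by linarith)
      (Continuous.intervalIntegrable (by fun_prop) _ _)
      (Continuous.intervalIntegrable (by fun_prop) _ _) hpt
  rw [intervalIntegral.integral_add (Continuous.intervalIntegrable (by fun_prop) _ _)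
      (Continuous.intervalIntegrable (by fun_prop) _ _),
    intervalIntegral.integral_const_mul,
    intervalIntegral.integral_const_mul (n / 2 * F),
    intervalIntegral.integral_sub (Continuous.intervalIntegrable (by fun_prop) _ _)
      intervalIntegrable_const, integral_sin_sq_half, intervalIntegral.integral_const,
    smul_eq_mul, show Real.pi / 2 - (Real.pi / 2 - -(Real.pi / 2)) * (1 / 2) = 0 by ring, mul_zero,
    add_zero] at e1
  have e2 := mul_le_mul_of_nonneg_left e1 (show 0 ≤ 1 / (2 * Real.pi) by positivity)
  rw [libration₁, libration₂]
  linarith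

theorem libration₁_zero (Θ : ℝ → ℝ) : libration₁ Θ 0 = Θ 0 / 2 := by
  have hπ := Real.pi_pos
  simp only [libration₁, librationKernel, zero_mul, sub_zero, Real.sqrt_one, inv_one, mul_one,
    intervalIntegral.integral_const, smul_eq_mul]
  field_simp
  ring

theorem rotation_pos {Θ : ℝ → ℝ} (hΘ : Continuous Θ) (h : ∀ x ∈ Icc (0 : ℝ) 1, 0 < Θ x) (r : ℝ)
    {z : ℝ} (hz : 1 < z) : 0 < rotation Θ r z := by
  have hc : ContinuousOn (fun y => (z - Real.sin (Real.pi * y) ^ 2) ^ r *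
      Θ (Real.sin (Real.pi * y) ^ 2)) (Icc 0 1) :=
    (continuousOn_rotation_integrand hΘ r).comp (f := fun y => (z, y)) (by fun_prop)
      fun y hy => ⟨hz, hy⟩
  refine intervalIntegral.intervalIntegral_pos_of_pos_on ?_ (fun y _ => ?_) one_pos
  · exact ContinuousOn.intervalIntegrable (by rwa [uIcc_of_le zero_le_one])
  · exact mul_pos (Real.rpow_pos_of_pos (sub_sin_sq_pos hz _) r)
      (h _ ⟨sq_nonneg _, Real.sin_sq_le_one _⟩)

/-! ### Null sets of parameters -/

/-- A set on which `f` has a nonzero derivative is null as soon as its image is null. -/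
theorem volume_eq_zero_of_image {f f' : ℝ → ℝ} {s : Set ℝ}
    (hf : ∀ x ∈ s, HasDerivWithinAt f (f' x) s x) (h0 : ∀ x ∈ s, f' x ≠ 0)
    (him : volume (f '' s) = 0) : volume s = 0 := by
  classical
  rcases s.eq_empty_or_nonempty with rfl | hne
  · simp
  have key : ∀ A : ℝ →L[ℝ] ℝ, A.det ≠ 0 → ∃ δ : NNReal, 0 < δ ∧
      ∀ t : Set ℝ, ApproximatesLinearOn f A t δ → volume (f '' t) = 0 → volume t = 0 := by
    intro A hA
    have hpos : 0 < |A.det| := abs_pos.2 hA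
    have hm : ((|A.det| / 2).toNNReal : ENNReal) < ENNReal.ofReal |A.det| :=
      (ENNReal.ofReal_lt_ofReal_iff hpos).2 (by linarith)
    obtain ⟨δ, h1, h2⟩ := ((mul_le_addHaar_image_of_lt_det volume A hm).and
      self_mem_nhdsWithin).exists
    refine ⟨δ, h2, fun t ht h3 => ?_⟩
    have h4 := h1 t f ht
    rw [h3, nonpos_iff_eq_zero, mul_eq_zero] at h4
    refine h4.resolve_left ?_
    rw [ENNReal.coe_eq_zero, Real.toNNReal_eq_zero]
    linarith
  choose! r hr0 hr using key
  obtain ⟨t, A, -, -, hst, happ, hA⟩ := exists_partition_approximatesLinearOn_of_hasFDerivWithinAt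
    f s (fun x => ContinuousLinearMap.toSpanSingleton ℝ (f' x))
    (fun x hx => (hf x hx).hasFDerivWithinAt) (fun A => if A.det = 0 then 1 else r A) fun A => by
      split_ifs with h
      · exact one_ne_zero
      · exact (hr0 A h).ne'
  have hsub : s ⊆ ⋃ n, s ∩ t n := by
    rw [← inter_iUnion]
    exact subset_inter subset_rfl hst
  refine measure_mono_null hsub (measure_iUnion_null fun n => ?_)
  obtain ⟨y, hy, hAy⟩ := hA hne n
  have hdet : (A n).det ≠ 0 := by
    rw [hAy]
    simpa using h0 y hy
  have h1 := happ n
  simp only [hdet, if_false] at h1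
  exact hr (A n) hdet _ h1 (measure_mono_null (image_mono inter_subset_left) him)

/-- In a pencil `S + ε u` of functions with `u' ≠ 0`, for almost every `ε` all critical points are
nondegenerate and all critical values avoid a given null set. The critical points of `S + ε u` form
the level set `g = ε` of `g = -S' / u'`; they are nondegenerate where `g' ≠ 0`, and along the
critical points the critical value is `V = S + g u`, with `V' = g' u`. -/
theorem volume_bad_pencil {K N : Set ℝ} {S S₁ S₂ u u₁ u₂ : ℝ → ℝ} (hN : volume N = 0)
    (hS : ∀ c ∈ K, HasDerivWithinAt S (S₁ c) K c) (hS₁ : ∀ c ∈ K, HasDerivWithinAt S₁ (S₂ c) K c)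
    (hu : ∀ c ∈ K, HasDerivWithinAt u (u₁ c) K c) (hu₁ : ∀ c ∈ K, HasDerivWithinAt u₁ (u₂ c) K c)
    (h0 : ∀ c ∈ K, u₁ c ≠ 0) :
    volume {ε | ∃ c ∈ K, S₁ c + ε * u₁ c = 0 ∧ (S₂ c + ε * u₂ c = 0 ∨ S c + ε * u c ∈ N)} = 0 := by
  set g : ℝ → ℝ := fun c => -S₁ c / u₁ c with hg
  set g₁ : ℝ → ℝ := fun c => (-S₂ c * u₁ c - -S₁ c * u₂ c) / u₁ c ^ 2 with hg₁
  have hgd : ∀ c ∈ K, HasDerivWithinAt g (g₁ c) K c := fun c hc =>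
    (hS₁ c hc).neg.div (hu₁ c hc) (h0 c hc)
  have hVd : ∀ c ∈ K, HasDerivWithinAt (fun c => S c + g c * u c) (g₁ c * u c) K c := by
    intro c hc
    refine ((hS c hc).add ((hgd c hc).mul (hu c hc))).congr_deriv ?_
    have := h0 c hc
    simp only [hg]
    field_simp
    ring
  set Z₁ := {c | c ∈ K ∧ g₁ c = 0} with hZ₁
  set Z₂ := {c | c ∈ K ∧ u c = 0} with hZ₂
  set Z₃ := {c | c ∈ K ∧ g₁ c * u c ≠ 0 ∧ S c + g c * u c ∈ N} with hZ₃
  have k₁ : Z₁ ⊆ K := fun c hc => hc.1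
  have k₂ : Z₂ ⊆ K := fun c hc => hc.1
  have k₃ : Z₃ ⊆ K := fun c hc => hc.1
  have n₁ : volume (g '' Z₁) = 0 := by
    refine addHaar_image_eq_zero_of_det_fderivWithin_eq_zero volume
      (fun c hc => ((hgd c hc.1).mono k₁).hasFDerivWithinAt) fun c hc => ?_
    simpa using hc.2
  have null_image : ∀ Z ⊆ K, volume Z = 0 → volume (g '' Z) = 0 := fun Z hZ hZ0 =>
    addHaar_image_eq_zero_of_differentiableOn_of_addHaar_eq_zero volume
      (fun c hc => ((hgd c (hZ hc)).mono hZ).differentiableWithinAt) hZ0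
  have n₂ : volume (g '' Z₂) = 0 := by
    refine null_image Z₂ k₂ (volume_eq_zero_of_image (fun c hc => (hu c hc.1).mono k₂)
      (fun c hc => h0 c hc.1) (measure_mono_null (t := {0}) ?_ (by simp)))
    rintro _ ⟨c, hc, rfl⟩
    exact hc.2
  have n₃ : volume (g '' Z₃) = 0 := by
    refine null_image Z₃ k₃ (volume_eq_zero_of_image (fun c hc => (hVd c hc.1).mono k₃)
      (fun c hc => hc.2.1) (measure_mono_null (t := N) ?_ hN))
    rintro _ ⟨c, hc, rfl⟩
    exact hc.2.2
  refine measure_mono_null ?_ (measure_union_null (measure_union_null n₁ n₂) n₃)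
  rintro ε ⟨c, hc, h1, h2⟩
  have hu0 := h0 c hc
  have hgε : g c = ε := by
    simp only [hg]
    rw [div_eq_iff hu0]
    linarith
  by_cases hg0 : g₁ c = 0
  · exact Or.inl (Or.inl ⟨c, ⟨hc, hg0⟩, hgε⟩)
  by_cases hu0' : u c = 0
  · exact Or.inl (Or.inr ⟨c, ⟨hc, hu0'⟩, hgε⟩)
  refine Or.inr ⟨c, ⟨hc, mul_ne_zero hg0 hu0', ?_⟩, hgε⟩
  rcases h2 with h2 | h2
  · exfalso
    apply hg0
    simp only [hg₁]
    rw [div_eq_zero_iff]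
    left
    rw [show S₂ c = -(ε * u₂ c) by linarith, show S₁ c = -(ε * u₁ c) by linarith]
    ring
  · rwa [hgε]

/-- Convergence by Cauchy condensation. -/
theorem summable_one_div_mul_log_sq :
    Summable fun q : ℕ => 1 / ((q : ℝ) * Real.log (1 + q) ^ 2) := by
  have hnn : ∀ q : ℕ, 0 ≤ 1 / ((q : ℝ) * Real.log (1 + q) ^ 2) := fun q => by positivity
  rw [← summable_condensed_iff_of_nonneg hnn]
  · have h2 : Summable fun k : ℕ => 4 / Real.log 2 ^ 2 * (1 / ((k + 1 : ℕ) : ℝ) ^ 2) :=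
      ((summable_nat_add_iff 1).2 (Real.summable_one_div_nat_pow.2 one_lt_two)).mul_left _
    refine h2.of_nonneg_of_le (fun k => mul_nonneg (by positivity) (hnn _)) fun k => ?_
    have hl2 : 0 < Real.log 2 := Real.log_pos one_lt_two
    have h3 : ((k + 1 : ℕ) : ℝ) / 2 * Real.log 2 ≤ Real.log (1 + ((2 ^ k : ℕ) : ℝ)) := by
      rcases Nat.eq_zero_or_pos k with rfl | hk
      · norm_num
        linarith
      · have h4 : (k : ℝ) * Real.log 2 ≤ Real.log (1 + ((2 ^ k : ℕ) : ℝ)) := by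
          rw [← Real.log_pow]
          refine Real.log_le_log (by positivity) ?_
          push_cast
          linarith
        refine le_trans ?_ h4
        have : (1 : ℝ) ≤ k := by exact_mod_cast hk
        push_cast
        gcongr
        linarith
    have h5 : (2 : ℝ) ^ k * (1 / (((2 ^ k : ℕ) : ℝ) * Real.log (1 + ((2 ^ k : ℕ) : ℝ)) ^ 2)) =
        1 / Real.log (1 + ((2 ^ k : ℕ) : ℝ)) ^ 2 := by
      push_cast
      have : (2 : ℝ) ^ k ≠ 0 := by positivity
      field_simp
    rw [h5]
    have h6 : 4 / Real.log 2 ^ 2 * (1 / ((k + 1 : ℕ) : ℝ) ^ 2) =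
        1 / (((k + 1 : ℕ) : ℝ) / 2 * Real.log 2) ^ 2 := by
      field_simp
      norm_num
    rw [h6]
    gcongr
  · intro m n hm hmn
    have hm' : (0 : ℝ) < m := by exact_mod_cast hm
    have hmn' : (m : ℝ) ≤ n := by exact_mod_cast hmn
    have := Real.log_pos (show 1 < 1 + (m : ℝ) by linarith)
    gcongr

/-- Almost every real number is typical, by the Borel–Cantelli lemma with `τ = 2`. -/
theorem volume_not_isTypical : volume {α : ℝ | ¬IsTypical α} = 0 := by
  set r : ℕ → ℝ := fun q => 1 / ((q : ℝ) * Real.log (1 + q) ^ 2) with hr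
  have hr0 : ∀ q, 0 ≤ r q := fun q => by simp only [hr]; positivity
  have hr3 : ∀ q : ℕ, 1 ≤ q → r q ≤ 3 := by
    intro q hq
    have hq' : (1 : ℝ) ≤ q := by exact_mod_cast hq
    have h1 : Real.log 2 ≤ Real.log (1 + q) := Real.log_le_log two_pos (by linarith)
    have h2 := Real.log_two_gt_d9
    simp only [hr]
    rw [div_le_iff₀ (mul_pos (by linarith) (pow_pos (by linarith) 2))]
    have h3 : (0.69 : ℝ) ^ 2 ≤ Real.log (1 + q) ^ 2 := pow_le_pow_left₀ (by norm_num) (by linarith) 2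
    nlinarith
  -- the real numbers of absolute value at most `M` that are too close to a fraction `k / q`
  have bc : ∀ M : ℕ, ∀ᵐ α : ℝ, |α| ≤ M → ∀ᶠ q : ℕ in atTop, ∀ k : ℤ, r q ≤ |k + α * q| := by
    intro M
    set s : ℕ → Set ℝ := fun q =>
      ⋃ k ∈ Finset.Icc (-((M * q + 3 : ℕ) : ℤ)) ((M * q + 3 : ℕ) : ℤ),
        Metric.ball (-(k : ℝ) / q) (r q / q) with hs
    have hvol : ∀ q : ℕ, 1 ≤ q → volume (s q) ≤ ENNReal.ofReal ((4 * M + 14) * r q) := by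
      intro q hq
      have hq' : (1 : ℝ) ≤ q := by exact_mod_cast hq
      refine (measure_biUnion_finset_le _ _).trans ?_
      simp only [Real.volume_ball, Finset.sum_const, Int.card_Icc]
      rw [← ENNReal.ofReal_nsmul]
      refine ENNReal.ofReal_le_ofReal ?_
      rw [show (((M * q + 3 : ℕ) : ℤ) + 1 - -((M * q + 3 : ℕ) : ℤ)).toNat = 2 * (M * q) + 7 by omega,
        nsmul_eq_mul]
      push_cast
      rw [show (2 * ((M : ℝ) * q) + 7) * (2 * (r q / q)) = (4 * (M * q) + 14) * r q / q by ring,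
        div_le_iff₀ (by linarith)]
      have := hr0 q
      nlinarith [mul_nonneg this (sub_nonneg.2 hq')]
    have hsum : ∑' q, volume (s (q + 1)) ≠ (⊤ : ENNReal) := by
      refine ne_top_of_le_ne_top ?_ (ENNReal.tsum_le_tsum fun q => hvol (q + 1) (by omega))
      have h1 : Summable fun q => (4 * (M : ℝ) + 14) * r (q + 1) :=
        ((summable_nat_add_iff 1).2 summable_one_div_mul_log_sq).mul_left _
      exact h1.tsum_ofReal_ne_top
    filter_upwards [ae_eventually_notMem hsum] with α hα hM
    suffices h : ∀ᶠ q : ℕ in atTop, ∀ k : ℤ, r (q + 1) ≤ |k + α * ((q + 1 : ℕ) : ℝ)| by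
      rw [← map_add_atTop_eq_nat 1]
      exact h
    filter_upwards [hα] with q hq k
    by_contra hlt
    push Not at hlt
    apply hq
    have hq0 : (0 : ℝ) < ((q + 1 : ℕ) : ℝ) := by positivity
    have hk : |(k : ℝ)| ≤ M * ((q + 1 : ℕ) : ℝ) + 3 := by
      have h1 := abs_sub_abs_le_abs_sub (k : ℝ) (-(α * ((q + 1 : ℕ) : ℝ)))
      rw [sub_neg_eq_add, abs_neg, abs_mul, abs_of_pos hq0] at h1
      have h2 := hr3 (q + 1) (by omega)
      have h3 := mul_le_mul_of_nonneg_right hM hq0.le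
      linarith
    simp only [hs, mem_iUnion]
    refine ⟨k, ?_, ?_⟩
    · rw [abs_le] at hk
      rw [Finset.mem_Icc]
      constructor
      · have : (-((M * (q + 1) + 3 : ℕ) : ℤ) : ℝ) ≤ k := by push_cast at hk ⊢; linarith [hk.1]
        exact_mod_cast this
      · have : (k : ℝ) ≤ (((M * (q + 1) + 3 : ℕ) : ℤ) : ℝ) := by push_cast at hk ⊢; linarith [hk.2]
        exact_mod_cast this
    · rw [Metric.mem_ball, Real.dist_eq, lt_div_iff₀ hq0]
      refine lt_of_eq_of_lt ?_ hlt
      rw [← abs_of_pos hq0, ← abs_mul, abs_of_pos hq0]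
      congr 1
      field_simp
      ring
  have hall : ∀ᵐ α : ℝ, ∀ M : ℕ, |α| ≤ M → ∀ᶠ q : ℕ in atTop, ∀ k : ℤ, r q ≤ |k + α * q| :=
    ae_all_iff.2 bc
  have hirr : ∀ᵐ α : ℝ, α ∉ range ((↑) : ℚ → ℝ) := (countable_range _).ae_notMem volume
  rw [← ae_iff]
  filter_upwards [hall, hirr] with α hα hi
  obtain ⟨M, hM⟩ := exists_nat_ge |α|
  obtain ⟨Q, hQ⟩ := eventually_atTop.1 (hα M hM)
  have hd : ∀ q : ℕ, 1 ≤ q → 0 < |α * q - round (α * q)| := by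
    intro q hq
    rw [abs_pos, sub_ne_zero]
    intro h
    apply hi
    have hq' : (q : ℝ) ≠ 0 := by positivity
    exact ⟨(round (α * q) : ℚ) / q, by push_cast; rw [← h]; field_simp⟩
  -- irrationality takes care of the finitely many denominators below `Q`
  have hex : ∀ Q : ℕ, ∃ δ, 0 < δ ∧ δ ≤ 1 ∧ ∀ q : ℕ, 1 ≤ q → q < Q → ∀ k : ℤ,
      δ * r q ≤ |k + α * q| := by
    intro Q
    induction Q with
    | zero => exact ⟨1, one_pos, le_rfl, fun q _ h => absurd h (by omega)⟩
    | succ Q ih =>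
      obtain ⟨δ, h0, h1, h2⟩ := ih
      rcases Nat.eq_zero_or_pos Q with rfl | hQ0
      · exact ⟨1, one_pos, le_rfl, fun q _ h => absurd h (by omega)⟩
      refine ⟨min δ (|α * Q - round (α * Q)| / 3), lt_min h0 (by have := hd Q hQ0; positivity),
        (min_le_left _ _).trans h1, fun q hq hqQ k => ?_⟩
      rcases Nat.lt_succ_iff_lt_or_eq.1 hqQ with h | rfl
      · exact (mul_le_mul_of_nonneg_right (min_le_left _ _) (hr0 q)).trans (h2 q hq h k)
      · refine (mul_le_mul (min_le_right _ _) (hr3 q hq) (hr0 q) (by positivity)).trans ?_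
        rw [div_mul_cancel₀ _ three_ne_zero]
        have := round_le (α * q) (-k)
        push_cast at this
        rwa [sub_neg_eq_add, add_comm] at this
  obtain ⟨δ, h0, h1, h2⟩ := hex Q
  have h3 : ∀ q : ℕ, 1 ≤ q → ∀ k : ℤ, δ * r q ≤ |k + α * q| := by
    intro q hq k
    rcases lt_or_ge q Q with h | h
    · exact h2 q hq h k
    · exact (mul_le_of_le_one_left (hr0 q) h1).trans (hQ q h k)
  refine ⟨2, two_pos, δ, h0, fun k₁ k₂ hk₂ => ?_⟩
  have h4 : |(k₂ : ℝ)| = (k₂.natAbs : ℝ) := by rw [Nat.cast_natAbs, Int.cast_abs]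
  have h5 : 1 ≤ k₂.natAbs := Nat.one_le_iff_ne_zero.2 (Int.natAbs_ne_zero.2 hk₂)
  rw [Real.rpow_two, h4]
  have h6 : ∀ k : ℤ, δ / (k₂.natAbs * Real.log (1 + k₂.natAbs) ^ 2) ≤ |k + α * k₂.natAbs| := by
    intro k
    have := h3 _ h5 k
    simp only [hr] at this
    rwa [mul_one_div] at this
  rw [← h4] at h6 ⊢
  rcases abs_cases (k₂ : ℝ) with h | h
  · rw [h.1] at h6 ⊢
    exact h6 k₁
  · rw [h.1] at h6 ⊢
    have := h6 (-k₁)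
    push_cast at this
    rwa [mul_neg, ← neg_add, abs_neg] at this

/-! ### The direction of the perturbation -/

/-- The square root weight that turns integration in `y` into integration in `x = sin² (π y)`. -/
noncomputable def arcsineWeight (g : ℝ → ℝ) (x : ℝ) : ℝ := √(x * (1 - x)) * g x

/-- The substitution `x = sin² (π y)`, where `dx = 2 π √(x (1 - x)) dy` on each half of the period. -/
theorem integral_arcsineWeight {g : ℝ → ℝ} (hg : ContinuousOn g (Icc 0 1)) :
    ∫ y in (0 : ℝ)..1, arcsineWeight g (Real.sin (Real.pi * y) ^ 2) =
      1 / Real.pi * ∫ x in (0 : ℝ)..1, g x := by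
  have hπ := Real.pi_pos
  set H : ℝ → ℝ := fun y => arcsineWeight g (Real.sin (Real.pi * y) ^ 2) with hH
  have hsym : ∀ y, H (1 - y) = H y := by
    intro y
    simp only [hH]
    rw [mul_sub, mul_one, Real.sin_pi_sub]
  have hHc : Continuous H := by
    have h1 : Continuous fun y => g (Real.sin (Real.pi * y) ^ 2) :=
      hg.comp_continuous (by fun_prop) fun y => ⟨sq_nonneg _, Real.sin_sq_le_one _⟩
    exact (show Continuous fun y => √(Real.sin (Real.pi * y) ^ 2 *
      (1 - Real.sin (Real.pi * y) ^ 2)) by fun_prop).mul h1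
  have hi : ∀ a b, IntervalIntegrable H volume a b := fun a b => hHc.intervalIntegrable a b
  have h2 : ∫ y in (1 / 2 : ℝ)..1, H y = ∫ y in (0 : ℝ)..1 / 2, H y := by
    have h3 := intervalIntegral.integral_comp_sub_left (a := 0) (b := 1 / 2) H 1
    rw [show (1 - 1 / 2 : ℝ) = 1 / 2 by norm_num, sub_zero] at h3
    rw [← h3]
    exact intervalIntegral.integral_congr fun y _ => hsym y
  have h4 : ∫ y in (0 : ℝ)..1 / 2, H y = 1 / (2 * Real.pi) * ∫ x in (0 : ℝ)..1, g x := by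
    have h5 := intervalIntegral.integral_comp_mul_deriv' (a := 0) (b := 1 / 2)
      (f := fun y => Real.sin (Real.pi * y) ^ 2) (g := g)
      (fun y _ => hasDerivAt_sin_sq y) (by fun_prop) (hg.mono ?_)
    · simp only [mul_zero, Real.sin_zero, mul_one_div, Real.sin_pi_div_two, one_pow] at h5
      rw [zero_pow two_ne_zero] at h5
      rw [← h5, ← intervalIntegral.integral_const_mul]
      refine intervalIntegral.integral_congr fun y hy => ?_
      rw [uIcc_of_le (by norm_num)] at hy
      have h6 : 0 ≤ Real.sin (Real.pi * y) :=
        Real.sin_nonneg_of_nonneg_of_le_pi (by nlinarith [hy.1]) (by nlinarith [hy.2])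
      have h7 : 0 ≤ Real.cos (Real.pi * y) :=
        Real.cos_nonneg_of_mem_Icc ⟨by nlinarith [hy.1], by nlinarith [hy.2]⟩
      simp only [hH, arcsineWeight, Function.comp]
      rw [← Real.cos_sq', ← mul_pow, Real.sqrt_sq (mul_nonneg h6 h7),
        show 2 * Real.pi * y = 2 * (Real.pi * y) by ring, Real.sin_two_mul]
      field_simp
    · rintro _ ⟨y, -, rfl⟩
      exact ⟨sq_nonneg _, Real.sin_sq_le_one _⟩
  rw [← intervalIntegral.integral_add_adjacent_intervals (hi 0 (1 / 2)) (hi _ _), h2, h4]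
  ring

theorem contDiff_infty_iteratedDeriv {g : ℝ → ℝ} (hg : ContDiff ℝ ∞ g) (j : ℕ) :
    ContDiff ℝ ∞ (iteratedDeriv j g) := by
  induction j with
  | zero => simpa using hg
  | succ j ih => rw [iteratedDeriv_succ]; exact (contDiff_infty_iff_deriv.1 ih).2

section Bump

variable {x₁ x₂ : ℝ}

theorem tsupport_iteratedDeriv_subset_tsupport {g : ℝ → ℝ} (j : ℕ) :
    tsupport (iteratedDeriv j g) ⊆ tsupport g := by
  induction j with
  | zero => simp
  | succ j ih => rw [iteratedDeriv_succ]; exact tsupport_deriv_subset.trans ih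

theorem contDiff_arcsineWeight {g : ℝ → ℝ} (hg : ContDiff ℝ ∞ g) (h1 : 0 < x₁) (h2 : x₂ < 1)
    (hs : tsupport g ⊆ Ioo x₁ x₂) : ContDiff ℝ ∞ (arcsineWeight g) := by
  rw [contDiff_iff_contDiffAt]
  intro x
  by_cases hx : x ∈ tsupport g
  · have hx' := hs hx
    have h3 : x * (1 - x) ≠ 0 := (mul_pos (h1.trans hx'.1) (by linarith [hx'.2])).ne'
    exact ((contDiff_id.mul (contDiff_const.sub contDiff_id)).contDiffAt.sqrt h3).mul hg.contDiffAt
  · refine (contDiffAt_const (c := (0 : ℝ))).congr_of_eventuallyEq ?_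
    filter_upwards [(isClosed_tsupport g).isOpen_compl.mem_nhds hx] with y hy
    rw [arcsineWeight, image_eq_zero_of_notMem_tsupport hy, mul_zero]

/-- Integration of a function supported in `(x₁, x₂)` against a power of `z - x`. -/
noncomputable def powerIntegral (x₁ x₂ : ℝ) (g : ℝ → ℝ) (r z : ℝ) : ℝ :=
  ∫ x in x₁..x₂, g x * (z - x) ^ r

theorem continuousOn_sub_rpow (h2 : x₂ < 1) (r : ℝ) {z : ℝ} (hz : 1 ≤ z) :
    ContinuousOn (fun x : ℝ => (z - x) ^ r) (Icc x₁ x₂) :=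
  ContinuousOn.rpow_const (by fun_prop) fun x hx => Or.inl (by linarith [hx.2] : 0 < z - x).ne'

/-- Integration by parts; the boundary terms vanish because of the support of `g`. -/
theorem powerIntegral_deriv {g : ℝ → ℝ} (hg : ContDiff ℝ ∞ g) (h12 : x₁ < x₂) (h2 : x₂ < 1)
    (hs : tsupport g ⊆ Ioo x₁ x₂) (r : ℝ) {z : ℝ} (hz : 1 ≤ z) :
    powerIntegral x₁ x₂ (deriv g) r z = r * powerIntegral x₁ x₂ g (r - 1) z := by
  have e1 : g x₁ = 0 := image_eq_zero_of_notMem_tsupport fun h => lt_irrefl _ (hs h).1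
  have e2 : g x₂ = 0 := image_eq_zero_of_notMem_tsupport fun h => lt_irrefl _ (hs h).2
  have c1 : Continuous (deriv g) := hg.continuous_deriv (by simp)
  have hd : ∀ x ∈ uIcc x₁ x₂, HasDerivAt (fun x => g x * (z - x) ^ r)
      (deriv g x * (z - x) ^ r - r * (g x * (z - x) ^ (r - 1))) x := by
    intro x hx
    rw [uIcc_of_le h12.le] at hx
    have h3 : 0 < z - x := by linarith [hx.2]
    have h4 := ((hg.differentiable (by simp)) x).hasDerivAt.mul
      (((hasDerivAt_id x).const_sub z).rpow_const (p := r) (Or.inl h3.ne'))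
    refine h4.congr_deriv ?_
    simp only [id]
    ring
  have i1 : IntervalIntegrable (fun x => deriv g x * (z - x) ^ r) volume x₁ x₂ :=
    (c1.continuousOn.mul (uIcc_of_le h12.le ▸ continuousOn_sub_rpow h2 r hz)).intervalIntegrable
  have i2 : IntervalIntegrable (fun x => r * (g x * (z - x) ^ (r - 1))) volume x₁ x₂ :=
    (continuousOn_const.mul (hg.continuous.continuousOn.mul
      (uIcc_of_le h12.le ▸ continuousOn_sub_rpow h2 (r - 1) hz))).intervalIntegrable
  have h5 := intervalIntegral.integral_eq_sub_of_hasDerivAt hd (i1.sub i2)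
  rw [intervalIntegral.integral_sub i1 i2, intervalIntegral.integral_const_mul, e1, e2] at h5
  rw [powerIntegral, powerIntegral]
  linarith

theorem powerIntegral_iteratedDeriv {b : ℝ → ℝ} (hb : ContDiff ℝ ∞ b) (h12 : x₁ < x₂)
    (h2 : x₂ < 1) (hs : tsupport b ⊆ Ioo x₁ x₂) (j : ℕ) (r : ℝ) {z : ℝ} (hz : 1 ≤ z) :
    powerIntegral x₁ x₂ (iteratedDeriv j b) r z =
      (∏ i ∈ Finset.range j, (r - i)) * powerIntegral x₁ x₂ b (r - j) z := by
  induction j generalizing r with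
  | zero => simp
  | succ j ih =>
    rw [iteratedDeriv_succ, powerIntegral_deriv (contDiff_infty_iteratedDeriv hb j) h12 h2
      ((tsupport_iteratedDeriv_subset_tsupport j).trans hs) r hz, ih, Finset.prod_range_succ']
    push_cast
    rw [show r - 1 - (j : ℝ) = r - (j + 1) by ring]
    have : ∀ i : ℕ, r - 1 - (i : ℝ) = r - (i + 1) := fun i => by ring
    simp_rw [this]
    ring

theorem powerIntegral_pos {b : ℝ → ℝ} (hb : Continuous b) (h12 : x₁ < x₂) (h2 : x₂ < 1)
    (h0 : ∀ x, 0 ≤ b x) {x₃ : ℝ} (h3 : x₃ ∈ Ioo x₁ x₂) (hx₃ : 0 < b x₃) (r : ℝ) {z : ℝ}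
    (hz : 1 ≤ z) : 0 < powerIntegral x₁ x₂ b r z := by
  refine intervalIntegral.integral_pos h12
    (hb.continuousOn.mul (continuousOn_sub_rpow h2 r hz)) (fun x hx => ?_)
    ⟨x₃, Ioo_subset_Icc_self h3, ?_⟩
  · exact mul_nonneg (h0 x) (Real.rpow_nonneg (by linarith [hx.2]) r)
  · exact mul_pos hx₃ (Real.rpow_pos_of_pos (by linarith [h3.2]) r)

theorem powerIntegral_le {b : ℝ → ℝ} (hb : Continuous b) (h1 : 0 < x₁) (h12 : x₁ < x₂)
    (h2 : x₂ < 1) (h0 : ∀ x, 0 ≤ b x) (r : ℝ) {z : ℝ} (hz : 1 ≤ z) :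
    powerIntegral x₁ x₂ b r z ≤ z * powerIntegral x₁ x₂ b (r - 1) z := by
  rw [powerIntegral, powerIntegral, ← intervalIntegral.integral_const_mul]
  refine intervalIntegral.integral_mono_on h12.le
    (hb.continuousOn.mul (uIcc_of_le h12.le ▸ continuousOn_sub_rpow h2 r hz)).intervalIntegrable
    (continuousOn_const.mul (hb.continuousOn.mul
      (uIcc_of_le h12.le ▸ continuousOn_sub_rpow h2 (r - 1) hz))).intervalIntegrable fun x hx => ?_
  have h3 : 0 < z - x := by linarith [hx.2]
  have h4 : (z - x) ^ r = (z - x) * (z - x) ^ (r - 1) := by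
    rw [Real.rpow_sub_one h3.ne']
    field_simp
  have h5 : 0 ≤ b x * (z - x) ^ (r - 1) := mul_nonneg (h0 x) (Real.rpow_nonneg h3.le _)
  rw [h4]
  nlinarith [hx.1]

theorem rotation_arcsineWeight {g : ℝ → ℝ} (hg : Continuous g) (h1 : 0 < x₁) (h12 : x₁ < x₂)
    (h2 : x₂ < 1) (hs : tsupport g ⊆ Ioo x₁ x₂) {r z : ℝ}
    (hc : ContinuousOn (fun x : ℝ => (z - x) ^ r) (Icc 0 1)) :
    rotation (arcsineWeight g) r z = 1 / Real.pi * powerIntegral x₁ x₂ g r z := by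
  have hgc : ContinuousOn (fun x => g x * (z - x) ^ r) (Icc 0 1) := hg.continuousOn.mul hc
  have h3 := integral_arcsineWeight hgc
  have h4 : ∀ y : ℝ, arcsineWeight (fun x => g x * (z - x) ^ r) (Real.sin (Real.pi * y) ^ 2) =
      (z - Real.sin (Real.pi * y) ^ 2) ^ r * arcsineWeight g (Real.sin (Real.pi * y) ^ 2) := by
    intro y
    rw [arcsineWeight, arcsineWeight]
    ring
  simp_rw [h4] at h3
  rw [rotation, h3, powerIntegral]
  congr 1
  have hz0 : ∀ x, x ≤ x₁ ∨ x₂ ≤ x → g x = 0 := fun x hx =>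
    image_eq_zero_of_notMem_tsupport fun h => by
      rcases hx with hx | hx
      · linarith [(hs h).1]
      · linarith [(hs h).2]
  have i : ∀ a b, a ≤ b → Icc a b ⊆ Icc 0 1 →
      IntervalIntegrable (fun x => g x * (z - x) ^ r) volume a b := fun a b hab h =>
    ContinuousOn.intervalIntegrable (uIcc_of_le hab ▸ hgc.mono h)
  have e1 : ∫ x in (0 : ℝ)..x₁, g x * (z - x) ^ r = 0 := by
    rw [intervalIntegral.integral_congr (g := fun _ => 0), intervalIntegral.integral_zero]
    intro x hx
    rw [uIcc_of_le h1.le] at hx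
    simp [hz0 x (Or.inl hx.2)]
  have e2 : ∫ x in x₂..1, g x * (z - x) ^ r = 0 := by
    rw [intervalIntegral.integral_congr (g := fun _ => 0), intervalIntegral.integral_zero]
    intro x hx
    rw [uIcc_of_le h2.le] at hx
    simp [hz0 x (Or.inr hx.1)]
  rw [← intervalIntegral.integral_add_adjacent_intervals
      (i 0 x₁ h1.le (Icc_subset_Icc_right (by linarith)))
      (i x₁ 1 (by linarith) (Icc_subset_Icc_left h1.le)),
    ← intervalIntegral.integral_add_adjacent_intervals
      (i x₁ x₂ h12.le (Icc_subset_Icc h1.le h2.le))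
      (i x₂ 1 h2.le (Icc_subset_Icc_left (by linarith))), e1, e2]
  ring

end Bump

theorem continuousOn_sub_rpow_Icc (r : ℝ) {z : ℝ} (hz : 1 < z) :
    ContinuousOn (fun x : ℝ => (z - x) ^ r) (Icc 0 1) :=
  ContinuousOn.rpow_const (by fun_prop) fun x hx => Or.inl (by linarith [hx.2] : 0 < z - x).ne'

theorem prod_half_sub_ne_zero (k : ℤ) (j : ℕ) :
    ∏ i ∈ Finset.range j, ((2 * k + 1 : ℝ) / 2 - i) ≠ 0 := by
  refine Finset.prod_ne_zero_iff.2 fun i _ h => ?_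
  have h1 : (2 * k + 1 : ℝ) = 2 * i := by linarith
  have h2 : 2 * k + 1 = 2 * (i : ℤ) := by exact_mod_cast h1
  omega

/-- The direction of the perturbation of the density. Below the energy `x₀` it is a fast growing
function, and above the critical energy it is dominated by a high derivative of a bump function;
both make the logarithmic derivative of the derivative of its action large. -/
theorem exists_perturbation {x₀ : ℝ} (h0 : 0 ≤ x₀) (hx₀ : x₀ < 1) (n : ℕ) {L zl zh zc : ℝ}
    (hL : 0 ≤ L) (hzl : 1 < zl) (hlh : zl ≤ zh) (hzc : 1 ≤ zc) :
    ∃ E : ℝ → ℝ, ContDiff ℝ ∞ E ∧ ∫ y in (0 : ℝ)..1, E (Real.sin (Real.pi * y) ^ 2) = 0 ∧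
      (∃ x₁, x₀ < x₁ ∧ x₁ ≤ 1 ∧ ∀ x < x₁, E x = (1 + x) ^ n) ∧
      (∀ z ∈ Icc zl zh, L * |pendulum₁ E z| < |pendulum₂ E z|) ∧ pendulum₁ E zh ≠ 0 ∧
      pendulumAction E 1 ≠ 0 ∧ pendulumAction E zc ≠ 0 := by
  have hπ := Real.pi_pos
  obtain ⟨x₁, hx₁, hx₁'⟩ := exists_between hx₀
  obtain ⟨x₂, h12, h2⟩ := exists_between hx₁'
  have h1 : 0 < x₁ := h0.trans_lt hx₁
  set x₃ := (x₁ + x₂) / 2 with hx₃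
  let bump : ContDiffBump x₃ := ⟨(x₂ - x₁) / 8, (x₂ - x₁) / 4, by linarith, by linarith⟩
  set b : ℝ → ℝ := fun x => bump x with hb
  have hbs : ContDiff ℝ ∞ b := bump.contDiff
  have hb0 : ∀ x, 0 ≤ b x := fun x => bump.nonneg
  have hbt : tsupport b ⊆ Ioo x₁ x₂ := by
    rw [hb, show (fun x => bump x) = bump from rfl, bump.tsupport_eq, Real.closedBall_eq_Icc]
    intro x hx
    simp only [bump, hx₃, mem_Icc] at hx
    constructor <;> linarith
  have h3 : x₃ ∈ Ioo x₁ x₂ := ⟨by rw [hx₃]; linarith, by rw [hx₃]; linarith⟩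
  have hb3 : 0 < b x₃ := bump.pos_of_mem_ball (Metric.mem_ball_self (by simp [bump]; linarith))
  have hI : ∀ r z, 1 ≤ z → 0 < powerIntegral x₁ x₂ b r z := fun r z hz =>
    powerIntegral_pos hbs.continuous h12 h2 hb0 h3 hb3 r hz
  -- with `j` derivatives on the bump, `Q` has a logarithmic derivative of order `j / zh`
  obtain ⟨j, hj⟩ := exists_nat_ge (2 * L * zh + 1)
  have hzh : 1 < zh := hzl.trans_le hlh
  have hj1 : 1 ≤ j := by
    have : (1 : ℝ) ≤ j := by nlinarith
    exact_mod_cast this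
  -- the mean value of a density is its rotation integral with exponent `0`
  have hmean : ∀ Θ : ℝ → ℝ, ∫ y in (0 : ℝ)..1, Θ (Real.sin (Real.pi * y) ^ 2) = rotation Θ 0 2 :=
    fun Θ => by simp [rotation]
  set P : ℝ → ℝ := arcsineWeight b with hP
  set Q : ℝ → ℝ := arcsineWeight (iteratedDeriv j b) with hQ
  have hbj := contDiff_infty_iteratedDeriv hbs j
  have hbjt : tsupport (iteratedDeriv j b) ⊆ Ioo x₁ x₂ := (tsupport_iteratedDeriv_subset_tsupport j).trans hbt
  have hPs : ContDiff ℝ ∞ P := contDiff_arcsineWeight hbs h1 h2 hbt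
  have hQs : ContDiff ℝ ∞ Q := contDiff_arcsineWeight hbj h1 h2 hbjt
  have hQI : ∀ r z, 1 ≤ z → ContinuousOn (fun x : ℝ => (z - x) ^ r) (Icc 0 1) →
      rotation Q r z = 1 / Real.pi * ((∏ i ∈ Finset.range j, (r - i)) *
        powerIntegral x₁ x₂ b (r - j) z) := fun r z hz hc => by
    rw [hQ, rotation_arcsineWeight hbj.continuous h1 h12 h2 hbjt hc,
      powerIntegral_iteratedDeriv hbs h12 h2 hbt j r hz]
  have hQmean : rotation Q 0 2 = 0 := by
    rw [hQI 0 2 one_le_two (continuousOn_sub_rpow_Icc 0 one_lt_two),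
      Finset.prod_eq_zero (Finset.mem_range.2 hj1) (by simp)]
    ring
  have hPmean : 0 < rotation P 0 2 := by
    rw [hP, rotation_arcsineWeight hbs.continuous h1 h12 h2 hbt
      (continuousOn_sub_rpow_Icc 0 one_lt_two)]
    have := hI 0 2 one_le_two
    positivity
  -- subtracting `κ P` makes the mean value zero
  set κ := rotation (fun x => (1 + x) ^ n) 0 2 / rotation P 0 2 with hκ
  set E₁ : ℝ → ℝ := fun x => (1 + x) ^ n + -κ * P x with hE₁
  have hE₁s : ContDiff ℝ ∞ E₁ := by rw [hE₁]; fun_prop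
  have hE₁mean : ∫ y in (0 : ℝ)..1, E₁ (Real.sin (Real.pi * y) ^ 2) = 0 := by
    have hPc := hPs.continuous
    simp only [hE₁]
    rw [intervalIntegral.integral_add (Continuous.intervalIntegrable (by fun_prop) _ _)
      (Continuous.intervalIntegrable (by fun_prop) _ _), intervalIntegral.integral_const_mul,
      hmean P, hmean fun x => (1 + x) ^ n, hκ]
    field_simp
    ring
  -- the logarithmic derivative of the contribution of `Q`
  have hQ2 : ∀ z ∈ Icc zl zh, 2 * L * |pendulum₁ Q z| ≤ |pendulum₂ Q z| ∧ pendulum₂ Q z ≠ 0 := by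
    intro z hz
    have hz1 : 1 < z := hzl.trans_le hz.1
    rw [pendulum₁_of_gt hz1, pendulum₂_of_gt hz1,
      hQI _ z hz1.le (continuousOn_sub_rpow_Icc _ hz1),
      hQI _ z hz1.le (continuousOn_sub_rpow_Icc _ hz1)]
    have e1 : (∏ i ∈ Finset.range j, (-3 / 2 - i : ℝ)) =
        (∏ i ∈ Finset.range j, (-1 / 2 - i : ℝ)) * (1 + 2 * j) := by
      have f1 := Finset.prod_range_succ (fun i : ℕ => (-1 / 2 - i : ℝ)) j
      have f2 := Finset.prod_range_succ' (fun i : ℕ => (-1 / 2 - i : ℝ)) j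
      have f3 : ∀ i : ℕ, (-1 / 2 - (i + 1 : ℕ) : ℝ) = -3 / 2 - i := fun i => by push_cast; ring
      simp_rw [f3] at f2
      rw [f1] at f2
      push_cast at f2
      linear_combination 2 * f2
    have e2 := prod_half_sub_ne_zero (-1) j
    rw [show (2 * ((-1 : ℤ) : ℝ) + 1) / 2 = -1 / 2 by norm_num] at e2
    set c := ∏ i ∈ Finset.range j, (-1 / 2 - i : ℝ)
    have e3 := hI (-1 / 2 - j) z hz1.le
    have e4 := hI (-3 / 2 - j) z hz1.le
    have e5 := powerIntegral_le hbs.continuous h1 h12 h2 hb0 (-1 / 2 - j) hz1.le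
    rw [show (-1 / 2 - j - 1 : ℝ) = -3 / 2 - j by ring] at e5
    rw [e1]
    set I := powerIntegral x₁ x₂ b (-1 / 2 - j) z
    set I' := powerIntegral x₁ x₂ b (-3 / 2 - j) z
    have hc := abs_pos.2 e2
    have hj0 : (0 : ℝ) < 1 + 2 * j := by positivity
    refine ⟨?_, by have := e4.ne'; positivity⟩
    have g1 : |1 / 2 * (1 / Real.pi * (c * I))| = 1 / (2 * Real.pi) * (|c| * I) := by
      rw [show 1 / 2 * (1 / Real.pi * (c * I)) = 1 / (2 * Real.pi) * I * c by ring, abs_mul,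
        abs_of_pos (by positivity)]
      ring
    have g2 : |-1 / 4 * (1 / Real.pi * (c * (1 + 2 * j) * I'))| =
        1 / (2 * Real.pi) * (|c| * ((1 + 2 * j) / 2 * I')) := by
      rw [show -1 / 4 * (1 / Real.pi * (c * (1 + 2 * j) * I')) =
        -(1 / (4 * Real.pi) * ((1 + 2 * j) * I') * c) by ring, abs_neg, abs_mul,
        abs_of_pos (by positivity)]
      ring
    rw [g1, g2, mul_left_comm, mul_left_comm (2 * L)]
    refine mul_le_mul_of_nonneg_left (mul_le_mul_of_nonneg_left ?_ hc.le) (by positivity)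
    calc 2 * L * I ≤ 2 * L * (z * I') := mul_le_mul_of_nonneg_left e5 (by positivity)
      _ ≤ 2 * L * (zh * I') := by gcongr; exact hz.2
      _ = 2 * L * zh * I' := by ring
      _ ≤ (1 + 2 * j) / 2 * I' := mul_le_mul_of_nonneg_right (by linarith) e4.le
  have hcont : ∀ Θ : ℝ → ℝ, ContDiff ℝ ∞ Θ → ContinuousOn (pendulum₁ Θ) (Icc zl zh) ∧
      ContinuousOn (pendulum₂ Θ) (Icc zl zh) := by
    intro Θ hΘ
    have hΘ2 : ContDiff ℝ 2 Θ := by exact_mod_cast contDiff_infty.1 hΘ 2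
    exact ⟨fun z hz => (hasDerivAt_pendulum₁ hΘ2
        (hzl.trans_le hz.1).ne').continuousAt.continuousWithinAt,
      fun z hz => (differentiableAt_pendulum₂ hΘ2
        (hzl.trans_le hz.1).ne').continuousAt.continuousWithinAt⟩
  obtain ⟨zm, hzm, hmin⟩ := isCompact_Icc.exists_isMinOn (nonempty_Icc.2 hlh) (hcont Q hQs).2.abs
  set μ := |pendulum₂ Q zm| with hμ
  have hμ0 : 0 < μ := abs_pos.2 (hQ2 zm hzm).2
  obtain ⟨C, hC⟩ := isCompact_Icc.exists_bound_of_continuousOn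
    ((hcont E₁ hE₁s).2.abs.add (continuousOn_const (c := L) |>.mul (hcont E₁ hE₁s).1.abs))
  have two_le : ∀ {Θ : ℝ → ℝ}, ContDiff ℝ ∞ Θ → ContDiff ℝ 2 Θ := fun h => by
    exact_mod_cast contDiff_infty.1 h 2
  have hQa : ∀ z, 1 ≤ z → pendulumAction Q z ≠ 0 := by
    intro z hz
    rw [pendulumAction_eq_rotation, hQI _ z hz
      (ContinuousOn.rpow_const (by fun_prop) fun _ _ => Or.inr (by norm_num))]
    have e2 := prod_half_sub_ne_zero 0 j
    rw [show (2 * ((0 : ℤ) : ℝ) + 1) / 2 = 1 / 2 by norm_num] at e2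
    have := (hI (1 / 2 - j) z hz).ne'
    positivity
  have hQ1 : pendulum₁ Q zh ≠ 0 := by
    rw [pendulum₁_of_gt hzh, hQI _ zh hzh.le (continuousOn_sub_rpow_Icc _ hzh)]
    have e2 := prod_half_sub_ne_zero (-1) j
    rw [show (2 * ((-1 : ℤ) : ℝ) + 1) / 2 = -1 / 2 by norm_num] at e2
    have := (hI (-1 / 2 - j) zh hzh.le).ne'
    positivity
  have avoid : ∀ x y : ℝ, y ≠ 0 → ∀ᶠ K : ℝ in atTop, x + K * y ≠ 0 := by
    intro x y hy
    filter_upwards [eventually_ne_atTop (-x / y)] with K hK h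
    apply hK
    rw [eq_div_iff hy]
    linarith
  -- a large multiple of `Q` dominates `E₁`, and all but one value of `K` avoid each zero
  obtain ⟨K, hK0, hK1, hK2, hK3, hK4⟩ := ((eventually_gt_atTop (2 * C / μ)).and
    ((avoid (pendulum₁ E₁ zh) _ hQ1).and ((avoid (pendulumAction E₁ 1) _ (hQa 1 le_rfl)).and
    ((avoid (pendulumAction E₁ zc) _ (hQa zc hzc)).and (eventually_gt_atTop 0))))).exists
  refine ⟨fun x => E₁ x + K * Q x, hE₁s.add (contDiff_const.mul hQs), ?_, ⟨x₁, hx₁, hx₁'.le, ?_⟩,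
    ?_, ?_, ?_, ?_⟩
  · have c1 := hE₁s.continuous
    have c2 := hQs.continuous
    rw [intervalIntegral.integral_add (Continuous.intervalIntegrable (by fun_prop) _ _)
      (Continuous.intervalIntegrable (by fun_prop) _ _), intervalIntegral.integral_const_mul,
      hE₁mean, hmean Q, hQmean]
    ring
  · intro x hx
    have e1 : b x = 0 := image_eq_zero_of_notMem_tsupport fun h => by linarith [(hbt h).1]
    have e2 : iteratedDeriv j b x = 0 :=
      image_eq_zero_of_notMem_tsupport fun h => by linarith [(hbjt h).1]
    simp [hE₁, hP, hQ, arcsineWeight, e1, e2]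
  · intro z hz
    have hz1 : 1 < z := hzl.trans_le hz.1
    rw [pendulum₁_add_mul (two_le hE₁s) (two_le hQs) K (by linarith) hz1.ne',
      pendulum₂_add_mul (two_le hE₁s) (two_le hQs) K (by linarith) hz1.ne']
    have g1 := (hQ2 z hz).1
    have g2 : μ ≤ |pendulum₂ Q z| := hmin hz
    have g3 : |pendulum₂ E₁ z| + L * |pendulum₁ E₁ z| ≤ C := (le_abs_self _).trans (hC z hz)
    rw [div_lt_iff₀ hμ0] at hK0
    have g4 := abs_add_le (pendulum₁ E₁ z) (K * pendulum₁ Q z)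
    have g5 := abs_sub_abs_le_abs_sub (K * pendulum₂ Q z) (-pendulum₂ E₁ z)
    rw [abs_mul, abs_of_pos hK4] at g4 g5
    rw [sub_neg_eq_add, abs_neg, add_comm (K * _)] at g5
    have g6 := mul_le_mul_of_nonneg_left g4 hL
    have g7 := mul_le_mul_of_nonneg_left g1 hK4.le
    have g8 := mul_le_mul_of_nonneg_left g2 hK4.le
    nlinarith
  · rwa [pendulum₁_add_mul (two_le hE₁s) (two_le hQs) K (by linarith) hzh.ne']
  · rwa [pendulumAction_add_mul hE₁s.continuous hQs.continuous]
  · rwa [pendulumAction_add_mul hE₁s.continuous hQs.continuous]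

/-! ### A criterion for nondegeneracy in terms of slopes -/

/-- Simple zeros are isolated, so there are only finitely many of them in a compact set. -/
theorem finite_zeros_of_simple {f f' : ℝ → ℝ} {K : Set ℝ} (hK : IsCompact K)
    (hf : ∀ c ∈ K, HasDerivWithinAt f (f' c) K c) (h0 : ∀ c ∈ K, f c = 0 → f' c ≠ 0) :
    {c | c ∈ K ∧ f c = 0}.Finite := by
  by_contra hinf
  obtain ⟨c, hc, hacc⟩ := Set.Infinite.exists_accPt_of_subset_isCompact hinf hK fun c hc => hc.1
  have hfr : ∃ᶠ x in 𝓝[K \ {c}] c, f x = 0 := by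
    rw [accPt_iff_frequently] at hacc
    refine frequently_nhdsWithin_iff.2 (hacc.mono fun x hx => ⟨hx.2.2, hx.2.1, hx.1⟩)
  by_cases hfc : f c = 0
  · exact hfr ((hf c hc).eventually_ne (h0 c hc hfc))
  · have := ((hf c hc).continuousWithinAt.mono (sdiff_subset : K \ {c} ⊆ K)).tendsto.eventually_ne
      hfc
    exact hfr this

/-- A criterion for nondegeneracy, for a pair whose action variables have derivatives `F₂' = A`
and `F₁' = -B` with `B > 0` on `[c₄, c₃) ∪ (c₂, c₁]`. The curvature then vanishes where
`A' B - A B'` does. -/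
theorem isNondegenerate_of {U : CircleFun × CircleFun} (hU : U ∈ Omega) {A A' B B' : ℝ → ℝ}
    {K K₀ : Set ℝ} (hK : K = Ico (c₄ U) (c₃ U) ∪ Ioc (c₂ U) (c₁ U))
    (h43 : c₄ U < c₃ U) (h32 : c₃ U < c₂ U) (h21 : c₂ U < c₁ U)
    (hA : ∀ c ∈ K, HasDerivWithinAt (F₂ U) (A c) (Icc (c₄ U) (c₁ U)) c)
    (hA' : ∀ c ∈ K, HasDerivWithinAt A (A' c) (Icc (c₄ U) (c₁ U)) c)
    (hA'' : ∀ c ∈ K, DifferentiableWithinAt ℝ A' (Icc (c₄ U) (c₁ U)) c)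
    (hB : ∀ c ∈ K, HasDerivWithinAt (F₁ U) (-B c) (Icc (c₄ U) (c₁ U)) c)
    (hB' : ∀ c ∈ K, HasDerivWithinAt B (B' c) (Icc (c₄ U) (c₁ U)) c)
    (hB'' : ∀ c ∈ K, DifferentiableWithinAt ℝ B' (Icc (c₄ U) (c₁ U)) c)
    (hBpos : ∀ c ∈ K, 0 < B c) (hK₀ : IsCompact K₀) (hK₀K : K₀ ⊆ K)
    (hzero : ∀ c ∈ K, A' c * B c - A c * B' c = 0 → c ∈ K₀)
    (hsimple : ∀ c ∈ K, A' c * B c - A c * B' c = 0 →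
      derivWithin (fun c => A' c * B c - A c * B' c) (Icc (c₄ U) (c₁ U)) c ≠ 0 ∧
        IsTypical (-(A c / B c)))
    (ht₁ : IsTypical (-(A (c₁ U) / B (c₁ U)))) (ht₄ : IsTypical (-(A (c₄ U) / B (c₄ U))))
    (hr₂ : IsTypical (F₂ U (c₂ U) / F₁ U (c₂ U))) (hr₃ : IsTypical (F₂ U (c₃ U) / F₁ U (c₃ U))) :
    IsNondegenerate U := by
  set I := Icc (c₄ U) (c₁ U) with hI
  have hKI : K ⊆ I := by
    rw [hK]
    rintro c (hc | hc)
    · exact ⟨hc.1, by linarith [hc.2]⟩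
    · exact ⟨by linarith [hc.1], hc.2⟩
  have hud : UniqueDiffOn ℝ I := uniqueDiffOn_Icc (by linarith)
  have hKn : ∀ c ∈ K, K ∈ 𝓝[I] c := by
    intro c hc
    rw [hK] at hc ⊢
    rcases hc with hc | hc
    · filter_upwards [self_mem_nhdsWithin, mem_nhdsWithin_of_mem_nhds (Iio_mem_nhds hc.2)]
        with x h1 h2 using Or.inl ⟨h1.1, h2⟩
    · filter_upwards [self_mem_nhdsWithin, mem_nhdsWithin_of_mem_nhds (Ioi_mem_nhds hc.1)]
        with x h1 h2 using Or.inr ⟨h2, h1.2⟩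
  have e1 : ∀ c ∈ K, dF₂ U c = A c := fun c hc => (hA c hc).derivWithin (hud c (hKI hc))
  have e2 : ∀ c ∈ K, dF₁ U c = -B c := fun c hc => (hB c hc).derivWithin (hud c (hKI hc))
  have e3 : ∀ c ∈ K, ddF₂ U c = A' c := fun c hc =>
    ((hA' c hc).congr_of_eventuallyEq_of_mem (by filter_upwards [hKn c hc] with x hx using e1 x hx)
      (hKI hc)).derivWithin (hud c (hKI hc))
  have e4 : ∀ c ∈ K, ddF₁ U c = -B' c := fun c hc =>
    ((hB' c hc).neg.congr_of_eventuallyEq_of_mem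
      (by filter_upwards [hKn c hc] with x hx using e2 x hx) (hKI hc)).derivWithin (hud c (hKI hc))
  set n : ℝ → ℝ := fun c => A' c * B c - A c * B' c with hn
  -- the curvature is `n k` with a nowhere vanishing factor `k`
  set k : ℝ → ℝ := fun c => -(B c ^ 2 + A c ^ 2) ^ (-(3 / 2) : ℝ) with hk
  have hpos : ∀ c ∈ K, 0 < B c ^ 2 + A c ^ 2 := fun c hc => by have := hBpos c hc; positivity
  have hcurv : ∀ c ∈ K, curvature U c = n c * k c := by
    intro c hc
    rw [curvature, e1 c hc, e2 c hc, e3 c hc, e4 c hc, neg_sq, hn, hk]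
    simp only
    rw [Real.rpow_neg (hpos c hc).le]
    ring
  have hk0 : ∀ c ∈ K, k c ≠ 0 := fun c hc =>
    neg_ne_zero.2 (Real.rpow_pos_of_pos (hpos c hc) _).ne'
  have hnd : ∀ c ∈ K, HasDerivWithinAt n (derivWithin n I c) I c := fun c hc =>
    (((hA'' c hc).mul (hB' c hc).differentiableWithinAt).sub
      ((hA' c hc).differentiableWithinAt.mul (hB'' c hc))).hasDerivWithinAt
  have hkd : ∀ c ∈ K, DifferentiableWithinAt ℝ k I c := fun c hc =>
    ((((hB' c hc).differentiableWithinAt.pow 2).add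
      ((hA' c hc).differentiableWithinAt.pow 2)).rpow_const (Or.inl (hpos c hc).ne')).neg
  have hmem : ∀ c ∈ curvatureZeros U, c ∈ K ∧ n c = 0 := by
    rintro c ⟨hc, h0⟩
    rw [← hK] at hc
    rw [hcurv c hc] at h0
    exact ⟨hc, (mul_eq_zero.1 h0).resolve_right (hk0 c hc)⟩
  have hslope : ∀ c ∈ K, dF₂ U c / dF₁ U c = -(A c / B c) := fun c hc => by
    rw [e1 c hc, e2 c hc, div_neg]
  have hc₁ : c₁ U ∈ K := by rw [hK]; exact Or.inr ⟨h21, le_rfl⟩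
  have hc₄ : c₄ U ∈ K := by rw [hK]; exact Or.inl ⟨le_rfl, h43⟩
  refine ⟨hU, ?_, fun c hc => ?_, fun c hc => ?_, ?_, ?_, hr₂, hr₃⟩
  · refine (finite_zeros_of_simple hK₀
      (fun c hc => (hnd c (hK₀K hc)).mono (hK₀K.trans hKI))
      fun c hc h0 => (hsimple c (hK₀K hc) h0).1).subset fun c hc => ?_
    obtain ⟨h1, h2⟩ := hmem c hc
    exact ⟨hzero c h1 h2, h2⟩
  · obtain ⟨h1, h2⟩ := hmem c hc
    have h3 : HasDerivWithinAt (curvature U) _ I c :=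
      ((hnd c h1).mul (hkd c h1).hasDerivWithinAt).congr_of_eventuallyEq_of_mem
        (by filter_upwards [hKn c h1] with x hx using hcurv x hx) (hKI h1)
    rw [h3.derivWithin (hud c (hKI h1)), h2, zero_mul, add_zero]
    exact mul_ne_zero (hsimple c h1 h2).1 (hk0 c h1)
  · obtain ⟨h1, h2⟩ := hmem c hc
    rw [hslope c h1]
    exact (hsimple c h1 h2).2
  · rwa [hslope _ hc₁]
  · rwa [hslope _ hc₄]

/-- The derivative of the action of a function whose minimum is `a` and maximum `a + 2 β`. -/
noncomputable def slope₁ (Θ : ℝ → ℝ) (β a c : ℝ) : ℝ :=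
  √(2 * β) / (2 * β) * pendulum₁ Θ ((c - a) / (2 * β))

/-- The second derivative of the action of a function whose minimum is `a` and maximum
`a + 2 β`. -/
noncomputable def slope₂ (Θ : ℝ → ℝ) (β a c : ℝ) : ℝ :=
  √(2 * β) / (2 * β) ^ 2 * pendulum₂ Θ ((c - a) / (2 * β))

section Slope

variable {Θ : ℝ → ℝ} {β a : ℝ}

theorem scaled_ne_one (hβ : 0 < β) {c : ℝ} (hc : c ≠ a + 2 * β) : (c - a) / (2 * β) ≠ 1 := by
  rw [Ne, div_eq_one_iff_eq (by positivity)]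
  intro h
  exact hc (by linarith)

theorem hasDerivAt_scaled (β a c : ℝ) :
    HasDerivAt (fun c => (c - a) / (2 * β)) (1 / (2 * β)) c :=
  ((hasDerivAt_id c).sub_const a).div_const _

theorem hasDerivWithinAt_scaledAction (hΘ : ContDiff ℝ 2 Θ) (hβ : 0 < β) {c : ℝ} (hac : a ≤ c)
    (hc : c ≠ a + 2 * β) :
    HasDerivWithinAt (fun c => √(2 * β) * pendulumAction Θ ((c - a) / (2 * β)))
      (slope₁ Θ β a c) (Ici a) c := by
  have h1 := hasDerivWithinAt_pendulumAction hΘ (z := (c - a) / (2 * β))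
    (div_nonneg (by linarith) (by positivity)) (scaled_ne_one hβ hc)
  have h2 := (h1.comp c (hasDerivAt_scaled β a c).hasDerivWithinAt (s := Ici a)
    fun x hx => div_nonneg (sub_nonneg.2 hx) (by positivity)).const_mul √(2 * β)
  refine h2.congr_deriv ?_
  rw [slope₁]
  ring

theorem hasDerivAt_slope₁ (hΘ : ContDiff ℝ 2 Θ) (hβ : 0 < β) {c : ℝ} (hc : c ≠ a + 2 * β) :
    HasDerivAt (slope₁ Θ β a) (slope₂ Θ β a c) c := by
  have h1 := hasDerivAt_pendulum₁ hΘ (scaled_ne_one hβ hc)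
  have h2 := (h1.comp c (hasDerivAt_scaled β a c)).const_mul (√(2 * β) / (2 * β))
  refine h2.congr_deriv ?_
  rw [slope₂]
  ring

theorem differentiableAt_slope₂ (hΘ : ContDiff ℝ 2 Θ) (hβ : 0 < β) {c : ℝ} (hc : c ≠ a + 2 * β) :
    DifferentiableAt ℝ (slope₂ Θ β a) c := by
  have h1 := (differentiableAt_pendulum₂ hΘ (scaled_ne_one hβ hc)).hasDerivAt
  exact ((h1.comp c (hasDerivAt_scaled β a c)).const_mul (√(2 * β) / (2 * β) ^ 2)).differentiableAt

theorem scaled_lt_one (hβ : 0 < β) {c : ℝ} (hc : c < a + 2 * β) : (c - a) / (2 * β) < 1 := by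
  rw [div_lt_one (by positivity)]; linarith

theorem one_lt_scaled (hβ : 0 < β) {c : ℝ} (hc : a + 2 * β < c) : 1 < (c - a) / (2 * β) := by
  rw [one_lt_div (by positivity)]; linarith

theorem slope₁_pos (hΘ : ContDiff ℝ 2 Θ) (h0 : ∀ x ∈ Icc (0 : ℝ) 1, 0 < Θ x) (hβ : 0 < β) {c : ℝ}
    (hac : a ≤ c) (hc : c ≠ a + 2 * β) : 0 < slope₁ Θ β a c := by
  refine mul_pos (by positivity) ?_
  rcases lt_or_gt_of_ne hc with h | h
  · have h1 := scaled_lt_one hβ h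
    rw [pendulum₁_of_lt h1]
    exact libration₁_pos hΘ (div_nonneg (by linarith) (by positivity)) h1
      fun x hx => h0 x ⟨hx.1, hx.2.trans h1.le⟩
  · have h1 := one_lt_scaled hβ h
    rw [pendulum₁_of_gt h1]
    exact mul_pos (by norm_num) (rotation_pos hΘ.continuous h0 _ h1)

theorem slope₁_add_mul {E : ℝ → ℝ} (hΘ : ContDiff ℝ 2 Θ) (hE : ContDiff ℝ 2 E) (hβ : 0 < β)
    (ε : ℝ) {c : ℝ} (hac : a ≤ c) (hc : c ≠ a + 2 * β) :
    slope₁ (fun x => Θ x + ε * E x) β a c = slope₁ Θ β a c + ε * slope₁ E β a c := by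
  rw [slope₁, pendulum₁_add_mul hΘ hE ε (div_nonneg (by linarith) (by positivity))
    (scaled_ne_one hβ hc), slope₁, slope₁]
  ring

theorem slope₂_add_mul {E : ℝ → ℝ} (hΘ : ContDiff ℝ 2 Θ) (hE : ContDiff ℝ 2 E) (hβ : 0 < β)
    (ε : ℝ) {c : ℝ} (hac : a ≤ c) (hc : c ≠ a + 2 * β) :
    slope₂ (fun x => Θ x + ε * E x) β a c = slope₂ Θ β a c + ε * slope₂ E β a c := by
  rw [slope₂, pendulum₂_add_mul hΘ hE ε (div_nonneg (by linarith) (by positivity))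
    (scaled_ne_one hβ hc), slope₂, slope₂]
  ring

/-- The singularity at the maximum, uniformly over bounded sets of densities. -/
theorem exists_slope_dominates (hβ : 0 < β) {m : ℝ} (hm : 0 < m) (M L : ℝ) :
    ∃ δ, 0 < δ ∧ δ < 2 * β ∧ ∀ Θ : ℝ → ℝ, ContDiff ℝ 2 Θ → (∀ x ∈ Icc (0 : ℝ) 1, m ≤ Θ x) →
      (∀ x ∈ Icc (0 : ℝ) 1, Θ x ≤ M) → (∀ x ∈ Icc (0 : ℝ) 1, |deriv Θ x| ≤ M) →
      ∀ a c, a + 2 * β - δ < c → c < a + 2 * β → L * slope₁ Θ β a c < slope₂ Θ β a c := by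
  obtain ⟨δ, h0, h1, h2⟩ := exists_libration_dominates hm M (L * (2 * β))
  refine ⟨2 * β * δ, by positivity, by nlinarith, fun Θ hΘ h3 h4 h5 a c h6 h7 => ?_⟩
  have h8 := scaled_lt_one hβ h7
  have h9 : 1 - δ < (c - a) / (2 * β) := by
    rw [lt_div_iff₀ (by positivity)]; linarith
  have h10 := h2 Θ hΘ h3 h4 h5 _ h9 h8
  rw [slope₁, slope₂, pendulum₁_of_lt h8, pendulum₂_of_lt h8]
  have h11 : 0 < √(2 * β) / (2 * β) ^ 2 := by positivity
  calc L * (√(2 * β) / (2 * β) * libration₁ Θ ((c - a) / (2 * β)))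
      = √(2 * β) / (2 * β) ^ 2 * (L * (2 * β) * libration₁ Θ ((c - a) / (2 * β))) := by
        field_simp
    _ < _ := mul_lt_mul_of_pos_left h10 h11

/-- The integrand on the left is smaller, as `z - 1 ≤ z - sin² (π y)`. -/
theorem rotation_le {Θ : ℝ → ℝ} (hΘ : Continuous Θ) (h0 : ∀ x ∈ Icc (0 : ℝ) 1, 0 ≤ Θ x) {z : ℝ}
    (hz : 1 < z) : (z - 1) * rotation Θ (-3 / 2) z ≤ rotation Θ (-1 / 2) z := by
  have hc : ∀ r : ℝ, ContinuousOn (fun y => (z - Real.sin (Real.pi * y) ^ 2) ^ r *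
      Θ (Real.sin (Real.pi * y) ^ 2)) (uIcc 0 1) := fun r => by
    rw [uIcc_of_le zero_le_one]
    exact (continuousOn_rotation_integrand hΘ r).comp (f := fun y => (z, y)) (by fun_prop)
      fun y hy => ⟨hz, hy⟩
  rw [rotation, rotation, ← intervalIntegral.integral_const_mul]
  refine intervalIntegral.integral_mono_on zero_le_one ((hc (-3 / 2)).intervalIntegrable.const_mul _)
    (hc (-1 / 2)).intervalIntegrable fun y _ => ?_
  have h1 := sub_sin_sq_pos hz (Real.pi * y)
  have h2 : (z - Real.sin (Real.pi * y) ^ 2) ^ (-1 / 2 : ℝ) =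
      (z - Real.sin (Real.pi * y) ^ 2) * (z - Real.sin (Real.pi * y) ^ 2) ^ (-3 / 2 : ℝ) := by
    rw [show (-3 / 2 : ℝ) = -1 / 2 - 1 by norm_num, Real.rpow_sub_one h1.ne']
    field_simp
  have h3 : 0 ≤ (z - Real.sin (Real.pi * y) ^ 2) ^ (-3 / 2 : ℝ) * Θ (Real.sin (Real.pi * y) ^ 2) :=
    mul_nonneg (Real.rpow_nonneg h1.le _) (h0 _ ⟨sq_nonneg _, Real.sin_sq_le_one _⟩)
  rw [h2, mul_assoc]
  exact mul_le_mul_of_nonneg_right (by linarith [Real.sin_sq_le_one (Real.pi * y)]) h3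

/-- Above the maximum, the logarithmic derivative of the derivative of the action is bounded below,
uniformly in the density. -/
theorem neg_slope₁_le (hΘ : Continuous Θ) (h0 : ∀ x ∈ Icc (0 : ℝ) 1, 0 ≤ Θ x) (hβ : 0 < β)
    {c : ℝ} (hc : a + 2 * β < c) : -slope₁ Θ β a c ≤ 2 * (c - (a + 2 * β)) * slope₂ Θ β a c := by
  have h1 := one_lt_scaled hβ hc
  have h2 := rotation_le hΘ h0 h1
  rw [slope₁, slope₂, pendulum₁_of_gt h1, pendulum₂_of_gt h1]
  set R := rotation Θ (-1 / 2) ((c - a) / (2 * β))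
  set R' := rotation Θ (-3 / 2) ((c - a) / (2 * β))
  have h3 : c - (a + 2 * β) = (2 * β) * ((c - a) / (2 * β) - 1) := by field_simp; ring
  rw [h3]
  have h4 : 0 ≤ √(2 * β) / (2 * β) := by positivity
  have h5 := mul_le_mul_of_nonneg_left h2 h4
  have h6 : 2 * (2 * β * ((c - a) / (2 * β) - 1)) * (√(2 * β) / (2 * β) ^ 2 * (-1 / 4 * R')) =
      -(1 / 2) * (√(2 * β) / (2 * β) * (((c - a) / (2 * β) - 1) * R')) := by
    generalize (c - a) / (2 * β) = z
    field_simp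
    ring
  rw [h6]
  linarith

end Slope

/-! ### The sign of the curvature -/

theorem exists_abs_le_mul {K : Set ℝ} (hK : IsCompact K) {f g : ℝ → ℝ} (hf : ContinuousOn f K)
    (hg : ContinuousOn g K) (h : ∀ c ∈ K, 0 < g c) :
    ∃ L, 0 ≤ L ∧ ∀ c ∈ K, |f c| ≤ L * g c := by
  obtain ⟨L, hL⟩ := hK.exists_bound_of_continuousOn (hf.div hg fun c hc => (h c hc).ne')
  refine ⟨max L 0, le_max_right _ _, fun c hc => ?_⟩
  have h1 := hL c hc
  rw [Real.norm_eq_abs, Pi.div_apply, abs_div, abs_of_pos (h c hc), div_le_iff₀ (h c hc)] at h1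
  exact h1.trans (mul_le_mul_of_nonneg_right (le_max_left _ _) (h c hc).le)

theorem volume_affine_preimage {N : Set ℝ} (hN : volume N = 0) (p : ℝ) {q : ℝ} (hq : q ≠ 0) :
    volume {ε | p + ε * q ∈ N} = 0 := by
  have h1 : volume ((fun x => p + x) ⁻¹' N) = 0 := by rw [measure_preimage_add, hN]
  have h2 := Real.volume_preimage_mul_right hq ((fun x => p + x) ⁻¹' N)
  rw [h1, mul_zero] at h2
  exact h2

theorem ae_isTypical_affine (p : ℝ) {q : ℝ} (hq : q ≠ 0) : ∀ᵐ ε : ℝ, IsTypical (p + ε * q) :=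
  volume_affine_preimage volume_not_isTypical p hq

theorem pendulumAction_pos {Θ : ℝ → ℝ} (hΘ : Continuous Θ) (h : ∀ x ∈ Icc (0 : ℝ) 1, 0 < Θ x)
    {z : ℝ} (hz : 0 < z) : 0 < pendulumAction Θ z := by
  rw [pendulumAction]
  refine intervalIntegral.integral_pos zero_lt_one (by fun_prop) (fun y _ => ?_)
    ⟨0, ⟨le_rfl, zero_le_one⟩, ?_⟩
  · exact mul_nonneg (Real.sqrt_nonneg _) (h _ ⟨sq_nonneg _, Real.sin_sq_le_one _⟩).le
  · have := h 0 ⟨le_rfl, zero_le_one⟩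
    simp only [mul_zero, Real.sin_zero, ne_eq, OfNat.ofNat_ne_zero, not_false_eq_true, zero_pow,
      sub_zero]
    exact mul_pos (Real.sqrt_pos.2 hz) this

theorem hasDerivAt_slope₁_neg {Θ : ℝ → ℝ} {β b c : ℝ} (hΘ : ContDiff ℝ 2 Θ) (hβ : 0 < β)
    (hc : c ≠ -(b + 2 * β)) :
    HasDerivAt (fun c => slope₁ Θ β b (-c)) (-slope₂ Θ β b (-c)) c := by
  have h1 : -c ≠ b + 2 * β := fun h => hc (by rw [← h, neg_neg])
  exact ((hasDerivAt_slope₁ hΘ hβ h1).comp c (hasDerivAt_neg c)).congr_deriv (by ring)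

theorem differentiableAt_slope₂_neg {Θ : ℝ → ℝ} {β b c : ℝ} (hΘ : ContDiff ℝ 2 Θ) (hβ : 0 < β)
    (hc : c ≠ -(b + 2 * β)) : DifferentiableAt ℝ (fun c => slope₂ Θ β b (-c)) c := by
  have h1 : -c ≠ b + 2 * β := fun h => hc (by rw [← h, neg_neg])
  exact (differentiableAt_slope₂ hΘ hβ h1).comp c differentiableAt_id.neg

/-- The expression `F₁'' F₂' - F₂'' F₁'`, which is the negative of the numerator of the curvature, for
the densities `Θ` of `U₂` and `Θ₁` of `-U₁`. The minima of `U₂` and `-U₁` are `a` and `b`. -/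
noncomputable def wronskian (Θ Θ₁ : ℝ → ℝ) (β β₁ a b c : ℝ) : ℝ :=
  slope₂ Θ β a c * slope₁ Θ₁ β₁ b (-c) + slope₁ Θ β a c * slope₂ Θ₁ β₁ b (-c)

section Wronskian

variable {Θ₁ : ℝ → ℝ} {β β₁ a b : ℝ}

theorem differentiableAt_wronskian {Θ : ℝ → ℝ} (hΘ : ContDiff ℝ 2 Θ) (hΘ₁ : ContDiff ℝ 2 Θ₁)
    (hβ : 0 < β) (hβ₁ : 0 < β₁) {c : ℝ} (h3 : c ≠ a + 2 * β) (h2 : c ≠ -(b + 2 * β₁)) :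
    DifferentiableAt ℝ (wronskian Θ Θ₁ β β₁ a b) c :=
  ((differentiableAt_slope₂ hΘ hβ h3).mul (hasDerivAt_slope₁_neg hΘ₁ hβ₁ h2).differentiableAt).add
    ((hasDerivAt_slope₁ hΘ hβ h3).differentiableAt.mul (differentiableAt_slope₂_neg hΘ₁ hβ₁ h2))

theorem hasDerivAt_slope_quotient {Θ : ℝ → ℝ} (hΘ : ContDiff ℝ 2 Θ) (hΘ₁ : ContDiff ℝ 2 Θ₁)
    (hβ : 0 < β) (hβ₁ : 0 < β₁) {c : ℝ} (h3 : c ≠ a + 2 * β) (h2 : c ≠ -(b + 2 * β₁))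
    (h0 : slope₁ Θ₁ β₁ b (-c) ≠ 0) :
    HasDerivAt (fun c => slope₁ Θ β a c / slope₁ Θ₁ β₁ b (-c))
      (wronskian Θ Θ₁ β β₁ a b c / slope₁ Θ₁ β₁ b (-c) ^ 2) c :=
  ((hasDerivAt_slope₁ hΘ hβ h3).div (hasDerivAt_slope₁_neg hΘ₁ hβ₁ h2) h0).congr_deriv (by
    rw [wronskian]; ring)

theorem slope₁_neg_pos (hΘ₁ : ContDiff ℝ 2 Θ₁) (hp : ∀ x ∈ Icc (0 : ℝ) 1, 0 < Θ₁ x) (hβ₁ : 0 < β₁)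
    {c : ℝ} (h1 : c ≤ -b) (h2 : c ≠ -(b + 2 * β₁)) : 0 < slope₁ Θ₁ β₁ b (-c) :=
  slope₁_pos hΘ₁ hp hβ₁ (by linarith) fun h => h2 (by rw [← h, neg_neg])

/-- The logarithmic derivative of `F₁'` is bounded on compact sets of noncritical energies. -/
theorem exists_slope_bound (hΘ₁ : ContDiff ℝ 2 Θ₁) (hp : ∀ x ∈ Icc (0 : ℝ) 1, 0 < Θ₁ x)
    (hβ₁ : 0 < β₁) {K : Set ℝ} (hK : IsCompact K) (h1 : ∀ c ∈ K, c ≤ -b)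
    (h2 : ∀ c ∈ K, c ≠ -(b + 2 * β₁)) :
    ∃ L, 0 ≤ L ∧ ∀ c ∈ K, |slope₂ Θ₁ β₁ b (-c)| ≤ L * slope₁ Θ₁ β₁ b (-c) :=
  exists_abs_le_mul hK
    (fun c hc => (differentiableAt_slope₂_neg hΘ₁ hβ₁ (h2 c hc)).continuousAt.continuousWithinAt)
    (fun c hc => (hasDerivAt_slope₁_neg hΘ₁ hβ₁ (h2 c hc)).continuousAt.continuousWithinAt)
    fun c hc => slope₁_neg_pos hΘ₁ hp hβ₁ (h1 c hc) (h2 c hc)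

/-- The curvature does not vanish just below `c₃ = a + 2 β`, uniformly in the density of `U₂`: there
`F₂'' / F₂'` is large while `F₁'' / F₁'` is bounded. -/
theorem exists_wronskian_pos_below (hβ : 0 < β) (hΘ₁ : ContDiff ℝ 2 Θ₁)
    (hp : ∀ x ∈ Icc (0 : ℝ) 1, 0 < Θ₁ x) (hβ₁ : 0 < β₁) (hab : a + 2 * β < -(b + 2 * β₁)) {L : ℝ}
    (hL : ∀ c ∈ Icc a (a + 2 * β), |slope₂ Θ₁ β₁ b (-c)| ≤ L * slope₁ Θ₁ β₁ b (-c))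
    {m : ℝ} (hm : 0 < m) (M : ℝ) :
    ∃ δ, 0 < δ ∧ δ < 2 * β ∧ ∀ Θ : ℝ → ℝ, ContDiff ℝ 2 Θ → (∀ x ∈ Icc (0 : ℝ) 1, m ≤ Θ x) →
      (∀ x ∈ Icc (0 : ℝ) 1, Θ x ≤ M) → (∀ x ∈ Icc (0 : ℝ) 1, |deriv Θ x| ≤ M) →
      ∀ c, a + 2 * β - δ < c → c < a + 2 * β → 0 < wronskian Θ Θ₁ β β₁ a b c := by
  obtain ⟨δ, h0, h1, h2⟩ := exists_slope_dominates hβ hm M L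
  refine ⟨δ, h0, h1, fun Θ hΘ h3 h4 h5 c h6 h7 => ?_⟩
  have h8 := h2 Θ hΘ h3 h4 h5 a c h6 h7
  have hA := slope₁_pos hΘ (fun x hx => hm.trans_le (h3 x hx)) hβ (a := a) (by linarith : a ≤ c)
    h7.ne
  have hB := slope₁_neg_pos hΘ₁ hp hβ₁ (b := b) (c := c) (by linarith) (by linarith)
  have h9 := (abs_le.1 (hL c ⟨by linarith, h7.le⟩)).1
  rw [wronskian]
  have h10 := mul_lt_mul_of_pos_right h8 hB
  have h11 := mul_le_mul_of_nonneg_left h9 hA.le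
  linarith

/-- The curvature does not vanish just above `c₂ = -(b + 2 β₁)`, uniformly in the density of `U₂`:
there `-F₁'' / F₁'` is large and positive while `F₂'' / F₂'` is bounded below. -/
theorem exists_wronskian_pos_above (hβ : 0 < β) (hΘ₁ : ContDiff ℝ 2 Θ₁)
    (hp : ∀ x ∈ Icc (0 : ℝ) 1, 0 < Θ₁ x) (hβ₁ : 0 < β₁) (hab : a + 2 * β < -(b + 2 * β₁)) :
    ∃ δ, 0 < δ ∧ δ < 2 * β₁ ∧ ∀ Θ : ℝ → ℝ, ContDiff ℝ 2 Θ → (∀ x ∈ Icc (0 : ℝ) 1, 0 < Θ x) →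
      ∀ c, -(b + 2 * β₁) < c → c < -(b + 2 * β₁) + δ → 0 < wronskian Θ Θ₁ β β₁ a b c := by
  obtain ⟨m, hm, hm'⟩ : ∃ m, 0 < m ∧ ∀ x ∈ Icc (0 : ℝ) 1, m ≤ Θ₁ x := by
    obtain ⟨x, hx, hmin⟩ := isCompact_Icc.exists_isMinOn (nonempty_Icc.2 (zero_le_one (α := ℝ)))
      hΘ₁.continuous.continuousOn
    exact ⟨Θ₁ x, hp x hx, fun y hy => hmin hy⟩
  obtain ⟨M₁, hM₁⟩ := isCompact_Icc.exists_bound_of_continuousOn (s := Icc (0 : ℝ) 1)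
    hΘ₁.continuous.continuousOn
  obtain ⟨M₂, hM₂⟩ := isCompact_Icc.exists_bound_of_continuousOn (s := Icc (0 : ℝ) 1)
    (hΘ₁.continuous_deriv (by norm_num)).continuousOn
  set d := -(b + 2 * β₁) - (a + 2 * β) with hd
  have hd0 : 0 < d := by rw [hd]; linarith
  obtain ⟨δ, h0, h1, h2⟩ := exists_slope_dominates hβ₁ hm (max M₁ M₂) (1 / (2 * d))
  refine ⟨δ, h0, h1, fun Θ hΘ h3 c h6 h7 => ?_⟩
  have h8 := h2 Θ₁ hΘ₁ hm' (fun x hx => (le_abs_self _).trans ((hM₁ x hx).trans (le_max_left _ _)))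
    (fun x hx => (hM₂ x hx).trans (le_max_right _ _)) b (-c) (by linarith) (by linarith)
  have hA := slope₁_pos hΘ h3 hβ (a := a) (by linarith : a ≤ c) (by linarith)
  have hB := slope₁_neg_pos hΘ₁ hp hβ₁ (b := b) (c := c) (by linarith) h6.ne'
  have h9 := neg_slope₁_le hΘ.continuous (fun x hx => (h3 x hx).le) hβ
    (by linarith : a + 2 * β < c)
  have h10 : -(1 / (2 * d) * slope₁ Θ β a c) ≤ slope₂ Θ β a c := by
    rcases le_or_gt 0 (slope₂ Θ β a c) with h | h
    · exact le_trans (neg_nonpos.2 (by positivity)) h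
    · have h11 : 2 * (c - (a + 2 * β)) * slope₂ Θ β a c ≤ 2 * d * slope₂ Θ β a c :=
        mul_le_mul_of_nonpos_right (by rw [hd]; linarith) h.le
      rw [neg_le, one_div, inv_mul_eq_div, le_div_iff₀ (by positivity)]
      linarith
  rw [wronskian]
  have h11 := mul_le_mul_of_nonneg_right h10 hB.le
  have h12 := mul_lt_mul_of_pos_left h8 hA
  linarith

/-- A perturbation that is `(1 + x) ^ n` on a long initial interval moves the curvature on the
corresponding energies below `c₃`. -/
theorem wronskian_pos_of_pow {E : ℝ → ℝ} (hE : ContDiff ℝ 2 E) (hβ : 0 < β)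
    (hΘ₁ : ContDiff ℝ 2 Θ₁) (hp : ∀ x ∈ Icc (0 : ℝ) 1, 0 < Θ₁ x) (hβ₁ : 0 < β₁)
    (hab : a + 2 * β < -(b + 2 * β₁)) {L : ℝ}
    (hL : ∀ c ∈ Icc a (a + 2 * β), |slope₂ Θ₁ β₁ b (-c)| ≤ L * slope₁ Θ₁ β₁ b (-c))
    {n : ℕ} (hn : L < n / 4 / (2 * β)) {x₁ : ℝ} (hx₁ : x₁ ≤ 1) (hE₁ : ∀ x < x₁, E x = (1 + x) ^ n)
    {c : ℝ} (h0 : a ≤ c) (hc : (c - a) / (2 * β) < x₁) : 0 < wronskian E Θ₁ β β₁ a b c := by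
  have hz1 := hc.trans_le hx₁
  have hz0 : 0 ≤ (c - a) / (2 * β) := div_nonneg (by linarith) (by positivity)
  have hc3 : c < a + 2 * β := by
    rw [div_lt_one (by positivity)] at hz1; linarith
  have h1 := libration_growth hE hx₁ hE₁ hz0 hc
  have h2 : 0 < libration₁ E ((c - a) / (2 * β)) := libration₁_pos hE hz0 hz1 fun x hx => by
    rw [hE₁ x (hx.2.trans_lt hc)]
    have := hx.1
    positivity
  have hA : 0 < slope₁ E β a c := by
    rw [slope₁, pendulum₁_of_lt hz1]; positivity
  have hA' : n / 4 / (2 * β) * slope₁ E β a c ≤ slope₂ E β a c := by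
    rw [slope₁, slope₂, pendulum₁_of_lt hz1, pendulum₂_of_lt hz1]
    calc _ = √(2 * β) / (2 * β) ^ 2 * (n / 4 * libration₁ E ((c - a) / (2 * β))) := by
          field_simp
      _ ≤ _ := mul_le_mul_of_nonneg_left h1 (by positivity)
  have hB := slope₁_neg_pos hΘ₁ hp hβ₁ (b := b) (c := c) (by linarith) (by linarith)
  have h9 := (abs_le.1 (hL c ⟨h0, hc3.le⟩)).1
  rw [wronskian]
  have h10 := mul_le_mul_of_nonneg_right hA' hB.le
  have h11 := mul_le_mul_of_nonneg_left h9 hA.le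
  have h12 := mul_lt_mul_of_pos_right hn (mul_pos hA hB)
  linarith

/-- A perturbation with a large logarithmic derivative moves the curvature. -/
theorem wronskian_ne_zero_of_abs {E : ℝ → ℝ} (hβ : 0 < β) {L c : ℝ}
    (hB : 0 < slope₁ Θ₁ β₁ b (-c)) (hL : |slope₂ Θ₁ β₁ b (-c)| ≤ L * slope₁ Θ₁ β₁ b (-c))
    (hE : L * (2 * β) * |pendulum₁ E ((c - a) / (2 * β))| < |pendulum₂ E ((c - a) / (2 * β))|) :
    wronskian E Θ₁ β β₁ a b c ≠ 0 := by
  have h1 : L * |slope₁ E β a c| < |slope₂ E β a c| := by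
    rw [slope₁, slope₂, abs_mul, abs_mul, abs_of_pos (a := √(2 * β) / (2 * β)) (by positivity),
      abs_of_pos (a := √(2 * β) / (2 * β) ^ 2) (by positivity)]
    calc _ = √(2 * β) / (2 * β) ^ 2 * (L * (2 * β) * |pendulum₁ E ((c - a) / (2 * β))|) := by
          field_simp
      _ < _ := mul_lt_mul_of_pos_left hE (by positivity)
  intro h
  rw [wronskian] at h
  have h2 : |slope₂ E β a c| * slope₁ Θ₁ β₁ b (-c) = |slope₁ E β a c| * |slope₂ Θ₁ β₁ b (-c)| := by
    rw [← abs_of_pos hB, ← abs_mul, ← abs_mul, eq_neg_of_add_eq_zero_left h, abs_neg]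
  have h3 := mul_lt_mul_of_pos_right h1 hB
  have h4 := mul_le_mul_of_nonneg_left hL (abs_nonneg (slope₁ E β a c))
  linarith

theorem wronskian_add_mul {Θ E : ℝ → ℝ} (hΘ : ContDiff ℝ 2 Θ) (hE : ContDiff ℝ 2 E) (hβ : 0 < β)
    (ε : ℝ) {c : ℝ} (hac : a ≤ c) (hc : c ≠ a + 2 * β) :
    wronskian (fun x => Θ x + ε * E x) Θ₁ β β₁ a b c =
      wronskian Θ Θ₁ β β₁ a b c + ε * wronskian E Θ₁ β β₁ a b c := by
  rw [wronskian, slope₁_add_mul hΘ hE hβ ε hac hc, slope₂_add_mul hΘ hE hβ ε hac hc, wronskian,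
    wronskian]
  ring

/-- If the perturbation `E` moves the curvature at every point of `K`, then for almost every size
of the perturbation the zeros of the curvature on `K` are simple and have typical slopes. -/
theorem ae_wronskian_zeros {Θ E : ℝ → ℝ} (hΘ : ContDiff ℝ 2 Θ) (hE : ContDiff ℝ 2 E)
    (hΘ₁ : ContDiff ℝ 2 Θ₁) (hβ : 0 < β) (hβ₁ : 0 < β₁) {K : Set ℝ}
    (h3 : ∀ c ∈ K, c ≠ a + 2 * β) (h2 : ∀ c ∈ K, c ≠ -(b + 2 * β₁))
    (hB : ∀ c ∈ K, 0 < slope₁ Θ₁ β₁ b (-c)) (hw : ∀ c ∈ K, wronskian E Θ₁ β β₁ a b c ≠ 0) :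
    ∀ᵐ ε : ℝ, ∀ c ∈ K, wronskian Θ Θ₁ β β₁ a b c + ε * wronskian E Θ₁ β β₁ a b c = 0 →
      deriv (fun c => wronskian Θ Θ₁ β β₁ a b c + ε * wronskian E Θ₁ β β₁ a b c) c ≠ 0 ∧
      IsTypical (-((slope₁ Θ β a c + ε * slope₁ E β a c) / slope₁ Θ₁ β₁ b (-c))) := by
  set B : ℝ → ℝ := fun c => slope₁ Θ₁ β₁ b (-c) with hBdef
  have hBd : ∀ c ∈ K, DifferentiableAt ℝ B c := fun c hc =>
    (hasDerivAt_slope₁_neg hΘ₁ hβ₁ (h2 c hc)).differentiableAt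
  have hN : volume {x : ℝ | ¬IsTypical (-x)} = 0 := by
    have := volume_affine_preimage volume_not_isTypical 0 (q := -1) (by norm_num)
    simpa using this
  have hquot : ∀ {Θ : ℝ → ℝ}, ContDiff ℝ 2 Θ → ∀ c ∈ K,
      DifferentiableAt ℝ (fun c => wronskian Θ Θ₁ β β₁ a b c / B c ^ 2) c := fun hΘ c hc =>
    (differentiableAt_wronskian hΘ hΘ₁ hβ hβ₁ (h3 c hc) (h2 c hc)).div ((hBd c hc).pow 2)
      (pow_ne_zero 2 (hB c hc).ne')
  have key := volume_bad_pencil (K := K) hN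
    (fun c hc => (hasDerivAt_slope_quotient hΘ hΘ₁ hβ hβ₁ (h3 c hc) (h2 c hc)
      (hB c hc).ne').hasDerivWithinAt)
    (fun c hc => (hquot hΘ c hc).hasDerivAt.hasDerivWithinAt)
    (fun c hc => (hasDerivAt_slope_quotient hE hΘ₁ hβ hβ₁ (h3 c hc) (h2 c hc)
      (hB c hc).ne').hasDerivWithinAt)
    (fun c hc => (hquot hE c hc).hasDerivAt.hasDerivWithinAt)
    fun c hc => div_ne_zero (hw c hc) (pow_ne_zero 2 (hB c hc).ne')
  filter_upwards [compl_mem_ae_iff.2 key] with ε hε c hc h0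
  have hB0 := (hB c hc).ne'
  have h4 : wronskian Θ Θ₁ β β₁ a b c / B c ^ 2 + ε * (wronskian E Θ₁ β β₁ a b c / B c ^ 2) = 0 := by
    rw [mul_div_assoc', ← add_div, h0, zero_div]
  have h5 : ¬(_ ∨ _) := fun h => hε ⟨c, hc, h4, h⟩
  rw [not_or] at h5
  constructor
  · intro h6
    apply h5.1
    have hd : DifferentiableAt ℝ
        (fun c => wronskian Θ Θ₁ β β₁ a b c + ε * wronskian E Θ₁ β β₁ a b c) c :=
      (differentiableAt_wronskian hΘ hΘ₁ hβ hβ₁ (h3 c hc) (h2 c hc)).add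
        ((differentiableAt_wronskian hE hΘ₁ hβ hβ₁ (h3 c hc) (h2 c hc)).const_mul ε)
    have h7 := hd.hasDerivAt.div ((hBd c hc).hasDerivAt.pow 2) (pow_ne_zero 2 hB0)
    have h8 := (hquot hΘ c hc).hasDerivAt.add ((hquot hE c hc).hasDerivAt.const_mul ε)
    have h9 : (fun c => wronskian Θ Θ₁ β β₁ a b c / B c ^ 2) + (fun c =>
        ε * (wronskian E Θ₁ β β₁ a b c / B c ^ 2)) = (fun c => wronskian Θ Θ₁ β β₁ a b c +
        ε * wronskian E Θ₁ β β₁ a b c) / B ^ 2 := by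
      funext c
      simp only [Pi.add_apply, Pi.div_apply, Pi.pow_apply]
      ring
    rw [h9] at h8
    rw [h8.unique h7, h6, h0]
    simp
  · have h6 : IsTypical (-(slope₁ Θ β a c / B c + ε * (slope₁ E β a c / B c))) := not_not.1 h5.2
    rwa [mul_div_assoc', ← add_div] at h6

end Wronskian

/-! ### Generic perturbations -/

/-- The perturbation of the density of `U₂` from which the approximating family is made. For almost
every small `ε` the pair of densities `Θ₁`, `Θ + ε E` has the properties that define
nondegeneracy. -/
theorem exists_generic_perturbation {Θ Θ₁ : ℝ → ℝ} {β β₁ a b g₂ g₃ : ℝ} (hΘ : ContDiff ℝ 2 Θ)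
    (hΘ₁ : ContDiff ℝ 2 Θ₁) (hp : ∀ x ∈ Icc (0 : ℝ) 1, 0 < Θ x)
    (hp₁ : ∀ x ∈ Icc (0 : ℝ) 1, 0 < Θ₁ x) (hβ : 0 < β) (hβ₁ : 0 < β₁)
    (hab : a + 2 * β < -(b + 2 * β₁)) (hg₂ : g₂ ≠ 0) (hg₃ : g₃ ≠ 0) :
    ∃ E : ℝ → ℝ, ContDiff ℝ ∞ E ∧ ∫ y in (0 : ℝ)..1, E (Real.sin (Real.pi * y) ^ 2) = 0 ∧
      ∃ K₀, IsCompact K₀ ∧ K₀ ⊆ Ico a (a + 2 * β) ∪ Ioc (-(b + 2 * β₁)) (-b) ∧ ∃ r > 0,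
        ∀ᵐ ε : ℝ, |ε| < r →
          (∀ c ∈ Ico a (a + 2 * β) ∪ Ioc (-(b + 2 * β₁)) (-b),
            wronskian Θ Θ₁ β β₁ a b c + ε * wronskian E Θ₁ β β₁ a b c = 0 → c ∈ K₀ ∧
            deriv (fun c => wronskian Θ Θ₁ β β₁ a b c + ε * wronskian E Θ₁ β β₁ a b c) c ≠ 0 ∧
            IsTypical (-((slope₁ Θ β a c + ε * slope₁ E β a c) / slope₁ Θ₁ β₁ b (-c)))) ∧
          IsTypical (-((slope₁ Θ β a (-b) + ε * slope₁ E β a (-b)) / slope₁ Θ₁ β₁ b (- -b))) ∧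
          IsTypical (-((slope₁ Θ β a a + ε * slope₁ E β a a) / slope₁ Θ₁ β₁ b (-a))) ∧
          IsTypical (√(2 * β) * pendulumAction (fun x => Θ x + ε * E x)
            ((-(b + 2 * β₁) - a) / (2 * β)) / g₂) ∧
          IsTypical (√(2 * β) * pendulumAction (fun x => Θ x + ε * E x) 1 / g₃) := by
  obtain ⟨m, hm, hm'⟩ : ∃ m, 0 < m ∧ ∀ x ∈ Icc (0 : ℝ) 1, m ≤ Θ x := by
    obtain ⟨x, hx, hmin⟩ := isCompact_Icc.exists_isMinOn (nonempty_Icc.2 (zero_le_one (α := ℝ)))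
      hΘ.continuous.continuousOn
    exact ⟨Θ x, hp x hx, fun y hy => hmin hy⟩
  obtain ⟨M₁, hM₁⟩ := isCompact_Icc.exists_bound_of_continuousOn (s := Icc (0 : ℝ) 1)
    hΘ.continuous.continuousOn
  obtain ⟨M₂, hM₂⟩ := isCompact_Icc.exists_bound_of_continuousOn (s := Icc (0 : ℝ) 1)
    (hΘ.continuous_deriv (by norm_num)).continuousOn
  -- Intervals next to `c₃` and `c₂` on which no admissible density has curvature zeros.
  obtain ⟨L, -, hL⟩ := exists_slope_bound hΘ₁ hp₁ hβ₁ (b := b) (K := Icc a (a + 2 * β))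
    isCompact_Icc (fun c hc => by linarith [hc.2]) (fun c hc => by linarith [hc.2])
  obtain ⟨δ, hδ0, hδβ, hδ⟩ := exists_wronskian_pos_below hβ hΘ₁ hp₁ hβ₁ hab hL (half_pos hm)
    (max M₁ M₂ + 1)
  obtain ⟨δ', hδ0', hδβ', hδ'⟩ := exists_wronskian_pos_above (a := a) hβ hΘ₁ hp₁ hβ₁ hab
  -- The requirements on `E` on the remaining two compact intervals.
  obtain ⟨L', hL0', hL'⟩ := exists_slope_bound hΘ₁ hp₁ hβ₁ (b := b)
    (K := Icc (-(b + 2 * β₁) + δ') (-b)) isCompact_Icc (fun c hc => hc.2)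
    (fun c hc => by linarith [hc.1])
  obtain ⟨n, hn⟩ := exists_nat_gt (L * (8 * β))
  have hn' : L < n / 4 / (2 * β) := by
    rw [lt_div_iff₀ (by positivity), lt_div_iff₀ (by norm_num)]; linarith
  obtain ⟨E, hE, hmean, ⟨x₁, hx₀₁, hx₁, hEpow⟩, hdom, hzh, hz1, hzc⟩ := exists_perturbation
    (x₀ := (2 * β - δ) / (2 * β)) (div_nonneg (by linarith) (by positivity))
    (by rw [div_lt_one (by positivity)]; linarith) n (L := L' * (2 * β))
    (zl := (-(b + 2 * β₁) + δ' - a) / (2 * β)) (zh := (-b - a) / (2 * β))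
    (zc := (-(b + 2 * β₁) - a) / (2 * β)) (by positivity)
    (by rw [one_lt_div (by positivity)]; linarith) (by gcongr; linarith)
    (by rw [one_le_div (by positivity)]; linarith)
  have hE2 : ContDiff ℝ 2 E := by exact_mod_cast contDiff_infty.1 hE 2
  obtain ⟨N₁, hN₁⟩ := isCompact_Icc.exists_bound_of_continuousOn (s := Icc (0 : ℝ) 1)
    hE.continuous.continuousOn
  obtain ⟨N₂, hN₂⟩ := isCompact_Icc.exists_bound_of_continuousOn (s := Icc (0 : ℝ) 1)
    (hE2.continuous_deriv (by norm_num)).continuousOn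
  -- For `|ε| N < min (m / 2) 1`, the density `Θ + ε E` is admissible: it is at least `m / 2`, and it
  -- and its derivative are at most `max M₁ M₂ + 1`.
  set N := max (max N₁ N₂) 1 with hN
  have hN0 : 0 < N := zero_lt_one.trans_le (le_max_right _ _)
  set K₀ := Icc a (a + 2 * β - δ) ∪ Icc (-(b + 2 * β₁) + δ') (-b) with hK₀
  have hK₀K : K₀ ⊆ Ico a (a + 2 * β) ∪ Ioc (-(b + 2 * β₁)) (-b) :=
    union_subset_union (fun c hc => ⟨hc.1, by linarith [hc.2]⟩) fun c hc => ⟨by linarith [hc.1], hc.2⟩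
  have hK3 : ∀ c ∈ Ico a (a + 2 * β) ∪ Ioc (-(b + 2 * β₁)) (-b), c ≠ a + 2 * β := by
    rintro c (hc | hc)
    · exact hc.2.ne
    · linarith [hc.1]
  have hK2 : ∀ c ∈ Ico a (a + 2 * β) ∪ Ioc (-(b + 2 * β₁)) (-b), c ≠ -(b + 2 * β₁) := by
    rintro c (hc | hc)
    · linarith [hc.2]
    · exact hc.1.ne'
  have hKB : ∀ c ∈ Ico a (a + 2 * β) ∪ Ioc (-(b + 2 * β₁)) (-b), 0 < slope₁ Θ₁ β₁ b (-c) := by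
    intro c hc
    refine slope₁_neg_pos hΘ₁ hp₁ hβ₁ ?_ (hK2 c hc)
    rcases hc with hc | hc
    · linarith [hc.2]
    · exact hc.2
  have hKa : ∀ c ∈ Ico a (a + 2 * β) ∪ Ioc (-(b + 2 * β₁)) (-b), a ≤ c := by
    rintro c (hc | hc)
    · exact hc.1
    · linarith [hc.1]
  have haK : a ∈ Ico a (a + 2 * β) ∪ Ioc (-(b + 2 * β₁)) (-b) := Or.inl ⟨le_rfl, by linarith⟩
  have hbK : -b ∈ Ico a (a + 2 * β) ∪ Ioc (-(b + 2 * β₁)) (-b) := Or.inr ⟨by linarith, le_rfl⟩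
  have hw : ∀ c ∈ K₀, wronskian E Θ₁ β β₁ a b c ≠ 0 := by
    intro c hc
    have hcK := hK₀K hc
    rcases hc with hc | hc
    · refine (wronskian_pos_of_pow hE2 hβ hΘ₁ hp₁ hβ₁ hab hL hn' hx₁ hEpow hc.1 ?_).ne'
      refine lt_of_le_of_lt (div_le_div_of_nonneg_right ?_ (by positivity)) hx₀₁
      linarith [hc.2]
    · refine wronskian_ne_zero_of_abs hβ (hKB c hcK) (hL' c hc) (hdom _ ⟨?_, ?_⟩)
      · gcongr; exact hc.1
      · gcongr; exact hc.2
  have hs2β : √(2 * β) ≠ 0 := (Real.sqrt_pos.2 (by positivity)).ne'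
  have hslope_b : slope₁ E β a (-b) ≠ 0 := mul_ne_zero (by positivity) hzh
  have hslope_a : slope₁ E β a a ≠ 0 := by
    refine mul_ne_zero (by positivity) ?_
    have h0 : 0 < x₁ := lt_of_le_of_lt (div_nonneg (by linarith) (by positivity)) hx₀₁
    rw [sub_self, zero_div, pendulum₁_of_lt one_pos, libration₁_zero, hEpow 0 h0]
    norm_num
  refine ⟨E, hE, hmean, K₀, isCompact_Icc.union isCompact_Icc, hK₀K, min (m / 2) 1 / N,
    by positivity, ?_⟩
  filter_upwards [ae_wronskian_zeros hΘ hE2 hΘ₁ hβ hβ₁ (fun c hc => hK3 c (hK₀K hc))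
      (fun c hc => hK2 c (hK₀K hc)) (fun c hc => hKB c (hK₀K hc)) hw,
    ae_isTypical_affine (-(slope₁ Θ β a (-b) / slope₁ Θ₁ β₁ b (- -b)))
      (neg_ne_zero.2 (div_ne_zero hslope_b (hKB _ hbK).ne')),
    ae_isTypical_affine (-(slope₁ Θ β a a / slope₁ Θ₁ β₁ b (-a)))
      (neg_ne_zero.2 (div_ne_zero hslope_a (hKB _ haK).ne')),
    ae_isTypical_affine (√(2 * β) * pendulumAction Θ ((-(b + 2 * β₁) - a) / (2 * β)) / g₂)
      (div_ne_zero (mul_ne_zero hs2β hzc) hg₂),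
    ae_isTypical_affine (√(2 * β) * pendulumAction Θ 1 / g₃)
      (div_ne_zero (mul_ne_zero hs2β hz1) hg₃)] with ε h1 h2 h3 h4 h5 hε
  rw [lt_div_iff₀ hN0] at hε
  have hεE : ∀ x ∈ Icc (0 : ℝ) 1, |ε * E x| ≤ min (m / 2) 1 := fun x hx => by
    rw [abs_mul]
    refine (mul_le_mul_of_nonneg_left ?_ (abs_nonneg ε)).trans hε.le
    exact (hN₁ x hx).trans ((le_max_left _ _).trans (le_max_left _ _))
  have hεE' : ∀ x ∈ Icc (0 : ℝ) 1, |ε * deriv E x| ≤ 1 := fun x hx => by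
    rw [abs_mul]
    refine (mul_le_mul_of_nonneg_left ?_ (abs_nonneg ε)).trans (hε.le.trans (min_le_right _ _))
    exact (hN₂ x hx).trans ((le_max_right _ _).trans (le_max_left _ _))
  have hΘE : ContDiff ℝ 2 fun x => Θ x + ε * E x := hΘ.add (contDiff_const.mul hE2)
  have hlow : ∀ x ∈ Icc (0 : ℝ) 1, m / 2 ≤ Θ x + ε * E x := fun x hx => by
    have e1 := (abs_le.1 ((hεE x hx).trans (min_le_left _ _))).1
    linarith [hm' x hx]
  have hup : ∀ x ∈ Icc (0 : ℝ) 1, Θ x + ε * E x ≤ max M₁ M₂ + 1 := fun x hx =>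
    add_le_add ((le_abs_self _).trans ((hM₁ x hx).trans (le_max_left _ _)))
      ((le_abs_self _).trans ((hεE x hx).trans (min_le_right _ _)))
  have hder : ∀ x ∈ Icc (0 : ℝ) 1, |deriv (fun x => Θ x + ε * E x) x| ≤ max M₁ M₂ + 1 := by
    intro x hx
    have e1 := ((hΘ.differentiable (by norm_num)) x).hasDerivAt.add
      (((hE2.differentiable (by norm_num)) x).hasDerivAt.const_mul ε)
    have e2 : deriv (fun x => Θ x + ε * E x) x = deriv Θ x + ε * deriv E x := e1.deriv
    rw [e2]
    exact (abs_add_le _ _).trans (add_le_add ((hM₂ x hx).trans (le_max_right _ _)) (hεE' x hx))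
  refine ⟨fun c hc h0 => ?_, ?_, ?_, ?_, ?_⟩
  · have hcK₀ : c ∈ K₀ := by
      by_contra hcn
      rw [← wronskian_add_mul hΘ hE2 hβ ε (hKa c hc) (hK3 c hc)] at h0
      refine absurd h0 (ne_of_gt ?_)
      rcases hc with hc | hc
      · refine hδ _ hΘE hlow hup hder c ?_ hc.2
        by_contra h
        exact hcn (Or.inl ⟨hc.1, not_lt.1 h⟩)
      · refine hδ' _ hΘE (fun x hx => (half_pos hm).trans_le (hlow x hx)) c hc.1 ?_
        by_contra h
        exact hcn (Or.inr ⟨not_lt.1 h, hc.2⟩)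
    exact ⟨hcK₀, h1 c hcK₀ h0⟩
  · convert h2 using 1; ring
  · convert h3 using 1; ring
  · rw [pendulumAction_add_mul hΘ.continuous hE.continuous]
    convert h4 using 1; ring
  · rw [pendulumAction_add_mul hΘ.continuous hE.continuous]
    convert h5 using 1; ring

/-! ### Deformations of a pair -/

theorem CircleFun.ext_of {V W : CircleFun} (h : ∀ x, V x = W x) : V = W := by
  have h1 : V.toFun = W.toFun := funext h
  cases V
  cases W
  simpa using h1

/-- A periodic function of mean zero has a periodic primitive. -/
theorem exists_periodic_primitive {e : ℝ → ℝ} (he : ContDiff ℝ ∞ e) (hep : Function.Periodic e 1)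
    (hmean : ∫ y in (0 : ℝ)..1, e y = 0) :
    ∃ H : ℝ → ℝ, ContDiff ℝ ∞ H ∧ (∀ y, HasDerivAt H (e y) y) ∧ ∀ y, H (y + 1) = H y := by
  have hHd : ∀ y, HasDerivAt (fun y => ∫ s in (0 : ℝ)..y, e s) (e y) y := fun y =>
    intervalIntegral.integral_hasDerivAt_right (he.continuous.intervalIntegrable _ _)
      (he.continuous.stronglyMeasurableAtFilter _ _) he.continuous.continuousAt
  refine ⟨_, ?_, hHd, fun y => ?_⟩
  · rw [contDiff_infty_iff_deriv]
    refine ⟨fun y => (hHd y).differentiableAt, ?_⟩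
    rwa [show deriv (fun y => ∫ s in (0 : ℝ)..y, e s) = e from funext fun y => (hHd y).deriv]
  · have h1 := hep.intervalIntegral_add_eq y 0
    rw [zero_add, hmean] at h1
    have h2 := intervalIntegral.integral_add_adjacent_intervals (μ := volume) (a := 0) (b := y)
      (c := y + 1) (he.continuous.intervalIntegrable _ _) (he.continuous.intervalIntegrable _ _)
    rw [h1, add_zero] at h2
    exact h2.symm

/-- The deformations of `U` through functions with the same extrema, obtained by changing the
coordinate in its normal form. The sine makes the deformation parameter bounded. -/
theorem IsNormalForm.exists_family {U : CircleFun} {Φ : ℝ → ℝ} {α β : ℝ}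
    (h : IsNormalForm U Φ α β) {e : ℝ → ℝ} (he : ContDiff ℝ ∞ e) (hep : Function.Periodic e 1)
    (hmean : ∫ y in (0 : ℝ)..1, e y = 0) :
    ∃ r > 0, ∃ (G : ℝ → CircleFun) (Φ' : ℝ → ℝ → ℝ), Continuous G ∧ G 0 = U ∧
      (∀ t, IsNormalForm (G t) (Φ' t) α β) ∧
      ∀ t y, deriv (Φ' t) y = deriv Φ y + r * Real.sin t * e y := by
  obtain ⟨H, hHs, hHd, hHp⟩ := exists_periodic_primitive he hep hmean
  have hΦ'c : Continuous (deriv Φ) := h.diffeo.smooth.continuous_deriv (by simp)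
  have hdp : Function.Periodic (deriv Φ) 1 := fun y => by
    rw [← deriv_comp_add_const, funext h.diffeo.add_one, deriv_add_const]
  obtain ⟨m, hm, hm'⟩ : ∃ m, 0 < m ∧ ∀ y, m ≤ deriv Φ y := by
    obtain ⟨x, hx, hmin⟩ := isCompact_Icc.exists_isMinOn (nonempty_Icc.2 (zero_le_one (α := ℝ)))
      hΦ'c.continuousOn
    refine ⟨deriv Φ x, h.diffeo.deriv_pos x, fun y => ?_⟩
    obtain ⟨z, hz, hyz⟩ := hdp.exists_mem_Ico₀ one_pos y
    rw [hyz]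
    exact hmin (Ico_subset_Icc_self hz)
  obtain ⟨N, hN⟩ := isCompact_Icc.exists_bound_of_continuousOn (s := Icc (0 : ℝ) 1)
    he.continuous.continuousOn
  have hN' : ∀ y, |e y| ≤ max N 1 := fun y => by
    obtain ⟨z, hz, hyz⟩ := hep.exists_mem_Ico₀ one_pos y
    rw [hyz]
    exact (hN _ (Ico_subset_Icc_self hz)).trans (le_max_left _ _)
  have hN0 : 0 < max N 1 := zero_lt_one.trans_le (le_max_right _ _)
  set r := m / (2 * max N 1) with hr
  have hr0 : 0 < r := by positivity
  set F : ℝ → ℝ → ℝ := fun t y => Φ y + r * Real.sin t * H y with hF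
  have hFd : ∀ t y, HasDerivAt (F t) (deriv Φ y + r * Real.sin t * e y) y := fun t y =>
    ((h.diffeo.smooth.differentiable (by simp)) y).hasDerivAt.add ((hHd y).const_mul _)
  have hFs : ContDiff ℝ ∞ fun p : ℝ × ℝ => F p.1 p.2 :=
    (h.diffeo.smooth.comp contDiff_snd).add
      ((contDiff_const.mul (Real.contDiff_sin.comp contDiff_fst)).mul (hHs.comp contDiff_snd))
  have hFc : ∀ t, IsCircleDiffeo (F t) := by
    refine fun t => ⟨hFs.comp (contDiff_const.prodMk contDiff_id), fun y => ?_, fun y => ?_⟩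
    · simp only [hF, h.diffeo.add_one, hHp]; ring
    · rw [(hFd t y).deriv]
      have h1 : |r * Real.sin t * e y| ≤ m / 2 := by
        rw [abs_mul, abs_mul, abs_of_pos hr0]
        calc r * |Real.sin t| * |e y| ≤ r * 1 * max N 1 := by
              gcongr
              · exact Real.abs_sin_le_one t
              · exact hN' y
          _ = m / 2 := by rw [hr]; field_simp
      linarith [(abs_le.1 h1).1, hm' y]
  obtain ⟨Ψ, hΨ, hl, hR⟩ := exists_smooth_inverse_family (Φ := F) hFs hFc
  have hΨt : ∀ t, ContDiff ℝ ∞ (Ψ t) := fun t => hΨ.comp (contDiff_const.prodMk contDiff_id)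
  have hΨp : ∀ t x, Ψ t (x + 1) = Ψ t x + 1 := fun t x => by
    apply (hFc t).strictMono.injective
    rw [(hFc t).add_one, hR, hR]
  have hGs : ContDiff ℝ ∞ fun p : ℝ × ℝ => α - β * Real.cos (2 * Real.pi * Ψ p.1 p.2) :=
    contDiff_const.sub (contDiff_const.mul (Real.contDiff_cos.comp (contDiff_const.mul hΨ)))
  obtain ⟨G, hGeq⟩ : ∃ G : ℝ → CircleFun, ∀ t x,
      G t x = α - β * Real.cos (2 * Real.pi * Ψ t x) :=
    ⟨fun t => ⟨fun x => α - β * Real.cos (2 * Real.pi * Ψ t x),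
      contDiff_const.sub (contDiff_const.mul (Real.contDiff_cos.comp (contDiff_const.mul (hΨt t)))),
      fun x => by simp only [hΨp, mul_add, mul_one, Real.cos_add_two_pi]⟩, fun _ _ => rfl⟩
  refine ⟨r, hr0, G, F, continuous_of_contDiff_family G (by simpa only [hGeq] using hGs),
    CircleFun.ext_of fun x => ?_, fun t => ⟨hFc t, h.pos, fun y => by rw [hGeq, hl]⟩,
    fun t y => (hFd t y).deriv⟩
  have h2 := h.eq (Ψ 0 x)
  have h3 := hR 0 x
  simp only [hF, Real.sin_zero, mul_zero, zero_mul, add_zero] at h3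
  rw [h3] at h2
  rw [hGeq, h2]

section Density

variable {U : CircleFun × CircleFun} {Φ₁ Φ₂ Θ Θ₁ : ℝ → ℝ} {α₁ β₁ α₂ β₂ : ℝ}

theorem F₂_eq_pendulumAction (h : IsNormalForm U.2 Φ₂ α₂ β₂)
    (hΘ : ∀ y, Θ (Real.sin (Real.pi * y) ^ 2) = (deriv Φ₂ y + deriv Φ₂ (-y)) / 2) :
    F₂ U = fun c => √(2 * β₂) * pendulumAction Θ ((c - (α₂ - β₂)) / (2 * β₂)) := by
  rw [F₂_eq_action]
  exact funext (h.action_eq hΘ)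

theorem F₁_eq_pendulumAction (h : IsNormalForm U.1.neg Φ₁ α₁ β₁)
    (hΘ : ∀ y, Θ (Real.sin (Real.pi * y) ^ 2) = (deriv Φ₁ y + deriv Φ₁ (-y)) / 2) :
    F₁ U = fun c => √(2 * β₁) * pendulumAction Θ ((-c - (α₁ - β₁)) / (2 * β₁)) := by
  funext c
  rw [F₁_eq_action, h.action_eq hΘ]

theorem CircleFun.neg_neg_toFun (V : CircleFun) : V.neg.neg.toFun = V.toFun :=
  funext fun q => by simp

theorem c₁_eq (h : IsNormalForm U.1.neg Φ₁ α₁ β₁) : c₁ U = -(α₁ - β₁) := by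
  have := h.neg.maxVal_eq
  rw [CircleFun.neg_neg_toFun] at this
  rw [c₁, this]; ring

theorem c₂_eq (h : IsNormalForm U.1.neg Φ₁ α₁ β₁) : c₂ U = -(α₁ - β₁ + 2 * β₁) := by
  have := h.neg.minVal_eq
  rw [CircleFun.neg_neg_toFun] at this
  rw [c₂, this]; ring

theorem c₃_eq (h : IsNormalForm U.2 Φ₂ α₂ β₂) : c₃ U = α₂ - β₂ + 2 * β₂ := by
  rw [c₃, h.maxVal_eq]; ring

theorem c₄_eq (h : IsNormalForm U.2 Φ₂ α₂ β₂) : c₄ U = α₂ - β₂ := h.minVal_eq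

theorem IsNormalForm.mem_Omega (h₁ : IsNormalForm U.1.neg Φ₁ α₁ β₁)
    (h₂ : IsNormalForm U.2 Φ₂ α₂ β₂) (h : α₂ - β₂ + 2 * β₂ < -(α₁ - β₁ + 2 * β₁)) : U ∈ Omega := by
  refine ⟨?_, h₂.hasSimpleExtrema, fun q₁ q₂ => ?_⟩
  · have := h₁.neg.hasSimpleExtrema
    rwa [CircleFun.neg_neg_toFun] at this
  · have e1 := h₁.le_max q₁
    have e2 := h₂.le_max q₂
    rw [CircleFun.neg_apply] at e1
    linarith

theorem IsNormalForm.lt_of_mem_Omega (h₁ : IsNormalForm U.1.neg Φ₁ α₁ β₁)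
    (h₂ : IsNormalForm U.2 Φ₂ α₂ β₂) (h : U ∈ Omega) :
    α₂ - β₂ + 2 * β₂ < -(α₁ - β₁ + 2 * β₁) := by
  have e1 := h₁.eq (1 / 2)
  have e2 := h₂.eq (1 / 2)
  rw [show 2 * Real.pi * (1 / 2) = Real.pi by ring, Real.cos_pi] at e1 e2
  rw [CircleFun.neg_apply] at e1
  have := h.2.2 (Φ₁ (1 / 2)) (Φ₂ (1 / 2))
  linarith

/-- Every point of `[0, 1]` is of the form `sin² (π y)`. -/
theorem density_pos {Φ : ℝ → ℝ} (h : IsCircleDiffeo Φ)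
    (hΘ : ∀ y, Θ (Real.sin (Real.pi * y) ^ 2) = (deriv Φ y + deriv Φ (-y)) / 2) :
    ∀ x ∈ Icc (0 : ℝ) 1, 0 < Θ x := by
  intro x hx
  have h1 := hΘ (Real.arcsin √x / Real.pi)
  rw [mul_div_cancel₀ _ Real.pi_ne_zero, Real.sin_arcsin (by linarith [Real.sqrt_nonneg x])
    (Real.sqrt_le_one.2 hx.2), Real.sq_sqrt hx.1] at h1
  rw [h1]
  linarith [h.deriv_pos (Real.arcsin √x / Real.pi), h.deriv_pos (-(Real.arcsin √x / Real.pi))]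

end Density

/-! ### Nondegenerate pairs near a given one -/

/-- Nondegeneracy in terms of the densities `Θ₁` of `-U₁` and `Θ + ε E` of `U₂`. -/
theorem isNondegenerate_of_densities {U : CircleFun × CircleFun} {Φ₁ Φ₂ Θ E Θ₁ : ℝ → ℝ}
    {α₁ β₁ α₂ β₂ ε a b : ℝ} (h₁ : IsNormalForm U.1.neg Φ₁ α₁ β₁) (h₂ : IsNormalForm U.2 Φ₂ α₂ β₂)
    (ha : a = α₂ - β₂) (hb : b = α₁ - β₁) (hab : a + 2 * β₂ < -(b + 2 * β₁))
    (hΘ : ContDiff ℝ 2 Θ) (hE : ContDiff ℝ 2 E) (hΘ₁ : ContDiff ℝ 2 Θ₁)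
    (hd₁ : ∀ y, Θ₁ (Real.sin (Real.pi * y) ^ 2) = (deriv Φ₁ y + deriv Φ₁ (-y)) / 2)
    (hd₂ : ∀ y, Θ (Real.sin (Real.pi * y) ^ 2) + ε * E (Real.sin (Real.pi * y) ^ 2) =
      (deriv Φ₂ y + deriv Φ₂ (-y)) / 2)
    {K₀ : Set ℝ} (hK₀ : IsCompact K₀) (hK₀K : K₀ ⊆ Ico a (a + 2 * β₂) ∪ Ioc (-(b + 2 * β₁)) (-b))
    (hz : ∀ c ∈ Ico a (a + 2 * β₂) ∪ Ioc (-(b + 2 * β₁)) (-b),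
      wronskian Θ Θ₁ β₂ β₁ a b c + ε * wronskian E Θ₁ β₂ β₁ a b c = 0 → c ∈ K₀ ∧
      deriv (fun c => wronskian Θ Θ₁ β₂ β₁ a b c + ε * wronskian E Θ₁ β₂ β₁ a b c) c ≠ 0 ∧
      IsTypical (-((slope₁ Θ β₂ a c + ε * slope₁ E β₂ a c) / slope₁ Θ₁ β₁ b (-c))))
    (ht₁ : IsTypical (-((slope₁ Θ β₂ a (-b) + ε * slope₁ E β₂ a (-b)) / slope₁ Θ₁ β₁ b (- -b))))
    (ht₄ : IsTypical (-((slope₁ Θ β₂ a a + ε * slope₁ E β₂ a a) / slope₁ Θ₁ β₁ b (-a))))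
    (hr₂ : IsTypical (F₂ U (-(b + 2 * β₁)) / F₁ U (-(b + 2 * β₁))))
    (hr₃ : IsTypical (F₂ U (a + 2 * β₂) / F₁ U (a + 2 * β₂))) : IsNondegenerate U := by
  have hβ₁ := h₁.pos
  have hβ₂ := h₂.pos
  have e1 : c₁ U = -b := by rw [c₁_eq h₁, hb]
  have e2 : c₂ U = -(b + 2 * β₁) := by rw [c₂_eq h₁, hb]
  have e3 : c₃ U = a + 2 * β₂ := by rw [c₃_eq h₂, ha]
  have e4 : c₄ U = a := by rw [c₄_eq h₂, ha]
  have hΘE : ContDiff ℝ 2 fun x => Θ x + ε * E x := hΘ.add (contDiff_const.mul hE)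
  have hF₂ := F₂_eq_pendulumAction (Θ := fun x => Θ x + ε * E x) h₂ hd₂
  have hF₁ := F₁_eq_pendulumAction h₁ hd₁
  rw [← ha] at hF₂
  rw [← hb] at hF₁
  have hp₁ := density_pos h₁.diffeo hd₁
  set K := Ico a (a + 2 * β₂) ∪ Ioc (-(b + 2 * β₁)) (-b) with hK
  have hK3 : ∀ c ∈ K, c ≠ a + 2 * β₂ := by
    rintro c (hc | hc)
    · exact hc.2.ne
    · linarith [hc.1]
  have hK2 : ∀ c ∈ K, c ≠ -(b + 2 * β₁) := by
    rintro c (hc | hc)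
    · linarith [hc.2]
    · exact hc.1.ne'
  have hKI : ∀ c ∈ K, c ∈ Icc a (-b) := by
    rintro c (hc | hc)
    · exact ⟨hc.1, by linarith [hc.2]⟩
    · exact ⟨by linarith [hc.1], hc.2⟩
  have hud : UniqueDiffOn ℝ (Icc a (-b)) := uniqueDiffOn_Icc (by linarith)
  have hn : (fun c => (slope₂ Θ β₂ a c + ε * slope₂ E β₂ a c) * slope₁ Θ₁ β₁ b (-c) -
      (slope₁ Θ β₂ a c + ε * slope₁ E β₂ a c) * -slope₂ Θ₁ β₁ b (-c)) =
      fun c => wronskian Θ Θ₁ β₂ β₁ a b c + ε * wronskian E Θ₁ β₂ β₁ a b c := by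
    funext c
    rw [wronskian, wronskian]
    ring
  have hn' := fun c => congrFun hn c
  refine isNondegenerate_of (K := K) (K₀ := K₀) (h₁.mem_Omega h₂ (by rw [← ha, ← hb]; exact hab))
    (A := fun c => slope₁ Θ β₂ a c + ε * slope₁ E β₂ a c)
    (A' := fun c => slope₂ Θ β₂ a c + ε * slope₂ E β₂ a c)
    (B := fun c => slope₁ Θ₁ β₁ b (-c)) (B' := fun c => -slope₂ Θ₁ β₁ b (-c))
    (by rw [e1, e2, e3, e4]) (by rw [e3, e4]; linarith) (by rw [e2, e3]; exact hab)
    (by rw [e1, e2]; linarith) ?_ ?_ ?_ ?_ ?_ ?_ ?_ hK₀ hK₀K ?_ ?_ ?_ ?_ ?_ ?_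
  · intro c hc
    rw [e1, e4, hF₂, ← slope₁_add_mul hΘ hE hβ₂ ε (hKI c hc).1 (hK3 c hc)]
    exact (hasDerivWithinAt_scaledAction hΘE hβ₂ (hKI c hc).1 (hK3 c hc)).mono fun x hx => hx.1
  · intro c hc
    exact ((hasDerivAt_slope₁ hΘ hβ₂ (hK3 c hc)).add
      ((hasDerivAt_slope₁ hE hβ₂ (hK3 c hc)).const_mul ε)).hasDerivWithinAt
  · intro c hc
    exact ((differentiableAt_slope₂ hΘ hβ₂ (hK3 c hc)).add
      ((differentiableAt_slope₂ hE hβ₂ (hK3 c hc)).const_mul ε)).differentiableWithinAt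
  · intro c hc
    rw [e1, e4, hF₁]
    have h3 := hasDerivWithinAt_scaledAction hΘ₁ hβ₁ (a := b) (c := -c) (by linarith [(hKI c hc).2])
      fun h => hK2 c hc (by rw [← h, neg_neg])
    exact (h3.comp c (hasDerivAt_neg c).hasDerivWithinAt (s := Icc a (-b)) fun x hx =>
      mem_Ici.2 (by linarith [hx.2])).congr_deriv (by ring)
  · intro c hc
    exact (hasDerivAt_slope₁_neg hΘ₁ hβ₁ (hK2 c hc)).hasDerivWithinAt
  · intro c hc
    exact (differentiableAt_slope₂_neg hΘ₁ hβ₁ (hK2 c hc)).neg.differentiableWithinAt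
  · intro c hc
    exact slope₁_neg_pos hΘ₁ hp₁ hβ₁ (hKI c hc).2 (hK2 c hc)
  · intro c hc h0
    rw [hn'] at h0
    exact (hz c hc h0).1
  · intro c hc h0
    rw [hn'] at h0
    refine ⟨?_, (hz c hc h0).2.2⟩
    have h3 : DifferentiableAt ℝ
        (fun c => wronskian Θ Θ₁ β₂ β₁ a b c + ε * wronskian E Θ₁ β₂ β₁ a b c) c :=
      (differentiableAt_wronskian hΘ hΘ₁ hβ₂ hβ₁ (hK3 c hc) (hK2 c hc)).add
        ((differentiableAt_wronskian hE hΘ₁ hβ₂ hβ₁ (hK3 c hc) (hK2 c hc)).const_mul ε)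
    rw [e1, e4, hn, h3.derivWithin (hud c (hKI c hc))]
    exact (hz c hc h0).2.1
  · rw [e1]; exact ht₁
  · rw [e4]; exact ht₄
  · rw [e2]; exact hr₂
  · rw [e3]; exact hr₃

/-- Every pair in `Ω` lies on a continuous curve in `Ω` that passes through nondegenerate pairs
arbitrarily close to it. -/
theorem exists_nondegenerate_curve {U : CircleFun × CircleFun} (hU : U ∈ Omega) :
    ∃ G : ℝ → CircleFun, Continuous G ∧ G 0 = U.2 ∧ (∀ t, (U.1, G t) ∈ Omega) ∧
      ∃ᶠ t in 𝓝 0, IsNondegenerate (U.1, G t) := by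
  obtain ⟨Φ₁, α₁, β₁, h₁⟩ := hU.1.neg.exists_normalForm
  obtain ⟨Φ₂, α₂, β₂, h₂⟩ := hU.2.1.exists_normalForm
  have hβ₁ := h₁.pos
  have hβ₂ := h₂.pos
  have hlt := h₁.lt_of_mem_Omega h₂ hU
  obtain ⟨Θ₁, hΘ₁, hd₁⟩ := h₁.diffeo.exists_density
  obtain ⟨Θ, hΘ, hd⟩ := h₂.diffeo.exists_density
  have hp₁ := density_pos h₁.diffeo hd₁
  have hF₁ := F₁_eq_pendulumAction h₁ hd₁
  have hFpos : ∀ c, c < -(α₁ - β₁) → F₁ U c ≠ 0 := fun c hc => by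
    rw [hF₁]
    exact (mul_pos (Real.sqrt_pos.2 (by positivity)) (pendulumAction_pos hΘ₁.continuous hp₁
      (div_pos (by linarith) (by positivity)))).ne'
  obtain ⟨E, hE, hmean, K₀, hK₀, hK₀K, ρ, hρ, hae⟩ := exists_generic_perturbation hΘ hΘ₁
    (density_pos h₂.diffeo hd) hp₁ hβ₂ hβ₁ hlt
    (hFpos (-(α₁ - β₁ + 2 * β₁)) (by linarith)) (hFpos (α₂ - β₂ + 2 * β₂) (by linarith))
  have hE2 : ContDiff ℝ 2 E := by exact_mod_cast contDiff_infty.1 hE 2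
  obtain ⟨r, hr, G, Φ', hG, hG0, hGn, hGd⟩ := h₂.exists_family
    (e := fun y => E (Real.sin (Real.pi * y) ^ 2)) (hE.comp (by fun_prop))
    (fun y => by simp only [mul_add, mul_one, Real.sin_add_pi, neg_sq]) hmean
  refine ⟨G, hG, hG0, fun t => IsNormalForm.mem_Omega (U := (U.1, G t)) h₁ (hGn t) hlt, ?_⟩
  -- The sine in the deformation parameter is inverted by `t = arcsin (ε / r)`; a set of full measure
  -- of `ε` accumulates at zero.
  have hfreq := mem_closure_iff_frequently.1 (Measure.dense_of_ae hae 0)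
  have hcont : Tendsto (fun ε => Real.arcsin (ε / r)) (𝓝 0) (𝓝 0) := by
    have h3 : Continuous fun ε => Real.arcsin (ε / r) := Real.continuous_arcsin.comp (by fun_prop)
    simpa using h3.tendsto 0
  refine hcont.frequently ((hfreq.and_eventually
    (Metric.ball_mem_nhds (0 : ℝ) (lt_min hρ hr))).mono fun ε hε => ?_)
  obtain ⟨hε1, hε2⟩ := hε
  rw [Real.dist_0_eq_abs, lt_min_iff] at hε2
  obtain ⟨hz, ht₁, ht₄, hr₂, hr₃⟩ := hε1 hε2.1
  have hsin : r * Real.sin (Real.arcsin (ε / r)) = ε := by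
    have h3 := abs_le.1 hε2.2.le
    rw [Real.sin_arcsin (by rw [le_div_iff₀ hr]; linarith) (by rw [div_le_one hr]; linarith)]
    field_simp
  set t := Real.arcsin (ε / r)
  have hd' : ∀ y, Θ (Real.sin (Real.pi * y) ^ 2) + ε * E (Real.sin (Real.pi * y) ^ 2) =
      (deriv (Φ' t) y + deriv (Φ' t) (-y)) / 2 := fun y => by
    rw [hGd, hGd, hsin, hd, mul_neg, Real.sin_neg, neg_sq]
    ring
  have hF₂ := F₂_eq_pendulumAction (U := (U.1, G t)) (Θ := fun x => Θ x + ε * E x) (hGn t) hd'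
  refine isNondegenerate_of_densities (U := (U.1, G t)) h₁ (hGn t) rfl rfl hlt hΘ hE2 hΘ₁ hd₁ hd'
    hK₀ hK₀K hz ht₁ ht₄ ?_ ?_
  · rw [hF₂]
    exact hr₂
  · rw [hF₂]
    have h3 : (α₂ - β₂ + 2 * β₂ - (α₂ - β₂)) / (2 * β₂) = 1 := by field_simp; ring
    simp only [h3]
    exact hr₃

end Liouville

theorem theorem2 :
    Dense {U : Liouville.Omega | Liouville.IsNondegenerate U.1} := by
  intro U
  obtain ⟨G, hG, hG0, hΩ, hfreq⟩ := Liouville.exists_nondegenerate_curve U.2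
  rw [mem_closure_iff_frequently]
  have h1 : Continuous fun t => (⟨(U.1.1, G t), hΩ t⟩ : Liouville.Omega) :=
    (continuous_const.prodMk hG).subtype_mk _
  have h2 := h1.tendsto 0
  have h3 : (⟨(U.1.1, G 0), hΩ 0⟩ : Liouville.Omega) = U := Subtype.ext (Prod.ext rfl hG0)
  rw [h3] at h2
  exact h2.frequently hfreq
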